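/- **Setting.** Let $d\ge 1$, $\nu_1,\dots,\nu_d>0$, and let $k$ be the stationary kernel on $\mathbb R^d$ whose spectral measure is the product $p=\bigotimes_j p_j$ with $p_j=\mathcal N(0,\nu_j^{-2})$ (density proportional to $\exp(-\sum_j\omega_j^2\nu_j^2/2)$), i.e. $k(x,y)=\int\big(\sin(\omega^\top x)\sin(\omega^\top y)+\cos(\omega^\top x)\cos(\omega^\top y)\big)\,p(d\omega)$. Let $\mathcal D=[0,1]^d$, let $\mathcal H_k$ be the RKHS of $k$ on $\mathcal D$, and fix $B\ge 0$, $\rho,\lambda>0$. The reward function $f\in\mathcal H_k$ is unknown, with $\|f\|_k\le B$. In round $t=1,\dots,T$ a user with decision set $\mathcal D_t\subseteq\mathcal D$ (possibly depending on the past) plays $x_t\in\mathcal D_t$ and obtains $y_t=f(x_t)+\varepsilon_t$, where $\varepsilon_t$ is $\rho$-sub-Gaussian with mean zero conditionally on the past (including $x_t$). The pseudoregret is $\mathfrak R(T)=\sum_{t\le T}\big(\sup_{x\in\mathcal D_t}f(x)-f(x_t)\big)$. The maximum information gain is $\gamma_T=\sup_{A\subset\mathcal D,\,|A|=T}\big[H(y_A)-H(y_A\mid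 f)\big]$, with $H$ the differential entropy, $f\sim GP(0,k)$ and $y_A=f_A+\mathcal N(0,\rho^2I)$. **Features.** Let $\bar m=\lceil 6\ln T\rceil$ and $m=\bar m^d$. Let $z$ range over the $d$-tuples of zeros of the probabilists' Hermite polynomial $He_{\bar m}$, with weights $W_z=\prod_j \bar m!/(\bar m^2He_{\bar m-1}(z_j)^2)$, and let $\Phi(x)\in\mathbb R^{2m}$ have the entries $\sqrt{W_z}\cos(\sum_j z_jx_j/\nu_j)$ and $\sqrt{W_z}\sin(\sum_j z_jx_j/\nu_j)$. **Algorithm** (noise levels $\sigma_X,\sigma_u>0$, confidence parameter $\zeta$). Put $\Lambda=\sqrt T\,(4\sqrt{2m}+2\ln\frac{2T}\zeta)$, $\lambda_{\min}=\sigma_X\Lambda$, $\lambda_{\max}=3\sigma_X\Lambda$, $\kappa=\sigma_u\sqrt{T/\lambda_{\min}}\,(\sqrt{2m}+\sqrt{2\ln\frac{2T}{\zeta}})$, $\epsilon=d2^{d-1}\sqrt{\pi/2}\;\bar m^{-\bar m}\big(\tfrac{e}{4\min_j\nu_j^2}\big)^{\bar m}$. The server starts with $\widetilde\Sigma_1=2\sigma_X\Lambda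 I$, $\widetilde u_1=0$. In round $t$ it sends $(\widetilde\Sigma_t,\widetilde u_t)$ to client $t$, who sets $V_t=\widetilde\Sigma_t+\lambda I$, $\widetilde\theta_t=V_t^{-1}\widetilde u_t$, $$\beta_t^{1/2}=\frac{B\sqrt{\lambda_{\max}+\lambda}}{\rho}+\frac{tB\epsilon}{\rho\sqrt{\lambda_{\min}}}+\frac\kappa\rho+\sqrt{\ln\det\frac{V_t}{\lambda+\lambda_{\min}}+2\ln\frac2\zeta},$$ plays a maximizer $x_t$ of $\langle\widetilde\theta_t,\Phi(x)\rangle+\beta_t^{1/2}\rho\|\Phi(x)\|_{V_t^{-1}}$ over $\mathcal D_t$, obtains $y_t$, and sends back $\widetilde\Sigma_{t+1}=\widetilde\Sigma_t+\Phi(x_t)\Phi(x_t)^\top+N_t$ and $\widetilde u_{t+1}=\widetilde u_t+y_t\Phi(x_t)+n_t$. Here $N_t$ is a symmetric matrix whose entries on and below the diagonal are i.i.d. $\mathcal N(0,\sigma_X^2)$, $n_t$ has i.i.d. $\mathcal N(0,\sigma_u^2)$ entries, and $N_t,n_t$ are independent of each other, of the past and of $\varepsilon_t$. **Privacy.** The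 algorithm is $(\alpha,\beta)$-locally jointly differentially private if, in every round and for every state $(\widetilde\Sigma,\widetilde u)$ sent by the server, the law $Q$ of the client's message (over the reward and $N_t,n_t$) satisfies $Q(S)\le e^\alpha Q'(S)+\beta$ for all measurable $S$, where $Q,Q'$ correspond to any two users, each with its own decision set and its own law of the response to every action, with mean in $[-B,B]$ and $\rho$-sub-Gaussian about the mean. **Claim.** For all $\alpha_0>0$ and $q<1$ there is a constant $C>0$, depending only on $d,\nu,B,\rho,\lambda,\alpha_0,q$, such that for all $T\ge2$, $\alpha\in(0,\alpha_0]$ and $\beta,\zeta\in(0,q]$ there are noise levels $\sigma_X,\sigma_u>0$, not depending on $f$, the decision sets or the reward noise, with $$\sigma_X^2\ge\frac8{\alpha^2}\ln\frac5{2\beta},\qquad \sigma_u^2\ge\frac{8}{\alpha^2}\Big(B^2+2\rho^2\ln\frac{8m}\beta\Big)\ln\frac5\beta,$$ for which the algorithm is $(\alpha,\beta)$-locally jointly differentially private and, for every $f$ with $\|f\|_k\le B$ and every environment as above, with probability at least $1-\zeta$, $$\mathfrak R(T)\le C\,T^{3/4}(\ln T)^{\frac{d+2}4}\sqrt{\frac{\gamma_T}{\alpha}\ln\frac1\beta\,\ln\frac1\zeta}.$$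 -/

import Mathlib

noncomputable section

open MeasureTheory ProbabilityTheory

namespace PrivateGP

/-! ### The action space and the kernel -/

/-- The action space `[0,1]^d`. -/
abbrev Cube (d : ℕ) : Set (Fin d → ℝ) := Set.Icc 0 1

/-- `k` is a (normalised) stationary kernel on `ℝ^d` whose spectral measure is the product of the
one-dimensional measures `p j`:
`k(x,y) = ∫ (sin ωᵀx sin ωᵀy + cos ωᵀx cos ωᵀy) p(dω)`, `p = ⊗ⱼ pⱼ`. -/
structure IsDecomposable {d : ℕ} (k : (Fin d → ℝ) → (Fin d → ℝ) → ℝ)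
    (p : Fin d → Measure ℝ) : Prop where
  isProbability : ∀ j, IsProbabilityMeasure (p j)
  bochner : ∀ x y, k x y = ∫ ω, (Real.sin (ω ⬝ᵥ x) * Real.sin (ω ⬝ᵥ y)
    + Real.cos (ω ⬝ᵥ x) * Real.cos (ω ⬝ᵥ y)) ∂(Measure.pi p)

/-! ### Maximum information gain -/

/-- Density of the centred Gaussian law on `ℝ^ι` with (nonsingular) covariance matrix `S`. -/
def gaussianDensity {ι : Type*} [Fintype ι] [DecidableEq ι] (S : Matrix ι ι ℝ) (y : ι → ℝ) : ℝ :=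
  (Real.sqrt ((2 * Real.pi) ^ Fintype.card ι * S.det))⁻¹ * Real.exp (-(y ⬝ᵥ S⁻¹.mulVec y) / 2)

/-- Differential entropy `-∫ p log p` of a probability density on `ℝ^ι`. -/
def diffEntropy {ι : Type*} [Fintype ι] (p : (ι → ℝ) → ℝ) : ℝ :=
  ∫ y, Real.negMulLog (p y)

/-- Information gain `H(y_A) - H(y_A | f)` of the observations `y_A = f_A + ε_A` at the points of
`A`, for `f ∼ GP(0, k)` and `ε_A ∼ N(0, ρ² I)`. The law of `y_A` is `N(0, K_A + ρ² I)`; given `f`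
it is the translate by `f_A` of `N(0, ρ² I)`, and differential entropy is translation invariant. -/
def infoGain {d : ℕ} (k : (Fin d → ℝ) → (Fin d → ℝ) → ℝ) (ρ : ℝ)
    (A : Finset (Fin d → ℝ)) : ℝ :=
  diffEntropy (gaussianDensity
      (Matrix.of (fun a b : A => k a b) + (ρ ^ 2) • (1 : Matrix A A ℝ)))
    - diffEntropy (gaussianDensity ((ρ ^ 2) • (1 : Matrix A A ℝ)))

/-- Maximum information gain `γ_T` over the `T`-point subsets of `[0,1]^d`. -/
def maxInfoGain {d : ℕ} (k : (Fin d → ℝ) → (Fin d → ℝ) → ℝ) (ρ : ℝ) (T : ℕ) : ℝ :=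
  sSup {γ : ℝ | ∃ A : Finset (Fin d → ℝ), (A : Set (Fin d → ℝ)) ⊆ Cube d ∧ A.card = T ∧
    γ = infoGain k ρ A}

/-! ### Quadrature Fourier features -/

/-- Nodes of the `n`-point Gauss–Hermite rule for the standard normal law: the zeros of the `n`-th
(probabilists') Hermite polynomial. -/
def hermiteNodes (n : ℕ) : Finset ℝ :=
  ((Polynomial.hermite n).map (Int.castRingHom ℝ)).roots.toFinset

/-- Weight `n! / (n² He_{n-1}(z)²)` of the node `z` of the `n`-point Gauss–Hermite rule for the
standard normal law. -/
def hermiteWeight (n : ℕ) (z : ℝ) : ℝ :=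
  (n.factorial : ℝ) / ((n : ℝ) ^ 2 * (Polynomial.aeval z (Polynomial.hermite (n - 1))) ^ 2)

/-- Index set of the features: a node of the `d`-fold product rule together with the choice of
cosine (`true`) or sine (`false`); it has `2 n^d` elements. -/
abbrev FeatureIndex (d n : ℕ) : Type := (Fin d → hermiteNodes n) × Bool

/-- Quadrature Fourier features for the Gaussian spectral density proportional to
`exp(-∑ⱼ ωⱼ² νⱼ² / 2)`: the node `z` of the product rule gives the frequency `(zⱼ / νⱼ)ⱼ`. -/
def qff {d : ℕ} (ν : Fin d → ℝ) (n : ℕ) (x : Fin d → ℝ) (i : FeatureIndex d n) : ℝ :=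
  Real.sqrt (∏ j, hermiteWeight n (i.1 j)) *
    bif i.2 then Real.cos (∑ j, (i.1 j : ℝ) / ν j * x j)
    else Real.sin (∑ j, (i.1 j : ℝ) / ν j * x j)

/-! ### The algorithm -/

/-- Inputs of the algorithm. -/
structure Params (d : ℕ) where
  /-- horizon -/
  T : ℕ
  /-- length scales of the kernel -/
  ν : Fin d → ℝ
  /-- bound on the RKHS norm of the reward function -/
  B : ℝ
  /-- sub-Gaussian parameter of the reward noise -/
  ρ : ℝ
  /-- regulariser -/
  lam : ℝ
  /-- failure probability of the regret bound -/
  ζ : ℝ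
  /-- standard deviation of the matrix perturbations -/
  σX : ℝ
  /-- standard deviation of the vector perturbations -/
  σu : ℝ

namespace Params

variable {d : ℕ} (P : Params d)

/-- Number of quadrature nodes per coordinate. -/
def mbar : ℕ := ⌈6 * Real.log P.T⌉₊

/-- Number of quadrature nodes. The features have dimension `2 m`. -/
def m : ℕ := P.mbar ^ d

/-- Index set of the features. -/
abbrev Idx : Type := FeatureIndex d P.mbar

/-- The feature map. -/
def Φ (x : Cube d) : P.Idx → ℝ := qff P.ν P.mbar x

/-- `Λ = √T (4 √(2m) + 2 log(2T/ζ))`. -/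
def Lam : ℝ := Real.sqrt P.T * (4 * Real.sqrt (2 * P.m) + 2 * Real.log (2 * P.T / P.ζ))

/-- Lower spectral bound for the accumulated (shifted) matrix noise. -/
def lamMin : ℝ := P.σX * P.Lam

/-- Upper spectral bound for the accumulated (shifted) matrix noise. -/
def lamMax : ℝ := 3 * P.σX * P.Lam

/-- Bound for the accumulated vector noise, in the norm of the inverse matrix noise. -/
def κ : ℝ := P.σu * Real.sqrt (P.T / P.lamMin) *
  (Real.sqrt (2 * P.m) + Real.sqrt (2 * Real.log (2 * P.T / P.ζ)))

/-- Uniform approximation error `d 2^(d-1) √(π/2) (e / (4 ν² m̄))^m̄`, `ν = minⱼ νⱼ`, of the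
quadrature features. -/
def approxError : ℝ :=
  d * 2 ^ (d - 1) * Real.sqrt (Real.pi / 2) * (1 / (P.mbar : ℝ) ^ P.mbar) *
    (Real.exp 1 / (4 * (⨅ j, P.ν j) ^ 2)) ^ P.mbar

/-- What the server holds and sends to the next client: the noisy Gram matrix `Σ̃` and the noisy
vector `ũ`. -/
abbrev State : Type := (P.Idx → P.Idx → ℝ) × (P.Idx → ℝ)

/-- `V = Σ̃ + λ I`. -/
def V (s : P.State) : Matrix P.Idx P.Idx ℝ := Matrix.of s.1 + P.lam • 1

/-- `θ̃ = V⁻¹ ũ`. -/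
def θ (s : P.State) : P.Idx → ℝ := (P.V s)⁻¹.mulVec s.2

/-- The posterior standard deviation `σ̃(x) = ρ ‖Φ(x)‖_{V⁻¹}`. -/
def σpost (s : P.State) (x : Cube d) : ℝ :=
  P.ρ * Real.sqrt (P.Φ x ⬝ᵥ (P.V s)⁻¹.mulVec (P.Φ x))

/-- The confidence multiplier `β_t^{1/2}` in round `t = 1, 2, …`. -/
def sqrtBeta (t : ℕ) (s : P.State) : ℝ :=
  P.B * Real.sqrt (P.lamMax + P.lam) / P.ρ
    + t * P.B * P.approxError / (P.ρ * Real.sqrt P.lamMin)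
    + P.κ / P.ρ
    + Real.sqrt (Real.log ((P.lam + P.lamMin)⁻¹ • P.V s).det + 2 * Real.log (2 / P.ζ))

/-- The upper confidence bound `μ̃_t(x) + β_t^{1/2} σ̃_t(x)`. -/
def ucb (t : ℕ) (s : P.State) (x : Cube d) : ℝ :=
  P.θ s ⬝ᵥ P.Φ x + P.sqrtBeta t s * P.σpost s x

/-- In round `t`, on receiving the state `s`, a client with decision set `D` may play `x`. -/
def IsAction (t : ℕ) (s : P.State) (D : Set (Cube d)) (x : Cube d) : Prop :=
  x ∈ D ∧ IsMaxOn (P.ucb t s) D x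

/-- Initial state of the server. The multiple of the identity makes the accumulated matrix noise
`2 σ_X Λ I + ∑ N_τ` positive definite with high probability. -/
def init : P.State := (fun i j => (2 * P.σX * P.Lam) * (1 : Matrix P.Idx P.Idx ℝ) i j, 0)

/-- The message a client sends after playing `x` and obtaining the reward `y`:
`(Σ̃ + Φ(x)Φ(x)ᵀ + N, ũ + y Φ(x) + n)`, where the symmetric matrix `N` is given by its entries
indexed by unordered pairs. -/
def message (s : P.State) (x : Cube d) (y : ℝ) (N : Sym2 P.Idx → ℝ) (n : P.Idx → ℝ) : P.State :=
  (fun i j => s.1 i j + P.Φ x i * P.Φ x j + N s(i, j), fun i => s.2 i + y * P.Φ x i + n i)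

/-- Law of the perturbation `(N, n)` drawn by one client: independent centred Gaussians, with
variance `σ_X²` for the entries of `N` on and below the diagonal and `σ_u²` for those of `n`. -/
def noiseLaw : Measure ((Sym2 P.Idx → ℝ) × (P.Idx → ℝ)) :=
  (Measure.pi fun _ => gaussianReal 0 (P.σX ^ 2).toNNReal).prod
    (Measure.pi fun _ => gaussianReal 0 (P.σu ^ 2).toNNReal)

/-- Law of the message of a client that plays `x`, with reward law `r`, on receiving `s`. -/
def messageLaw (s : P.State) (x : Cube d) (r : Measure ℝ) : Measure P.State :=
  (r.prod P.noiseLaw).map fun q => P.message s x q.1 q.2.1 q.2.2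

end Params

/-! ### Privacy -/

/-- `(α, β)`-local differential privacy of a randomised map `g`. -/
def IsLocallyDP {X Z : Type*} [MeasurableSpace Z] (g : X → Measure Z) (α β : ℝ) : Prop :=
  ∀ x x' : X, ∀ S : Set Z, MeasurableSet S →
    g x S ≤ ENNReal.ofReal (Real.exp α) * g x' S + ENNReal.ofReal β

/-- The private data of a user: a decision set and the law of the response to each action, whose
mean is at most `B` in absolute value and which is `ρ`-sub-Gaussian about its mean. -/
structure User (d : ℕ) (B ρ : ℝ) where
  decisionSet : Set (Cube d)
  response : Cube d → Measure ℝ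
  isProbability : ∀ x, IsProbabilityMeasure (response x)
  abs_mean_le : ∀ x, |∫ y, y ∂(response x)| ≤ B
  subgaussian : ∀ x, HasSubgaussianMGF (fun y => y - ∫ y', y' ∂(response x)) (ρ ^ 2).toNNReal
    (response x)

/-- `(α, β)`-local joint differential privacy: in every round, whatever the server has sent, the
message of the client is an `(α, β)`-locally differentially private function of the client's data.
The client's own action is not part of the message; all other clients are affected by these data
through the message only. -/
def Params.LocalJDP {d : ℕ} (P : Params d) (α β : ℝ) : Prop :=
  ∀ t ∈ Finset.Icc 1 P.T, ∀ s : P.State,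
    IsLocallyDP (fun q : {q : User d P.B P.ρ × Cube d // P.IsAction t s q.1.decisionSet q.2} =>
      P.messageLaw s q.1.2 (q.1.1.response q.1.2)) α β

/-! ### Runs of the algorithm and regret -/

namespace Params

variable {d : ℕ} (P : Params d) {Ω : Type*}

/-- The server's state at the beginning of round `t + 1`, for actions `x`, reward noise `ε` and
perturbations `N`, `n` (sequences are indexed from `0`, so that `x t` is played in round `t + 1`),
and rewards `y_t = f(x_t) + ε_t`. -/
def serverState (f : Cube d → ℝ) (x : ℕ → Ω → Cube d) (ε : ℕ → Ω → ℝ)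
    (N : ℕ → Ω → Sym2 P.Idx → ℝ) (n : ℕ → Ω → P.Idx → ℝ) (ω : Ω) : ℕ → P.State
  | 0 => P.init
  | t + 1 => P.message (serverState f x ε N n ω t) (x t ω) (f (x t ω) + ε t ω) (N t ω) (n t ω)

/-- A run of the algorithm on a probability space. `ℱ t` is the information available before the
reward of round `t + 1` is drawn, the action of that round included; the decision sets `D t` may
be random and may depend on the past. -/
structure IsRun [mΩ : MeasurableSpace Ω] (μ : Measure Ω) (f : Cube d → ℝ) (ℱ : Filtration ℕ mΩ)
    (D : ℕ → Ω → Set (Cube d)) (x : ℕ → Ω → Cube d) (ε : ℕ → Ω → ℝ)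
    (N : ℕ → Ω → Sym2 P.Idx → ℝ) (n : ℕ → Ω → P.Idx → ℝ) : Prop where
  measurable_action : ∀ t < P.T, Measurable[ℱ t] (x t)
  measurable_noise : ∀ t < P.T, Measurable[ℱ (t + 1)] (ε t)
  measurable_matrix : ∀ t < P.T, Measurable[ℱ (t + 1)] (N t)
  measurable_vector : ∀ t < P.T, Measurable[ℱ (t + 1)] (n t)
  isAction : ∀ t < P.T, ∀ᵐ ω ∂μ,
    P.IsAction (t + 1) (P.serverState f x ε N n ω t) (D t ω) (x t ω)
  integrable_exp : ∀ t < P.T, ∀ a : ℝ, Integrable (fun ω => Real.exp (a * ε t ω)) μ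
  subgaussian : ∀ t < P.T, ∀ a : ℝ,
    μ[fun ω => Real.exp (a * ε t ω) | ℱ t] ≤ᵐ[μ] fun _ => Real.exp (P.ρ ^ 2 * a ^ 2 / 2)
  noise_law : ∀ t < P.T, μ.map (fun ω => (N t ω, n t ω)) = P.noiseLaw
  noise_indep : ∀ t < P.T, Indep (MeasurableSpace.comap (fun ω => (N t ω, n t ω)) inferInstance)
    (ℱ t ⊔ MeasurableSpace.comap (ε t) inferInstance) μ

/-- Cumulative pseudoregret `∑_t (sup_{D_t} f - f(x_t))`. -/
def regret (f : Cube d → ℝ) (D : ℕ → Ω → Set (Cube d)) (x : ℕ → Ω → Cube d) (ω : Ω) : ℝ :=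
  ∑ t ∈ Finset.range P.T, (sSup (f '' D t ω) - f (x t ω))

end Params

end PrivateGP

end

noncomputable section
open MeasureTheory ProbabilityTheory
namespace PrivateGP


/-! ### Quadratic forms and determinants -/

open Matrix

section LinearAlgebra

variable {ι κ : Type*} [Fintype ι] [Fintype κ]

/-! Privacy. Two users who receive the same state produce messages that differ only by a translation
of the Gaussian noise (`Params.message_eq`). The features are unit vectors, so the matrix part is
translated by at most √2 and, if the rewards are at most Y in absolute value, the vector part by at
most 2Y. The Gaussian mechanism (`pi_gaussianReal_shift_le`), with budget α/2 for each part, covers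
such rewards. Rewards are unbounded, so Y is a sub-Gaussian quantile and the excess mass is charged
to β (`Params.localJDP_of_noise`).

Regret. Gauss–Hermite quadrature with about 6 log T nodes per coordinate approximates k within a
constant times T⁻⁶, because the rule is exact below degree 2n and the Taylor remainder of exp(iaz)
is controlled by one Gaussian moment (`norm_sum_hermiteWeight_mul_exp_sub_le`). By duality
(`exists_feature_approx`) f is then within a constant times T⁻³ of a linear function ⟨θ, Φ⟩ with ‖θ‖
≤ B, which makes the problem a linear bandit with negligible misspecification.

Write l for λ_min. With probability at least 1 − ζ/2 the accumulated matrix noise has spectral norm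
at most l in every round, so the server holds the true Gram matrix plus a perturbation between l·I
and 3l·I, and the accumulated vector noise is at most κ in the norm given by l
(`Params.IsRun.measure_noise_le`). With probability at least 1 − ζ/2 the reward noise obeys a
self-normalised bound (`measure_selfNormalised_le`). On both events ridge regression with the noisy
statistics has a valid confidence band (`abs_dotProduct_ridge_sub_le`). Optimism then bounds the
regret by the width of the band times √T times the root of the elliptical potential
(`Params.regret_le_of_good`). By Sylvester's identity the potential is a log-determinant of inner
products of features, and it is compared with the kernel matrix and hence with γ_T
(`log_det_one_add_smul_gramSum_le`).

Rate. The squared width is of order √T (log T)^{(d+2)/2} log(1/β) log(1/ζ)/α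
(`IsTuned.exists_width_sq_le`). It is governed by l, which grows with σ_X, and by κ², which is
proportional to σ_u²/σ_X. Taking σ_X proportional to log(5/β)/α, which is more than privacy needs,
balances the two and leaves a single factor log(1/β). -/

lemma posSemidef_of_forall {A : Matrix ι ι ℝ} (hA : A.IsSymm) (h : ∀ x, 0 ≤ x ⬝ᵥ A *ᵥ x) :
    A.PosSemidef :=
  PosSemidef.of_dotProduct_mulVec_nonneg (by simpa [IsHermitian, IsSymm] using hA) (by simpa using h)

lemma posDef_of_forall {A : Matrix ι ι ℝ} (hA : A.IsSymm) (h : ∀ x, x ≠ 0 → 0 < x ⬝ᵥ A *ᵥ x) :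
    A.PosDef :=
  PosDef.of_dotProduct_mulVec_pos (by simpa [IsHermitian, IsSymm] using hA) (by simpa using h)

lemma _root_.Matrix.PosSemidef.isSymm_real {A : Matrix ι ι ℝ} (hA : A.PosSemidef) : A.IsSymm := by
  simpa [IsHermitian, IsSymm] using hA.isHermitian

lemma _root_.Matrix.IsSymm.dotProduct_mulVec_comm {A : Matrix ι ι ℝ} (hA : A.IsSymm)
    (x y : ι → ℝ) : x ⬝ᵥ A *ᵥ y = y ⬝ᵥ A *ᵥ x := by
  rw [dotProduct_mulVec, ← mulVec_transpose, hA.eq, dotProduct_comm]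

lemma _root_.Matrix.PosSemidef.quadForm_nonneg {A : Matrix ι ι ℝ} (hA : A.PosSemidef)
    (x : ι → ℝ) : 0 ≤ x ⬝ᵥ A *ᵥ x := by
  simpa using hA.dotProduct_mulVec_nonneg x

lemma quadForm_transpose_mul_self (R : Matrix κ ι ℝ) (x : ι → ℝ) :
    x ⬝ᵥ (Rᵀ * R) *ᵥ x = (R *ᵥ x) ⬝ᵥ (R *ᵥ x) := by
  rw [← mulVec_mulVec, dotProduct_mulVec, vecMul_transpose]

lemma posSemidef_vecMulVec (u : ι → ℝ) : (vecMulVec u u).PosSemidef := by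
  simpa using posSemidef_vecMulVec_self_star u

variable [DecidableEq ι]

/-- The factor R turns √(xᵀAx) into the Euclidean norm of Rx, from which these seminorms inherit the
triangle inequality and Cauchy–Schwarz. It also provides the changes of variables in the Gaussian
integrals. -/
lemma _root_.Matrix.PosSemidef.exists_eq_transpose_mul_self {A : Matrix ι ι ℝ}
    (hA : A.PosSemidef) : ∃ R : Matrix ι ι ℝ, A = Rᵀ * R := by
  have h := hA.1.spectral_theorem
  set U := (hA.1.eigenvectorUnitary : Matrix ι ι ℝ) with hU
  refine ⟨diagonal (fun i => Real.sqrt (hA.1.eigenvalues i)) * Uᵀ, ?_⟩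
  rw [transpose_mul, transpose_transpose, diagonal_transpose, Matrix.mul_assoc,
    ← Matrix.mul_assoc (diagonal _) (diagonal _), diagonal_mul_diagonal]
  conv_lhs => rw [h]
  rw [Unitary.conjStarAlgAut_apply, Matrix.mul_assoc]
  congr 2
  congr 1
  ext i
  exact (Real.mul_self_sqrt (hA.eigenvalues_nonneg i)).symm

/-- The seminorm `√(xᵀ A x)` of a positive semidefinite matrix is subadditive. -/
lemma sqrt_quadForm_add_le {A : Matrix ι ι ℝ} (hA : A.PosSemidef) (x y : ι → ℝ) :
    Real.sqrt ((x + y) ⬝ᵥ A *ᵥ (x + y)) ≤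
      Real.sqrt (x ⬝ᵥ A *ᵥ x) + Real.sqrt (y ⬝ᵥ A *ᵥ y) := by
  obtain ⟨R, rfl⟩ := hA.exists_eq_transpose_mul_self
  have key : ∀ z : ι → ℝ, Real.sqrt (z ⬝ᵥ (Rᵀ * R) *ᵥ z) = ‖WithLp.toLp 2 (R *ᵥ z)‖ := by
    intro z
    rw [quadForm_transpose_mul_self, EuclideanSpace.norm_eq]
    simp [dotProduct, sq]
  rw [key, key, key, mulVec_add, WithLp.toLp_add]
  exact norm_add_le _ _

lemma abs_dotProduct_mulVec_le {A : Matrix ι ι ℝ} (hA : A.PosSemidef) (x y : ι → ℝ) :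
    |x ⬝ᵥ A *ᵥ y| ≤ Real.sqrt (x ⬝ᵥ A *ᵥ x) * Real.sqrt (y ⬝ᵥ A *ᵥ y) := by
  obtain ⟨R, rfl⟩ := hA.exists_eq_transpose_mul_self
  have key : ∀ z : ι → ℝ, Real.sqrt (z ⬝ᵥ (Rᵀ * R) *ᵥ z) = ‖WithLp.toLp 2 (R *ᵥ z)‖ := by
    intro z
    rw [quadForm_transpose_mul_self, EuclideanSpace.norm_eq]
    simp [dotProduct, sq]
  rw [key, key, ← mulVec_mulVec, dotProduct_mulVec, vecMul_transpose]
  have := abs_real_inner_le_norm (WithLp.toLp 2 (R *ᵥ x)) (WithLp.toLp 2 (R *ᵥ y))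
  rwa [EuclideanSpace.inner_eq_star_dotProduct, star_trivial, dotProduct_comm] at this

/-- Cauchy–Schwarz for the dual norms of a positive definite matrix. -/
lemma two_mul_dotProduct_sub_le {A : Matrix ι ι ℝ} (hA : A.PosDef) (x y : ι → ℝ) :
    2 * (x ⬝ᵥ y) - y ⬝ᵥ A *ᵥ y ≤ x ⬝ᵥ A⁻¹ *ᵥ x := by
  have h := hA.posSemidef.quadForm_nonneg (y - A⁻¹ *ᵥ x)
  have hu : IsUnit A.det := (Matrix.isUnit_iff_isUnit_det A).1 hA.isUnit
  have e1 : A *ᵥ (A⁻¹ *ᵥ x) = x := by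
    rw [mulVec_mulVec, mul_nonsing_inv _ hu, one_mulVec]
  have e2 : (A⁻¹ *ᵥ x) ⬝ᵥ A *ᵥ y = x ⬝ᵥ y := by
    rw [hA.posSemidef.isSymm_real.dotProduct_mulVec_comm, e1, dotProduct_comm]
  rw [mulVec_sub, sub_dotProduct, dotProduct_sub, dotProduct_sub, e1, e2,
    dotProduct_comm (A⁻¹ *ᵥ x) x, dotProduct_comm y x] at h
  linarith

/-- Inversion reverses the order of positive definite matrices. -/
lemma quadForm_inv_le {A B : Matrix ι ι ℝ} (hA : A.PosDef) (hB : B.PosDef)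
    (h : ∀ x, x ⬝ᵥ A *ᵥ x ≤ x ⬝ᵥ B *ᵥ x) (x : ι → ℝ) :
    x ⬝ᵥ B⁻¹ *ᵥ x ≤ x ⬝ᵥ A⁻¹ *ᵥ x := by
  have h1 := two_mul_dotProduct_sub_le hA x (B⁻¹ *ᵥ x)
  have hu : IsUnit B.det := (Matrix.isUnit_iff_isUnit_det B).1 hB.isUnit
  have e1 : B *ᵥ (B⁻¹ *ᵥ x) = x := by
    rw [mulVec_mulVec, mul_nonsing_inv _ hu, one_mulVec]
  have h2 := h (B⁻¹ *ᵥ x)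
  rw [e1, dotProduct_comm _ x] at h2
  linarith

/-- `‖Aθ‖_{A⁻¹} = ‖θ‖_A`. -/
lemma quadForm_inv_mulVec {A : Matrix ι ι ℝ} (hA : A.PosDef) (x : ι → ℝ) :
    (A *ᵥ x) ⬝ᵥ A⁻¹ *ᵥ (A *ᵥ x) = x ⬝ᵥ A *ᵥ x := by
  have hu : IsUnit A.det := (Matrix.isUnit_iff_isUnit_det A).1 hA.isUnit
  rw [mulVec_mulVec, nonsing_inv_mul _ hu, one_mulVec, dotProduct_comm]

lemma posDef_smul_one {c : ℝ} (hc : 0 < c) : (c • (1 : Matrix ι ι ℝ)).PosDef :=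
  PosDef.one.smul hc

lemma inv_smul_one {c : ℝ} (hc : c ≠ 0) :
    (c • (1 : Matrix ι ι ℝ))⁻¹ = c⁻¹ • (1 : Matrix ι ι ℝ) := by
  apply Matrix.inv_eq_left_inv
  rw [smul_mul_smul_comm, one_mul, inv_mul_cancel₀ hc, one_smul]

lemma quadForm_smul_one (c : ℝ) (x : ι → ℝ) :
    x ⬝ᵥ (c • (1 : Matrix ι ι ℝ)) *ᵥ x = c * (x ⬝ᵥ x) := by
  rw [smul_mulVec, one_mulVec, dotProduct_smul, smul_eq_mul]

lemma quadForm_inv_le_div {B : Matrix ι ι ℝ} {c : ℝ} (hc : 0 < c) (hB : B.PosDef)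
    (h : ∀ x, c * (x ⬝ᵥ x) ≤ x ⬝ᵥ B *ᵥ x) (x : ι → ℝ) :
    x ⬝ᵥ B⁻¹ *ᵥ x ≤ (x ⬝ᵥ x) / c := by
  have := quadForm_inv_le (posDef_smul_one hc) hB (by simpa [quadForm_smul_one] using h) x
  rwa [inv_smul_one hc.ne', quadForm_smul_one, inv_mul_eq_div] at this

lemma det_one_add_smul_eq_prod {K : Matrix ι ι ℝ} (hK : K.IsHermitian) (a : ℝ) :
    (1 + a • K).det = ∏ i, (1 + a * hK.eigenvalues i) := by
  have h := hK.spectral_theorem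
  have hU : (hK.eigenvectorUnitary : Matrix ι ι ℝ) * star (hK.eigenvectorUnitary : Matrix ι ι ℝ)
      = 1 := Unitary.coe_mul_star_self _
  have e : (1 : Matrix ι ι ℝ) + a • K = (hK.eigenvectorUnitary : Matrix ι ι ℝ) *
      diagonal (fun i => 1 + a * hK.eigenvalues i) *
        star (hK.eigenvectorUnitary : Matrix ι ι ℝ) := by
    have e2 : diagonal (fun i => 1 + a * hK.eigenvalues i) =
        (1 : Matrix ι ι ℝ) + a • diagonal (RCLike.ofReal ∘ hK.eigenvalues) := by
      rw [← diagonal_one, ← diagonal_smul, diagonal_add]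
      rfl
    rw [e2, mul_add, add_mul, mul_one, hU, Matrix.mul_smul, Matrix.smul_mul]
    conv_lhs => rw [h, Unitary.conjStarAlgAut_apply]
  rw [e, det_mul, det_mul, mul_right_comm, ← det_mul, hU, det_one, one_mul, det_diagonal]

lemma one_le_det_one_add {K : Matrix ι ι ℝ} (hK : K.PosSemidef) : 1 ≤ (1 + K).det := by
  have := det_one_add_smul_eq_prod hK.1 1
  rw [one_smul] at this
  rw [this]
  refine Finset.prod_const_one.symm.trans_le (Finset.prod_le_prod (fun i _ => zero_le_one)
    fun i _ => ?_)
  linarith [hK.eigenvalues_nonneg i]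

lemma one_add_trace_le_det_one_add {K : Matrix ι ι ℝ} (hK : K.PosSemidef) :
    1 + K.trace ≤ (1 + K).det := by
  have h1 := det_one_add_smul_eq_prod hK.1 1
  rw [one_smul] at h1
  have h2 := hK.1.trace_eq_sum_eigenvalues
  rw [h1, h2]
  have : ∀ s : Finset ι, 1 + ∑ i ∈ s, hK.1.eigenvalues i ≤ ∏ i ∈ s, (1 + hK.1.eigenvalues i) ∧
      1 ≤ ∏ i ∈ s, (1 + hK.1.eigenvalues i) := by
    intro s
    induction s using Finset.induction_on with
    | empty => simp
    | insert a s ha ih =>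
      rw [Finset.sum_insert ha, Finset.prod_insert ha]
      have := hK.eigenvalues_nonneg a
      constructor <;> nlinarith [ih.1, ih.2]
  simpa using (this Finset.univ).1

lemma log_det_one_add_le_trace {K : Matrix ι ι ℝ} (hK : K.PosSemidef) :
    Real.log (1 + K).det ≤ K.trace := by
  have h1 := det_one_add_smul_eq_prod hK.1 1
  rw [one_smul] at h1
  have h2 := hK.1.trace_eq_sum_eigenvalues
  have h3 : ∀ i, 0 < 1 + 1 * hK.1.eigenvalues i := fun i => by
    have := hK.eigenvalues_nonneg i
    linarith
  rw [h1, h2, Real.log_prod (fun i _ => (h3 i).ne')]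
  refine Finset.sum_le_sum fun i _ => ?_
  have := Real.log_le_sub_one_of_pos (h3 i)
  simpa using this

/-- Bernoulli's inequality with exponent max(1, a). -/
lemma log_one_add_mul_le {a u : ℝ} (ha : 0 ≤ a) (hu : 0 ≤ u) :
    Real.log (1 + a * u) ≤ max 1 a * Real.log (1 + u) := by
  have h1 : 1 + a * u ≤ (1 + u) ^ (max 1 a) := by
    have := one_add_mul_self_le_rpow_one_add (s := u) (by linarith) (le_max_left 1 a)
    have h2 : a * u ≤ max 1 a * u := mul_le_mul_of_nonneg_right (le_max_right _ _) hu
    linarith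
  have h0 : 0 < 1 + a * u := by positivity
  calc Real.log (1 + a * u) ≤ Real.log ((1 + u) ^ (max 1 a)) := Real.log_le_log h0 h1
    _ = _ := Real.log_rpow (by linarith) _

/-- Applied eigenvalue by eigenvalue, `log_one_add_mul_le` allows the regulariser in a
log-determinant to be changed at the price of a constant factor. This is how λ + λ_min is exchanged
for the noise variance ρ² in γ_T. -/
lemma log_det_one_add_smul_le {K : Matrix ι ι ℝ} (hK : K.PosSemidef) {a : ℝ} (ha : 0 ≤ a) :
    Real.log (1 + a • K).det ≤ max 1 a * Real.log (1 + K).det := by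
  have h1 := det_one_add_smul_eq_prod hK.1 1
  rw [one_smul] at h1
  have h0 := hK.eigenvalues_nonneg
  rw [h1, det_one_add_smul_eq_prod hK.1 a, Real.log_prod, Real.log_prod, Finset.mul_sum]
  · refine Finset.sum_le_sum fun i _ => ?_
    rw [one_mul]
    exact log_one_add_mul_le ha (h0 i)
  · intro i _
    have := h0 i
    positivity
  · intro i _
    have := mul_nonneg ha (h0 i)
    positivity

/-- Writing B = A + RᵀR, the quotient of the determinants is det(1 + R A⁻¹ Rᵀ), which is at least 1.
-/
lemma det_le_det {A B : Matrix ι ι ℝ} (hA : A.PosDef) (hB : B.IsSymm)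
    (h : ∀ x, x ⬝ᵥ A *ᵥ x ≤ x ⬝ᵥ B *ᵥ x) : A.det ≤ B.det := by
  have hC : (B - A).PosSemidef := by
    refine posSemidef_of_forall (hB.sub hA.posSemidef.isSymm_real) fun x => ?_
    rw [sub_mulVec, dotProduct_sub]
    linarith [h x]
  obtain ⟨R, hR⟩ := hC.exists_eq_transpose_mul_self
  have hu : IsUnit A.det := (Matrix.isUnit_iff_isUnit_det A).1 hA.isUnit
  have e : B = A + Rᵀ * R := by rw [← hR]; abel
  rw [e, det_add_mul _ _ hu]
  have : (R * A⁻¹ * Rᵀ).PosSemidef := by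
    simpa using hA.inv.posSemidef.mul_mul_conjTranspose_same R
  nlinarith [one_le_det_one_add this, hA.det_pos]

/-- The rank-one update of the determinant. -/
lemma det_add_vecMulVec {A : Matrix ι ι ℝ} (hA : A.PosDef) (u : ι → ℝ) :
    (A + vecMulVec u u).det = A.det * (1 + u ⬝ᵥ A⁻¹ *ᵥ u) := by
  have hu : IsUnit A.det := (Matrix.isUnit_iff_isUnit_det A).1 hA.isUnit
  have e : vecMulVec u u = replicateCol Unit u * replicateRow Unit u := by
    ext i j
    simp [vecMulVec_apply, Matrix.mul_apply]
  rw [e, det_add_replicateCol_mul_replicateRow hu,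
    det_unique (1 + replicateRow Unit u * A⁻¹ * replicateCol Unit u)]
  congr 1
  rw [Matrix.add_apply, Matrix.one_apply_eq, Matrix.mul_assoc]
  simp [Matrix.mul_apply, dotProduct, mulVec]

lemma le_mul_log_one_add {c u : ℝ} (hc : 0 < c) (hu : 0 ≤ u) (huc : u ≤ 1 / c) :
    u ≤ (1 + 1 / c) * Real.log (1 + u) := by
  have h1 : u / (1 + u) ≤ Real.log (1 + u) := by
    have := Real.one_sub_inv_le_log_of_pos (x := 1 + u) (by linarith)
    have e : u / (1 + u) = 1 - (1 + u)⁻¹ := by field_simp; ring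
    linarith
  have h2 : u ≤ (1 + 1 / c) * (u / (1 + u)) := by
    rw [← mul_div_assoc, le_div_iff₀ (by linarith)]
    nlinarith
  exact h2.trans (mul_le_mul_of_nonneg_left h1 (by positivity))

/-- The elliptical potential lemma. -/
lemma sum_quadForm_inv_le {X : ℕ → ι → ℝ} {c : ℝ} (hc : 0 < c) (hX : ∀ t, X t ⬝ᵥ X t ≤ 1)
    (T : ℕ) :
    ∑ t ∈ Finset.range T, X t ⬝ᵥ
        (c • (1 : Matrix ι ι ℝ) + ∑ s ∈ Finset.range t, vecMulVec (X s) (X s))⁻¹ *ᵥ X t ≤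
      (1 + 1 / c) * Real.log (1 + c⁻¹ • ∑ s ∈ Finset.range T, vecMulVec (X s) (X s)).det := by
  set G : ℕ → Matrix ι ι ℝ := fun t => ∑ s ∈ Finset.range t, vecMulVec (X s) (X s) with hG
  have hGp : ∀ t, (G t).PosSemidef := fun t =>
    posSemidef_sum _ fun s _ => posSemidef_vecMulVec _
  have hpd : ∀ t, (c • (1 : Matrix ι ι ℝ) + G t).PosDef := fun t =>
    (posDef_smul_one hc).add_posSemidef (hGp t)
  have hdet : ∀ t, (1 + c⁻¹ • G t).det = (c⁻¹) ^ Fintype.card ι * (c • 1 + G t).det := by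
    intro t
    rw [← det_smul, smul_add, smul_smul, inv_mul_cancel₀ hc.ne', one_smul]
  change ∑ t ∈ Finset.range T, X t ⬝ᵥ (c • (1 : Matrix ι ι ℝ) + G t)⁻¹ *ᵥ X t ≤
    (1 + 1 / c) * Real.log (1 + c⁻¹ • G T).det
  induction T with
  | zero => simp [hG]
  | succ T ih =>
    rw [Finset.sum_range_succ]
    have h0 := (hpd T).inv.posSemidef.quadForm_nonneg (X T)
    have hle : X T ⬝ᵥ (c • (1 : Matrix ι ι ℝ) + G T)⁻¹ *ᵥ X T ≤ 1 / c := by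
      refine (quadForm_inv_le_div hc (hpd T) (fun x => ?_) _).trans
        (div_le_div_of_nonneg_right (hX T) hc.le)
      rw [add_mulVec, dotProduct_add, quadForm_smul_one]
      linarith [(hGp T).quadForm_nonneg x]
    have hs : c • (1 : Matrix ι ι ℝ) + G (T + 1) = (c • 1 + G T) + vecMulVec (X T) (X T) := by
      simp only [hG, Finset.sum_range_succ, add_assoc]
    -- The log-determinant grows by log(1 + u), where u is the new quadratic form, and u ≤ 1/c
    -- allows u itself to be bounded by a multiple of this increment. The increments telescope.
    rw [hdet (T + 1), hs, det_add_vecMulVec (hpd T), ← mul_assoc, ← hdet T, Real.log_mul, mul_add]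
    · linarith [le_mul_log_one_add hc h0 hle]
    · have := one_le_det_one_add ((hGp T).smul (inv_nonneg.2 hc.le))
      positivity
    · positivity

end LinearAlgebra
end PrivateGP
end

noncomputable section
open MeasureTheory ProbabilityTheory
namespace PrivateGP

/-! ### Gaussian integrals and the information gain -/

open Matrix

section GaussianIntegral

variable {ι : Type*} [Fintype ι] [DecidableEq ι]

lemma lintegral_comp_mulVec {R : Matrix ι ι ℝ} (hR : R.det ≠ 0) {f : (ι → ℝ) → ENNReal}
    (hf : Measurable f) : ∫⁻ x, f (R *ᵥ x) = ENNReal.ofReal |(R.det)⁻¹| * ∫⁻ x, f x := by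
  have h := Real.map_matrix_volume_pi_eq_smul_volume_pi hR
  have hm : Measurable (toLin' R) := (LinearMap.continuous_on_pi _).measurable
  have := lintegral_map (μ := volume) hf hm
  rw [h, lintegral_smul_measure, smul_eq_mul] at this
  rw [this]
  simp

lemma integral_comp_mulVec {R : Matrix ι ι ℝ} (hR : R.det ≠ 0) {f : (ι → ℝ) → ℝ}
    (hf : Measurable f) : ∫ x, f (R *ᵥ x) = |(R.det)⁻¹| * ∫ x, f x := by
  have h := Real.map_matrix_volume_pi_eq_smul_volume_pi hR
  have hm : Measurable (toLin' R) := (LinearMap.continuous_on_pi _).measurable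
  have := integral_map (μ := volume) hm.aemeasurable (f := f) hf.aestronglyMeasurable
  rw [h, integral_smul_measure, smul_eq_mul, ENNReal.toReal_ofReal (abs_nonneg _)] at this
  rw [this]
  simp

lemma exp_neg_dotProduct_self (x : ι → ℝ) :
    Real.exp (-(x ⬝ᵥ x) / 2) = ∏ i, Real.exp (-(1 / 2) * x i ^ 2) := by
  rw [← Real.exp_sum, dotProduct, ← Finset.mul_sum]
  congr 1
  simp only [sq]
  ring

lemma integrable_exp_neg_dotProduct_self :
    Integrable fun x : ι → ℝ => Real.exp (-(x ⬝ᵥ x) / 2) := by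
  simp only [exp_neg_dotProduct_self]
  exact Integrable.fintype_prod fun _ => integrable_exp_neg_mul_sq (by norm_num)

lemma integral_exp_neg_dotProduct_self :
    ∫ x : ι → ℝ, Real.exp (-(x ⬝ᵥ x) / 2) = Real.sqrt ((2 * Real.pi) ^ Fintype.card ι) := by
  simp only [exp_neg_dotProduct_self]
  rw [integral_fintype_prod_volume_eq_pow fun x : ℝ => Real.exp (-(1 / 2) * x ^ 2),
    integral_gaussian]
  refine ((Real.sqrt_eq_iff_mul_self_eq (by positivity) (by positivity)).2 ?_).symm
  rw [← mul_pow, Real.mul_self_sqrt (by positivity)]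
  congr 1
  ring

lemma integrable_dotProduct_self_mul_exp :
    Integrable fun x : ι → ℝ => (x ⬝ᵥ x) * Real.exp (-(x ⬝ᵥ x) / 2) := by
  have h : ∀ i : ι, Integrable fun x : ι → ℝ =>
      ∏ j, (if j = i then (x j) ^ 2 * Real.exp (-(1 / 2) * x j ^ 2)
        else Real.exp (-(1 / 2) * x j ^ 2)) := by
    intro i
    refine Integrable.fintype_prod (f := fun j y => if j = i then y ^ 2 * Real.exp (-(1 / 2) * y ^ 2)
        else Real.exp (-(1 / 2) * y ^ 2)) fun j => ?_
    by_cases hj : j = i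
    · simp only [hj, if_true]
      have := integrable_rpow_mul_exp_neg_mul_sq (b := 1 / 2) (by norm_num) (s := 2) (by norm_num)
      simpa using this
    · simp only [hj, if_false]
      exact integrable_exp_neg_mul_sq (by norm_num)
  refine (integrable_finsetSum Finset.univ fun i _ => h i).congr (Filter.Eventually.of_forall ?_)
  intro x
  simp only
  rw [exp_neg_dotProduct_self, dotProduct, Finset.sum_mul]
  refine Finset.sum_congr rfl fun i _ => ?_
  rw [← Finset.mul_prod_erase _ _ (Finset.mem_univ i), ← Finset.mul_prod_erase _ _ (Finset.mem_univ i),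
    if_pos rfl, ← mul_assoc, ← sq]
  congr 1
  refine Finset.prod_congr rfl fun j hj => ?_
  rw [if_neg (Finset.ne_of_mem_erase hj)]

/-- The Gaussian integral with a linear term. -/
lemma lintegral_exp_linear_sub_quadForm {A : Matrix ι ι ℝ} (hA : A.PosDef) (s : ι → ℝ) :
    ∫⁻ x, ENNReal.ofReal (Real.exp (x ⬝ᵥ s - x ⬝ᵥ A *ᵥ x / 2)) =
      ENNReal.ofReal (Real.sqrt ((2 * Real.pi) ^ Fintype.card ι / A.det) *
        Real.exp (s ⬝ᵥ A⁻¹ *ᵥ s / 2)) := by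
  obtain ⟨R, hR⟩ := hA.posSemidef.exists_eq_transpose_mul_self
  have hdet : A.det = R.det ^ 2 := by rw [hR, det_mul, det_transpose, sq]
  have hR0 : R.det ≠ 0 := by
    intro h
    have := hA.det_pos
    rw [hdet, h] at this
    norm_num at this
  have hu : IsUnit A.det := (Matrix.isUnit_iff_isUnit_det A).1 hA.isUnit
  have e1 : A *ᵥ (A⁻¹ *ᵥ s) = s := by
    rw [mulVec_mulVec, mul_nonsing_inv _ hu, one_mulVec]
  have key : ∀ y, (A⁻¹ *ᵥ s + y) ⬝ᵥ s - (A⁻¹ *ᵥ s + y) ⬝ᵥ A *ᵥ (A⁻¹ *ᵥ s + y) / 2 =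
      s ⬝ᵥ A⁻¹ *ᵥ s / 2 + -((R *ᵥ y) ⬝ᵥ (R *ᵥ y)) / 2 := by
    intro y
    rw [← quadForm_transpose_mul_self, ← hR, mulVec_add, e1, add_dotProduct, add_dotProduct,
      dotProduct_add, dotProduct_add,
      hA.posSemidef.isSymm_real.dotProduct_mulVec_comm (A⁻¹ *ᵥ s) y, e1,
      dotProduct_comm s (A⁻¹ *ᵥ s)]
    ring
  -- The square is completed by translating to the maximiser A⁻¹s. The substitution y ↦ Ry then
  -- reduces to the standard Gaussian integral.
  rw [← lintegral_add_left_eq_self _ (A⁻¹ *ᵥ s)]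
  simp only [key, Real.exp_add, ENNReal.ofReal_mul (Real.exp_pos _).le]
  have hm : Measurable fun y : ι → ℝ => ENNReal.ofReal (Real.exp (-(y ⬝ᵥ y) / 2)) := by
    unfold dotProduct
    fun_prop
  rw [lintegral_const_mul, lintegral_comp_mulVec (f := fun y => ENNReal.ofReal
    (Real.exp (-(y ⬝ᵥ y) / 2))) hR0 hm, ← ofReal_integral_eq_lintegral_ofReal
    integrable_exp_neg_dotProduct_self (Filter.Eventually.of_forall fun _ => (Real.exp_pos _).le),
    integral_exp_neg_dotProduct_self, ← ENNReal.ofReal_mul (abs_nonneg _),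
    ← ENNReal.ofReal_mul (Real.exp_pos _).le]
  · congr 1
    rw [hdet, Real.sqrt_div' _ (sq_nonneg _), Real.sqrt_sq_eq_abs, abs_inv]
    ring
  · unfold dotProduct mulVec dotProduct
    fun_prop

/-- The entropy of a centred Gaussian law depends on its covariance through the determinant. -/
lemma diffEntropy_gaussianDensity {S : Matrix ι ι ℝ} (hS : S.PosDef) :
    diffEntropy (gaussianDensity S) =
      diffEntropy (gaussianDensity (1 : Matrix ι ι ℝ)) + Real.log S.det / 2 := by
  obtain ⟨Q, hQ⟩ := hS.posSemidef.exists_eq_transpose_mul_self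
  obtain ⟨R, rfl⟩ : ∃ R : Matrix ι ι ℝ, Q = Rᵀ := ⟨Qᵀ, (transpose_transpose Q).symm⟩
  have hR : S = R * Rᵀ := by rw [hQ, transpose_transpose]
  have hdet : S.det = R.det ^ 2 := by rw [hR, det_mul, det_transpose, sq]
  have hR0 : R.det ≠ 0 := by
    intro h
    have := hS.det_pos
    rw [hdet, h] at this
    norm_num at this
  have hRu : IsUnit R.det := isUnit_iff_ne_zero.2 hR0
  have hpos : 0 < |R.det| := abs_pos.2 hR0
  set c : ℝ := Real.sqrt ((2 * Real.pi) ^ Fintype.card ι) with hc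
  have hc0 : 0 < c := Real.sqrt_pos.2 (by positivity)
  have hp1 : ∀ z : ι → ℝ, gaussianDensity (1 : Matrix ι ι ℝ) z =
      c⁻¹ * Real.exp (-(z ⬝ᵥ z) / 2) := by
    intro z
    simp [gaussianDensity, hc]
  -- With S = RRᵀ the substitution y = Rz carries N(0, S) to the standard normal law, and the
  -- entropy changes by the logarithm of the Jacobian.
  have hpS : ∀ z, gaussianDensity S (R *ᵥ z) =
      |R.det|⁻¹ * gaussianDensity (1 : Matrix ι ι ℝ) z := by
    intro z
    rw [hp1]
    unfold gaussianDensity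
    have e : (R *ᵥ z) ⬝ᵥ S⁻¹ *ᵥ (R *ᵥ z) = z ⬝ᵥ z := by
      rw [hR, Matrix.mul_inv_rev, mulVec_mulVec, Matrix.mul_assoc, nonsing_inv_mul _ hRu, mul_one,
        dotProduct_mulVec, ← transpose_nonsing_inv, vecMul_transpose, mulVec_mulVec,
        nonsing_inv_mul _ hRu, one_mulVec]
    rw [e, hdet, Real.sqrt_mul (by positivity), Real.sqrt_sq_eq_abs, ← hc, mul_inv]
    ring
  have hmS : Measurable fun y => Real.negMulLog (gaussianDensity S y) := by
    refine Real.continuous_negMulLog.measurable.comp ?_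
    unfold gaussianDensity dotProduct mulVec dotProduct
    fun_prop
  have h1 := integral_comp_mulVec hR0 hmS
  have hi1 : Integrable fun z : ι → ℝ => gaussianDensity (1 : Matrix ι ι ℝ) z := by
    simp only [hp1]
    exact integrable_exp_neg_dotProduct_self.const_mul _
  have hInt1 : ∫ z : ι → ℝ, gaussianDensity (1 : Matrix ι ι ℝ) z = 1 := by
    simp only [hp1]
    rw [integral_const_mul, integral_exp_neg_dotProduct_self, inv_mul_cancel₀ hc0.ne']
  have hi2 : Integrable fun z : ι → ℝ =>
      Real.negMulLog (gaussianDensity (1 : Matrix ι ι ℝ) z) := by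
    have : ∀ z : ι → ℝ, Real.negMulLog (gaussianDensity (1 : Matrix ι ι ℝ) z) =
        (c⁻¹ * Real.log c) * Real.exp (-(z ⬝ᵥ z) / 2) +
          (c⁻¹ / 2) * ((z ⬝ᵥ z) * Real.exp (-(z ⬝ᵥ z) / 2)) := by
      intro z
      rw [hp1, Real.negMulLog, Real.log_mul (by positivity) (Real.exp_pos _).ne', Real.log_exp,
        Real.log_inv]
      ring
    simp only [this]
    exact (integrable_exp_neg_dotProduct_self.const_mul _).add
      (integrable_dotProduct_self_mul_exp.const_mul _)
  have h2 : ∫ z, Real.negMulLog (gaussianDensity S (R *ᵥ z)) =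
      |R.det|⁻¹ * (diffEntropy (gaussianDensity (1 : Matrix ι ι ℝ)) + Real.log |R.det|) := by
    have : ∀ z, Real.negMulLog (gaussianDensity S (R *ᵥ z)) =
        |R.det|⁻¹ * (Real.negMulLog (gaussianDensity (1 : Matrix ι ι ℝ) z) +
          Real.log |R.det| * gaussianDensity (1 : Matrix ι ι ℝ) z) := by
      intro z
      rw [hpS, Real.negMulLog_mul, Real.negMulLog, Real.log_inv]
      ring
    simp only [this]
    rw [integral_const_mul, integral_add hi2 (hi1.const_mul _), integral_const_mul, hInt1, mul_one]
    rfl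
  rw [h2, abs_inv] at h1
  have h3 := mul_left_cancel₀ (inv_pos.2 hpos).ne' h1
  rw [diffEntropy, ← h3, hdet, ← sq_abs, Real.log_pow]
  push_cast
  ring

end GaussianIntegral

/-- Both entropies contain the entropy of the standard normal law, which cancels in the difference,
as does the log-determinant of ρ²I. -/
lemma infoGain_eq {d : ℕ} {k : (Fin d → ℝ) → (Fin d → ℝ) → ℝ} {ρ : ℝ} (hρ : 0 < ρ)
    (A : Finset (Fin d → ℝ)) (hK : (Matrix.of fun a b : A => k a b).PosSemidef) :
    infoGain k ρ A =
      Real.log (1 + (ρ ^ 2)⁻¹ • Matrix.of fun a b : A => k a b).det / 2 := by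
  have hρ2 : 0 < ρ ^ 2 := by positivity
  have h1 : ((ρ ^ 2) • (1 : Matrix A A ℝ)).PosDef := posDef_smul_one hρ2
  have h2 : ((Matrix.of fun a b : A => k a b) + (ρ ^ 2) • (1 : Matrix A A ℝ)).PosDef :=
    PosDef.posSemidef_add hK h1
  have h3 : (Matrix.of fun a b : A => k a b) + (ρ ^ 2) • (1 : Matrix A A ℝ) =
      (ρ ^ 2) • (1 + (ρ ^ 2)⁻¹ • Matrix.of fun a b : A => k a b) := by
    rw [smul_add, smul_smul, mul_inv_cancel₀ hρ2.ne', one_smul, add_comm]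
  have h4 := one_le_det_one_add (hK.smul (inv_nonneg.2 hρ2.le))
  rw [infoGain, diffEntropy_gaussianDensity h1, diffEntropy_gaussianDensity h2, h3, det_smul,
    det_smul, det_one, mul_one, Real.log_mul (by positivity) (by positivity)]
  ring

end PrivateGP
end

noncomputable section
open MeasureTheory ProbabilityTheory
namespace PrivateGP

/-! ### The squared exponential kernel and its maximum information gain -/

open Matrix Filter Topology

section Kernel

variable {d : ℕ} {k : (Fin d → ℝ) → (Fin d → ℝ) → ℝ} {p : Fin d → Measure ℝ}

/-- A product spectral measure makes k the real part of a product of one-dimensional characteristic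
functions, so the quadrature error can be estimated one coordinate at a time. -/
lemma IsDecomposable.eq_re_prod (hk : IsDecomposable k p) (x y : Fin d → ℝ) :
    k x y = (∏ j, charFun (p j) (x j - y j)).re := by
  have := hk.isProbability
  have e : ∏ j, charFun (p j) (x j - y j) =
      ∫ ω, Complex.exp ((ω ⬝ᵥ (x - y) : ℝ) * Complex.I) ∂(Measure.pi p) := by
    simp only [charFun_apply_real]
    rw [← integral_fintype_prod_eq_prod
      (f := fun j (w : ℝ) => Complex.exp (((x j - y j : ℝ) : ℂ) * w * Complex.I))]
    congr 1
    ext ω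
    rw [← Complex.exp_sum, ← Finset.sum_mul]
    congr 2
    simp only [dotProduct, Pi.sub_apply]
    push_cast
    exact Finset.sum_congr rfl fun j _ => mul_comm _ _
  have hInt : Integrable (fun ω : Fin d → ℝ => Complex.exp ((ω ⬝ᵥ (x - y) : ℝ) * Complex.I))
      (Measure.pi p) := by
    refine Integrable.of_bound (C := 1) (Measurable.aestronglyMeasurable ?_)
      (Eventually.of_forall fun ω => (Complex.norm_exp_ofReal_mul_I _).le)
    unfold dotProduct
    fun_prop
  rw [hk.bochner, e]
  have h2 := integral_re hInt
  rw [show (∫ ω, Complex.exp ((ω ⬝ᵥ (x - y) : ℝ) * Complex.I) ∂(Measure.pi p)).re =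
    RCLike.re (∫ ω, Complex.exp ((ω ⬝ᵥ (x - y) : ℝ) * Complex.I) ∂(Measure.pi p)) from rfl, ← h2]
  congr 1
  ext ω
  simp only [RCLike.re_to_complex, Complex.exp_ofReal_mul_I_re, dotProduct_sub, Real.cos_sub]
  ring

/-- Under the spectral integral the quadratic form is a sum of two squares. -/
lemma IsDecomposable.posSemidef_gram (hk : IsDecomposable k p) {τ : Type*} [Fintype τ]
    (x : τ → Fin d → ℝ) : (Matrix.of fun a b => k (x a) (x b)).PosSemidef := by
  have := hk.isProbability
  refine posSemidef_of_forall ?_ fun a => ?_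
  · ext i j
    simp only [transpose_apply, of_apply, hk.bochner]
    congr 1
    ext ω
    ring
  · have e : a ⬝ᵥ (Matrix.of fun i j => k (x i) (x j)) *ᵥ a =
        ∫ ω, ((∑ i, a i * Real.sin (ω ⬝ᵥ x i)) ^ 2 + (∑ i, a i * Real.cos (ω ⬝ᵥ x i)) ^ 2)
          ∂(Measure.pi p) := by
      have hi : ∀ i j, Integrable (fun ω : Fin d → ℝ =>
          Real.sin (ω ⬝ᵥ x i) * Real.sin (ω ⬝ᵥ x j) + Real.cos (ω ⬝ᵥ x i) * Real.cos (ω ⬝ᵥ x j))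
          (Measure.pi p) := by
        intro i j
        refine Integrable.of_bound (C := 1) (Measurable.aestronglyMeasurable ?_)
          (Eventually.of_forall fun ω => ?_)
        · unfold dotProduct
          fun_prop
        · have : Real.sin (ω ⬝ᵥ x i) * Real.sin (ω ⬝ᵥ x j) +
              Real.cos (ω ⬝ᵥ x i) * Real.cos (ω ⬝ᵥ x j) = Real.cos (ω ⬝ᵥ x i - ω ⬝ᵥ x j) := by
            rw [Real.cos_sub]; ring
          rw [this]
          exact Real.abs_cos_le_one _
      simp only [dotProduct, mulVec, of_apply, Finset.mul_sum, hk.bochner]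
      have : ∀ i j, a i * ((∫ ω, (Real.sin (ω ⬝ᵥ x i) * Real.sin (ω ⬝ᵥ x j) +
          Real.cos (ω ⬝ᵥ x i) * Real.cos (ω ⬝ᵥ x j)) ∂(Measure.pi p)) * a j) =
          ∫ ω, (a i * a j) * (Real.sin (ω ⬝ᵥ x i) * Real.sin (ω ⬝ᵥ x j) +
          Real.cos (ω ⬝ᵥ x i) * Real.cos (ω ⬝ᵥ x j)) ∂(Measure.pi p) := by
        intro i j
        rw [integral_const_mul]
        ring
      calc _ = ∑ i, ∑ j, ∫ ω, (a i * a j) * (Real.sin (ω ⬝ᵥ x i) * Real.sin (ω ⬝ᵥ x j) +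
            Real.cos (ω ⬝ᵥ x i) * Real.cos (ω ⬝ᵥ x j)) ∂(Measure.pi p) :=
            Finset.sum_congr rfl fun i _ => Finset.sum_congr rfl fun j _ => this i j
        _ = ∫ ω, ∑ i, ∑ j, (a i * a j) * (Real.sin (ω ⬝ᵥ x i) * Real.sin (ω ⬝ᵥ x j) +
            Real.cos (ω ⬝ᵥ x i) * Real.cos (ω ⬝ᵥ x j)) ∂(Measure.pi p) := by
            rw [integral_finsetSum _ fun i _ => integrable_finsetSum _ fun j _ =>
              (hi i j).const_mul _]
            refine Finset.sum_congr rfl fun i _ => ?_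
            rw [integral_finsetSum _ fun j _ => (hi i j).const_mul _]
        _ = _ := by
            congr 1
            ext ω
            rw [sq, sq, Finset.sum_mul_sum, Finset.sum_mul_sum, ← Finset.sum_add_distrib]
            refine Finset.sum_congr rfl fun i _ => ?_
            rw [← Finset.sum_add_distrib]
            refine Finset.sum_congr rfl fun j _ => ?_
            simp only [dotProduct]
            ring
    rw [e]
    exact integral_nonneg fun ω => by positivity

lemma IsDecomposable.apply_self (hk : IsDecomposable k p) (x : Fin d → ℝ) : k x x = 1 := by
  have := hk.isProbability
  rw [hk.eq_re_prod]
  simp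

lemma charFun_gaussianReal_inv_sq {ν : ℝ} (a : ℝ) :
    charFun (gaussianReal 0 (1 / ν ^ 2).toNNReal) a = Real.exp (-(a / ν) ^ 2 / 2) := by
  rw [charFun_gaussianReal]
  push_cast
  rw [Real.coe_toNNReal _ (by positivity)]
  congr 1
  push_cast
  ring

lemma continuous_of_gaussian (hk : IsDecomposable k p) {ν : Fin d → ℝ}
    (hp : ∀ j, p j = gaussianReal 0 (1 / (ν j) ^ 2).toNNReal) :
    Continuous fun q : (Fin d → ℝ) × (Fin d → ℝ) => k q.1 q.2 := by
  simp only [hk.eq_re_prod, hp, charFun_gaussianReal_inv_sq]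
  fun_prop

/-- For an unbounded set the real supremum in `maxInfoGain` would take a default value. Boundedness
follows from log det(1 + K) ≤ tr K and k(x, x) = 1. -/
lemma bddAbove_infoGain (hk : IsDecomposable k p) {ρ : ℝ} (hρ : 0 < ρ) (T : ℕ) :
    BddAbove {γ : ℝ | ∃ A : Finset (Fin d → ℝ), (A : Set (Fin d → ℝ)) ⊆ Cube d ∧ A.card = T ∧
      γ = infoGain k ρ A} := by
  refine ⟨(ρ ^ 2)⁻¹ * T / 2, ?_⟩
  rintro γ ⟨A, -, hA, rfl⟩
  have hK := hk.posSemidef_gram fun a : A => (a : Fin d → ℝ)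
  rw [infoGain_eq hρ A hK]
  have h := log_det_one_add_le_trace (hK.smul (a := (ρ ^ 2)⁻¹) (by positivity))
  rw [trace_smul] at h
  have : (Matrix.of fun a b : A => k a b).trace = T := by
    simp [Matrix.trace, hk.apply_self, hA]
  rw [this, smul_eq_mul] at h
  linarith

lemma log_det_le_maxInfoGain_of_injective (hk : IsDecomposable k p) {ρ : ℝ} (hρ : 0 < ρ) {T : ℕ}
    {x : Fin T → Fin d → ℝ} (hx : ∀ i, x i ∈ Cube d) (hinj : Function.Injective x) :
    Real.log (1 + (ρ ^ 2)⁻¹ • Matrix.of fun a b => k (x a) (x b)).det / 2 ≤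
      maxInfoGain k ρ T := by
  classical
  set A : Finset (Fin d → ℝ) := Finset.univ.image x with hA
  have hmem : ∀ i, x i ∈ A := fun i => Finset.mem_image_of_mem _ (Finset.mem_univ i)
  let e : Fin T ≃ A := Equiv.ofBijective (fun i => ⟨x i, hmem i⟩) ⟨fun i j h => hinj (by
    simpa using h), fun ⟨a, ha⟩ => by
      obtain ⟨i, -, rfl⟩ := Finset.mem_image.1 ha
      exact ⟨i, rfl⟩⟩
  refine le_csSup (bddAbove_infoGain hk hρ T) ⟨A, ?_, ?_, ?_⟩
  · intro a ha
    obtain ⟨i, -, rfl⟩ := Finset.mem_image.1 (Finset.mem_coe.1 ha)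
    exact hx i
  · rw [hA, Finset.card_image_of_injective _ hinj]
    simp
  · rw [infoGain_eq hρ A (hk.posSemidef_gram fun a : A => (a : Fin d → ℝ))]
    congr 2
    rw [← det_submatrix_equiv_self e]
    congr 1
    ext i j
    simp only [submatrix_apply, Matrix.add_apply, Matrix.smul_apply, of_apply, one_apply,
      e.injective.eq_iff]
    rfl

/-- The maximum over sets of `T` points bounds the information gain of any `T`-tuple of points. -/
lemma log_det_le_maxInfoGain (hd : 0 < d) (hk : IsDecomposable k p) {ν : Fin d → ℝ}
    (hp : ∀ j, p j = gaussianReal 0 (1 / (ν j) ^ 2).toNNReal) {ρ : ℝ} (hρ : 0 < ρ) {T : ℕ}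
    {x : Fin T → Fin d → ℝ} (hx : ∀ i, x i ∈ Cube d) :
    Real.log (1 + (ρ ^ 2)⁻¹ • Matrix.of fun a b => k (x a) (x b)).det / 2 ≤
      maxInfoGain k ρ T := by
  -- The actions of a run may repeat, whereas γ_T ranges over sets of T distinct points. Moving each
  -- point a small fraction s towards its own reference point on the diagonal stays in the cube and
  -- makes the points distinct for small s > 0. Continuity of the log-determinant then allows s → 0.
  set q : Fin T → Fin d → ℝ := fun i _ => (i : ℝ) / T with hq
  have hqm : ∀ i, q i ∈ Cube d := by
    intro i
    have : (0 : ℝ) < T := by exact_mod_cast (Nat.zero_le _).trans_lt i.2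
    refine ⟨fun _ => by positivity, fun _ => ?_⟩
    simp only [hq, Pi.one_apply]
    rw [div_le_one this]
    exact_mod_cast i.2.le
  set z : ℝ → Fin T → Fin d → ℝ := fun s i => (1 - s) • x i + s • q i with hz
  have hcont : Continuous fun s => Real.log
      (1 + (ρ ^ 2)⁻¹ • Matrix.of fun a b => k (z s a) (z s b)).det / 2 := by
    have hkc := continuous_of_gaussian hk hp
    have hzc : ∀ i, Continuous fun s => z s i := fun i => by fun_prop
    refine Continuous.div_const (Continuous.log ?_ fun s => ?_) _
    · refine Continuous.matrix_det (continuous_matrix fun a b => ?_)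
      simp only [Matrix.add_apply, Matrix.smul_apply, of_apply, smul_eq_mul]
      exact continuous_const.add (continuous_const.mul (hkc.comp ((hzc a).prodMk (hzc b))))
    · have := one_le_det_one_add ((hk.posSemidef_gram (z s)).smul
        (a := (ρ ^ 2)⁻¹) (by positivity))
      positivity
  have hlim := (hcont.tendsto 0).mono_left (nhdsWithin_le_nhds (s := Set.Ioi 0))
  have hz0 : z 0 = x := by
    ext i
    simp [hz]
  simp only [hz0] at hlim
  refine le_of_tendsto hlim ?_
  have h1 : ∀ᶠ s : ℝ in 𝓝[>] 0, s ∈ Set.Ioo (0 : ℝ) 1 :=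
    Ioo_mem_nhdsGT one_pos
  have h2 : ∀ᶠ s : ℝ in 𝓝[>] 0, ∀ i j : Fin T, i ≠ j → z s i ≠ z s j := by
    rw [eventually_all]
    intro i
    rw [eventually_all]
    intro j
    rcases eq_or_ne i j with hij | hij
    · exact Eventually.of_forall fun s h => (h hij).elim
    have hT : (0 : ℝ) < T := by exact_mod_cast (Nat.zero_le _).trans_lt i.2
    set o : Fin d := ⟨0, hd⟩
    have hB : q i o - q j o ≠ 0 := by
      simp only [hq]
      rw [← sub_div, div_ne_zero_iff]
      refine ⟨sub_ne_zero.2 ?_, hT.ne'⟩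
      exact_mod_cast fun h => hij (Fin.ext h)
    have hsub : ∀ s, z s i = z s j → (1 - s) * (x i o - x j o) + s * (q i o - q j o) = 0 := by
      intro s h
      have := congrFun h o
      simp only [hz, Pi.add_apply, Pi.smul_apply, smul_eq_mul] at this
      linarith
    -- If the first coordinates agree, the reference points separate them for every s in (0,1).
    -- Otherwise their difference is affine in s and nonzero at s = 0, hence nonzero near 0.
    by_cases hA : x i o - x j o = 0
    · filter_upwards [h1] with s hs _ h
      have := hsub s h
      rw [hA, mul_zero, zero_add] at this
      exact (mul_ne_zero hs.1.ne' hB) this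
    · have hc : Continuous fun s : ℝ => (1 - s) * (x i o - x j o) + s * (q i o - q j o) := by
        fun_prop
      have : ∀ᶠ s : ℝ in 𝓝 0, (1 - s) * (x i o - x j o) + s * (q i o - q j o) ≠ 0 :=
        hc.continuousAt.eventually_ne (by simpa using hA)
      filter_upwards [this.filter_mono nhdsWithin_le_nhds] with s hs _ h
      exact hs (hsub s h)
  filter_upwards [h1, h2] with s hs hinj
  refine log_det_le_maxInfoGain_of_injective hk hρ (fun i => ?_) fun i j h => ?_
  · exact (convex_Icc (0 : Fin d → ℝ) 1) (hx i) (hqm i) (by linarith [hs.2]) hs.1.le (by ring)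
  · by_contra hne
    exact hinj i j hne h

/-- T copies of a single point are enough, since det(1 + K) ≥ 1 + tr K. The resulting positive lower
bound for γ_T absorbs the lower-order terms of the regret. -/
lemma log_le_maxInfoGain (hd : 0 < d) (hk : IsDecomposable k p) {ν : Fin d → ℝ}
    (hp : ∀ j, p j = gaussianReal 0 (1 / (ν j) ^ 2).toNNReal) {ρ : ℝ} (hρ : 0 < ρ) (T : ℕ) :
    Real.log (1 + (ρ ^ 2)⁻¹ * T) / 2 ≤ maxInfoGain k ρ T := by
  have hK := hk.posSemidef_gram fun _ : Fin T => (0 : Fin d → ℝ)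
  refine le_trans ?_ (log_det_le_maxInfoGain hd hk hp hρ (T := T) (x := fun _ => 0)
    fun _ => ⟨le_rfl, zero_le_one⟩)
  have h := one_add_trace_le_det_one_add (hK.smul (a := (ρ ^ 2)⁻¹) (by positivity))
  have ht : (Matrix.of fun _ _ : Fin T => k 0 0).trace = T := by
    simp [Matrix.trace, hk.apply_self]
  rw [trace_smul, ht, smul_eq_mul] at h
  have := Real.log_le_log (by positivity) h
  linarith

end Kernel

end PrivateGP
end

noncomputable section
open MeasureTheory ProbabilityTheory
namespace PrivateGP

/-! ### Gauss–Hermite quadrature -/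

open Polynomial

section Hermite

lemma integrable_eval_mul_exp (p : ℝ[X]) :
    Integrable fun x : ℝ => p.eval x * Real.exp (-(1 / 2) * x ^ 2) := by
  induction p using Polynomial.induction_on' with
  | add p q hp hq =>
    simp only [eval_add, add_mul]
    exact hp.add hq
  | monomial n a =>
    have h := integrable_rpow_mul_exp_neg_mul_sq (b := 1 / 2) (by norm_num) (s := n)
      (by linarith [n.cast_nonneg (α := ℝ)])
    simp only [Real.rpow_natCast] at h
    simpa only [eval_monomial, mul_assoc] using h.const_mul a

lemma gaussianPDFReal_zero_one (x : ℝ) :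
    gaussianPDFReal 0 1 x = (Real.sqrt (2 * Real.pi))⁻¹ * Real.exp (-(1 / 2) * x ^ 2) := by
  simp only [gaussianPDFReal, NNReal.coe_one, mul_one, sub_zero]
  congr 2
  ring

lemma integral_eval_gaussianReal (p : ℝ[X]) :
    ∫ x, p.eval x ∂gaussianReal 0 1 = (Real.sqrt (2 * Real.pi))⁻¹ *
      ∫ x, p.eval x * Real.exp (-(1 / 2) * x ^ 2) := by
  rw [integral_gaussianReal_eq_integral_smul one_ne_zero, ← integral_const_mul]
  congr 1
  ext x
  rw [gaussianPDFReal_zero_one, smul_eq_mul]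
  ring

lemma integrable_eval_gaussianReal (p : ℝ[X]) :
    Integrable (fun x => p.eval x) (gaussianReal 0 1) := by
  rw [gaussianReal_of_var_ne_zero _ one_ne_zero,
    integrable_withDensity_iff_integrable_smul' (measurable_gaussianPDF _ _)
      (Filter.Eventually.of_forall fun _ => gaussianPDF_lt_top)]
  refine ((integrable_eval_mul_exp p).const_mul (Real.sqrt (2 * Real.pi))⁻¹).congr
    (Filter.Eventually.of_forall fun x => ?_)
  simp only [toReal_gaussianPDF, gaussianPDFReal_zero_one, smul_eq_mul]
  ring

/-- Expectation of a polynomial in a standard normal variable. -/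
def gaussE : ℝ[X] →ₗ[ℝ] ℝ where
  toFun p := ∫ x, p.eval x ∂gaussianReal 0 1
  map_add' p q := by
    simp only [eval_add]
    exact integral_add (integrable_eval_gaussianReal p) (integrable_eval_gaussianReal q)
  map_smul' c p := by
    simp only [eval_smul, smul_eq_mul, RingHom.id_apply]
    exact integral_const_mul _ _

lemma gaussE_apply (p : ℝ[X]) : gaussE p = ∫ x, p.eval x ∂gaussianReal 0 1 := rfl

lemma gaussE_C (c : ℝ) : gaussE (C c) = c := by
  simp [gaussE_apply]

/-- Stein's identity. -/
lemma gaussE_X_mul (p : ℝ[X]) : gaussE (X * p) = gaussE (derivative p) := by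
  rw [gaussE_apply, gaussE_apply, integral_eval_gaussianReal, integral_eval_gaussianReal]
  congr 1
  have h := integral_mul_deriv_eq_deriv_mul_of_integrable (u := fun x => p.eval x)
    (u' := fun x => (derivative p).eval x) (v := fun x : ℝ => Real.exp (-(1 / 2) * x ^ 2))
    (v' := fun x : ℝ => -(x * Real.exp (-(1 / 2) * x ^ 2))) (fun x _ => p.hasDerivAt x)
    (fun x _ => by
      have := ((hasDerivAt_pow 2 x).const_mul (-(1 / 2))).exp
      refine this.congr_deriv ?_
      ring)
    ((integrable_eval_mul_exp (X * p)).neg.congr (Filter.Eventually.of_forall fun x => by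
      simp only [eval_mul, eval_X, Pi.mul_apply, Pi.neg_apply]; ring))
    (integrable_eval_mul_exp (derivative p)) (integrable_eval_mul_exp p)
  have e : ∀ x : ℝ, (X * p).eval x * Real.exp (-(1 / 2) * x ^ 2) =
      -(p.eval x * -(x * Real.exp (-(1 / 2) * x ^ 2))) := by
    intro x
    simp only [eval_mul, eval_X]
    ring
  simp only [e]
  rw [integral_neg, h, neg_neg]

/-- Hermite polynomials with real coefficients. -/
def herm (n : ℕ) : ℝ[X] := (hermite n).map (Int.castRingHom ℝ)

lemma herm_zero : herm 0 = 1 := by simp [herm]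

lemma herm_succ (n : ℕ) : herm (n + 1) = X * herm n - derivative (herm n) := by
  simp [herm, hermite_succ, derivative_map]

lemma herm_monic (n : ℕ) : (herm n).Monic := (hermite_monic n).map _

lemma natDegree_herm (n : ℕ) : (herm n).natDegree = n := by
  rw [herm, (hermite_monic n).natDegree_map, natDegree_hermite]

lemma derivative_herm_succ (n : ℕ) : derivative (herm (n + 1)) = (n + 1 : ℝ) • herm n := by
  induction n with
  | zero => simp [herm_succ, herm_zero]
  | succ n ih =>
    rw [herm_succ (n + 1), derivative_sub, derivative_mul, derivative_X, one_mul, ih,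
      derivative_smul, mul_smul_comm, add_sub_assoc, ← smul_sub, ← herm_succ]
    push_cast
    rw [add_smul ((n : ℝ) + 1) 1, one_smul, add_comm]

lemma herm_succ_succ (n : ℕ) : herm (n + 2) = X * herm (n + 1) - (n + 1 : ℝ) • herm n := by
  rw [herm_succ, derivative_herm_succ]

/-- By the three-term recurrence a common zero of two consecutive Hermite polynomials would descend
to a zero of He_0 = 1. -/
lemma eval_herm_ne_zero {n : ℕ} {z : ℝ} (h : (herm (n + 1)).eval z = 0) :
    (herm n).eval z ≠ 0 := by
  induction n with
  | zero => simp [herm_zero]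
  | succ n ih =>
    intro h1
    rw [herm_succ_succ, eval_sub, eval_mul, h1, mul_zero, zero_sub, neg_eq_zero, eval_smul,
      smul_eq_mul, mul_eq_zero] at h
    rcases h with h | h
    · exact absurd h (by positivity)
    · exact ih h1 h

/-- As He_{n+1} = X·He_n − He_n′, Stein's identity lowers the Hermite index by one and moves one
derivative to p. At the end only the n-th derivative of p is left, which is constant. Orthogonality
to polynomials of lower degree is the case of a vanishing coefficient. -/
lemma gaussE_herm_mul {n : ℕ} {p : ℝ[X]} (hp : p.natDegree ≤ n) :
    gaussE (herm n * p) = n.factorial * p.coeff n := by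
  induction n generalizing p with
  | zero =>
    rw [eq_C_of_natDegree_le_zero hp, herm_zero, one_mul, gaussE_C]
    simp
  | succ n ih =>
    have h : herm (n + 1) * p = X * (herm n * p) - derivative (herm n) * p := by
      rw [herm_succ]; ring
    rw [h, map_sub, gaussE_X_mul, derivative_mul, map_add, add_sub_cancel_left,
      ih ((natDegree_derivative_le p).trans (by omega)), coeff_derivative, Nat.factorial_succ]
    push_cast
    ring

lemma mem_hermiteNodes {n : ℕ} {z : ℝ} : z ∈ hermiteNodes n ↔ (herm n).eval z = 0 := by
  rw [hermiteNodes, Multiset.mem_toFinset, ← herm, mem_roots (herm_monic n).ne_zero, IsRoot.def]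

lemma prod_dvd_herm (n : ℕ) : (∏ z ∈ hermiteNodes n, (X - C z)) ∣ herm n := by
  rw [hermiteNodes, Finset.prod, Multiset.toFinset_val, ← herm]
  exact (Multiset.prod_dvd_prod_of_le (Multiset.map_le_map (Multiset.dedup_le _))).trans
    (prod_multiset_X_sub_C_dvd _)

/-- The Hermite polynomial of degree `n` has `n` distinct real zeros. -/
lemma card_hermiteNodes (n : ℕ) : (hermiteNodes n).card = n := by
  set g : ℝ[X] := ∏ z ∈ hermiteNodes n, (X - C z) with hg
  have hgm : g.Monic := monic_prod_of_monic _ _ fun z _ => monic_X_sub_C z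
  have hgd : g.natDegree = (hermiteNodes n).card := by
    rw [hg, natDegree_prod_of_monic _ _ fun z _ => monic_X_sub_C z]
    simp
  obtain ⟨h, hh⟩ := prod_dvd_herm n
  rw [← hg] at hh
  have hle : (hermiteNodes n).card ≤ n := by
    rw [← hgd]
    conv_rhs => rw [← natDegree_herm n]
    exact natDegree_le_of_dvd ⟨h, hh⟩ (herm_monic n).ne_zero
  refine le_antisymm hle (not_lt.1 fun hlt => ?_)
  obtain ⟨m, rfl⟩ : ∃ m, n = m + 1 := ⟨n - 1, by omega⟩
  have hg0 : ∀ w, g.eval w = 0 ↔ w ∈ hermiteNodes (m + 1) := by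
    intro w
    rw [hg, eval_prod, Finset.prod_eq_zero_iff]
    constructor
    · rintro ⟨z, hz, h0⟩
      rw [eval_sub, eval_X, eval_C, sub_eq_zero] at h0
      rwa [h0]
    · intro hw
      exact ⟨w, hw, by simp⟩
  -- A real zero of the cofactor h would be a double zero of He_{m+1}, and since the derivative is
  -- (m+1)·He_m it would be shared with He_m.
  have hne : ∀ w, h.eval w ≠ 0 := by
    intro w hw
    have h1 : (herm (m + 1)).eval w = 0 := by rw [hh, eval_mul, hw, mul_zero]
    have h2 : g.eval w = 0 := (hg0 w).2 (mem_hermiteNodes.2 h1)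
    have h3 : (derivative (herm (m + 1))).eval w = 0 := by
      rw [hh, derivative_mul, eval_add, eval_mul, eval_mul, hw, h2]
      ring
    rw [derivative_herm_succ, eval_smul, smul_eq_mul, mul_eq_zero] at h3
    rcases h3 with h3 | h3
    · exact absurd h3 (by positivity)
    · exact eval_herm_ne_zero h1 h3
  -- With too few nodes, g would have degree below that of He_{m+1} and be orthogonal to it. But
  -- He_{m+1}·g = g²h with h of constant sign, so g would vanish almost everywhere.
  have hE : gaussE (herm (m + 1) * g) = 0 := by
    rw [gaussE_herm_mul (hgd.trans_le hle), coeff_eq_zero_of_natDegree_lt (by omega), mul_zero]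
  rw [hh, gaussE_apply] at hE
  have hsign : (∀ w, 0 < h.eval w) ∨ (∀ w, h.eval w < 0) := by
    by_contra hcon
    push Not at hcon
    obtain ⟨⟨a, ha⟩, ⟨b, hb⟩⟩ := hcon
    obtain ⟨c, hc⟩ := mem_range_of_exists_le_of_exists_ge h.continuous ⟨a, ha⟩ ⟨b, hb⟩
    exact hne c hc
  have hae : (fun x => (g * h * g).eval x) =ᵐ[gaussianReal 0 1] 0 := by
    have hInt := integrable_eval_gaussianReal (g * h * g)
    rcases hsign with hs | hs
    · refine (integral_eq_zero_iff_of_nonneg (fun x => ?_) hInt).1 hE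
      simp only [eval_mul, Pi.zero_apply]
      nlinarith [mul_nonneg (hs x).le (mul_self_nonneg (g.eval x))]
    · have hInt' : Integrable (fun x => -(g * h * g).eval x) (gaussianReal 0 1) := hInt.neg
      have h0 : ∫ x, -(g * h * g).eval x ∂gaussianReal 0 1 = 0 := by rw [integral_neg, hE, neg_zero]
      have := (integral_eq_zero_iff_of_nonneg (fun x => ?_) hInt').1 h0
      · filter_upwards [this] with x hx
        simpa using hx
      · simp only [eval_mul, Pi.zero_apply]
        nlinarith [mul_nonneg (neg_nonneg.2 (hs x).le) (mul_self_nonneg (g.eval x))]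
  have := nullSingletonClass_gaussianReal (μ := 0) (v := 1) one_ne_zero
  have hfin : ∀ᵐ x ∂gaussianReal 0 1, x ∉ (hermiteNodes (m + 1) : Set ℝ) :=
    measure_eq_zero_iff_ae_notMem.1 ((hermiteNodes (m + 1)).finite_toSet.measure_zero _)
  obtain ⟨x, hx1, hx2⟩ := (hae.and hfin).exists
  simp only [eval_mul, Pi.zero_apply] at hx1
  have hgx : g.eval x ≠ 0 := fun h0 => hx2 ((hg0 x).1 h0)
  exact mul_ne_zero (mul_ne_zero hgx (hne x)) hgx hx1

/-- Division by He_n: the quotient has degree below n and is orthogonal to He_n, while the remainder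
agrees with p at the nodes and is its own Lagrange interpolant. This doubles the degree of
exactness. -/
lemma sum_basis_eq_gaussE {n : ℕ} {p : ℝ[X]} (hp : p.natDegree < 2 * n) :
    ∑ z ∈ hermiteNodes n, p.eval z * gaussE (Lagrange.basis (hermiteNodes n) id z) =
      gaussE p := by
  set r := p %ₘ herm n with hr
  set s := p /ₘ herm n with hs
  have hps : r + herm n * s = p := modByMonic_add_div p (herm n)
  have hrd : r.degree < (hermiteNodes n).card := by
    rw [card_hermiteNodes]
    have := degree_modByMonic_lt p (herm_monic n)
    rwa [degree_eq_natDegree (herm_monic n).ne_zero, natDegree_herm] at this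
  have hsd : s.natDegree < n := by
    rw [hs, natDegree_divByMonic _ (herm_monic n), natDegree_herm]
    omega
  have h1 : gaussE p = gaussE r := by
    rw [← hps, map_add, gaussE_herm_mul hsd.le, coeff_eq_zero_of_natDegree_lt hsd, mul_zero,
      add_zero]
  have h2 := Lagrange.eq_interpolate (v := id) (s := hermiteNodes n) Function.injective_id.injOn hrd
  rw [h1, h2, Lagrange.interpolate_apply, map_sum]
  refine Finset.sum_congr rfl fun z hz => ?_
  rw [C_mul', map_smul, smul_eq_mul, id]
  congr 1
  rw [← hps, eval_add, eval_mul, mem_hermiteNodes.1 hz, zero_mul, add_zero]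

lemma hermiteWeight_eq {n : ℕ} {z : ℝ} : hermiteWeight n z =
    (n.factorial : ℝ) / ((n : ℝ) ^ 2 * ((herm (n - 1)).eval z) ^ 2) := by
  rw [hermiteWeight, herm, eval_map, aeval_def]
  rfl

/-- The rule is tested on He_{n−1} · He_n/(X − z). Only the node z contributes to the sum, with
value n·He_{n−1}(z)², and orthogonality evaluates the expectation as (n−1)!. -/
lemma gaussE_basis {n : ℕ} {z : ℝ} (hz : z ∈ hermiteNodes n) :
    gaussE (Lagrange.basis (hermiteNodes n) id z) = hermiteWeight n z := by
  obtain ⟨m, rfl⟩ : ∃ m, n = m + 1 := by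
    rcases n with _ | n
    · exact absurd (mem_hermiteNodes.1 hz) (by simp [herm_zero])
    · exact ⟨n, rfl⟩
  have hz0 := mem_hermiteNodes.1 hz
  obtain ⟨g, hg⟩ := dvd_iff_isRoot.2 (IsRoot.def.2 hz0)
  have hgm : g.Monic := (monic_X_sub_C z).of_mul_monic_left (hg ▸ herm_monic (m + 1))
  have hgd : g.natDegree = m := by
    have h1 := natDegree_herm (m + 1)
    rw [hg, (monic_X_sub_C z).natDegree_mul hgm, natDegree_X_sub_C] at h1
    omega
  have hgz : g.eval z = (m + 1) * (herm m).eval z := by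
    have h1 : derivative (herm (m + 1)) = g + (X - C z) * derivative g := by
      rw [hg, derivative_mul]
      simp
    rw [derivative_herm_succ] at h1
    have h2 := congrArg (eval z) h1
    simpa using h2.symm
  have hgw : ∀ w ∈ hermiteNodes (m + 1), w ≠ z → g.eval w = 0 := by
    intro w hw hne
    have h1 := mem_hermiteNodes.1 hw
    rw [hg, eval_mul, mul_eq_zero] at h1
    rcases h1 with h1 | h1
    · rw [eval_sub, eval_X, eval_C, sub_eq_zero] at h1
      exact absurd h1 hne
    · exact h1
  have hq := sum_basis_eq_gaussE (n := m + 1) (p := herm m * g) (by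
    rw [(herm_monic m).natDegree_mul hgm, natDegree_herm, hgd]
    omega)
  rw [gaussE_herm_mul hgd.le, ← hgd, hgm.coeff_natDegree, hgd, mul_one,
    Finset.sum_eq_single_of_mem z hz fun w hw hne => by rw [eval_mul, hgw w hw hne]; ring,
    eval_mul, hgz] at hq
  rw [hermiteWeight_eq, Nat.add_sub_cancel, Nat.factorial_succ]
  have h0 := eval_herm_ne_zero hz0
  have hm : (m : ℝ) + 1 ≠ 0 := by positivity
  push_cast
  rw [← hq]
  field_simp

/-- The `n`-point rule is exact for polynomials of degree less than `2 n`. -/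
lemma sum_hermiteWeight_mul_eval {n : ℕ} {p : ℝ[X]} (hp : p.natDegree < 2 * n) :
    ∑ z ∈ hermiteNodes n, hermiteWeight n z * p.eval z = gaussE p := by
  rw [← sum_basis_eq_gaussE hp]
  refine Finset.sum_congr rfl fun z hz => ?_
  rw [gaussE_basis hz, mul_comm]

lemma hermiteWeight_nonneg (n : ℕ) (z : ℝ) : 0 ≤ hermiteWeight n z := by
  unfold hermiteWeight
  positivity

lemma sum_hermiteWeight {n : ℕ} (hn : 0 < n) : ∑ z ∈ hermiteNodes n, hermiteWeight n z = 1 := by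
  have := sum_hermiteWeight_mul_eval (n := n) (p := C 1) (by simp [hn])
  rw [gaussE_C] at this
  simpa using this

lemma gaussE_X_pow (n : ℕ) :
    gaussE (X ^ (2 * n)) * (2 ^ n * n.factorial) = (2 * n).factorial := by
  induction n with
  | zero =>
    have := gaussE_C 1
    simpa using this
  | succ n ih =>
    have h : gaussE (X ^ (2 * (n + 1))) = (2 * n + 1) * gaussE (X ^ (2 * n)) := by
      rw [show 2 * (n + 1) = (2 * n + 1) + 1 by ring, pow_succ', gaussE_X_mul,
        derivative_X_pow, Nat.add_sub_cancel, C_mul', map_smul, smul_eq_mul]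
      push_cast
      ring
    rw [h, show 2 * (n + 1) = (2 * n + 1) + 1 by ring, Nat.factorial_succ (2 * n + 1),
      Nat.factorial_succ (2 * n), Nat.factorial_succ n]
    push_cast
    rw [← ih]
    ring

/-- The rule is exact on X^{2n} − He_n², which has degree below 2n, and He_n vanishes at every node.
Hence the rule underestimates the moment by E[He_n²] ≥ 0. -/
lemma sum_hermiteWeight_mul_pow_le {n : ℕ} (hn : 0 < n) :
    ∑ z ∈ hermiteNodes n, hermiteWeight n z * z ^ (2 * n) ≤ gaussE (X ^ (2 * n)) := by
  have hd : (X ^ (2 * n) - herm n ^ 2 : ℝ[X]).natDegree < 2 * n := by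
    have hm : (herm n ^ 2).Monic := (herm_monic n).pow 2
    have hnd : (herm n ^ 2).natDegree = 2 * n := by
      rw [(herm_monic n).natDegree_pow, natDegree_herm]
    have h1 : (X ^ (2 * n) - herm n ^ 2 : ℝ[X]).degree < (X ^ (2 * n) : ℝ[X]).degree := by
      refine degree_sub_lt_left ?_ (monic_X_pow _).ne_zero ?_
      · rw [degree_X_pow, degree_eq_natDegree hm.ne_zero, hnd]
      · rw [hm.leadingCoeff, (monic_X_pow _).leadingCoeff]
    by_cases h0 : (X ^ (2 * n) - herm n ^ 2 : ℝ[X]) = 0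
    · rw [h0, natDegree_zero]
      omega
    · simpa using natDegree_lt_natDegree h0 h1
  have h := sum_hermiteWeight_mul_eval hd
  rw [map_sub] at h
  have h2 : 0 ≤ gaussE (herm n ^ 2) := integral_nonneg fun x => by
    simp only [eval_pow, Pi.zero_apply]
    positivity
  have h3 : ∑ z ∈ hermiteNodes n, hermiteWeight n z * z ^ (2 * n) =
      ∑ z ∈ hermiteNodes n, hermiteWeight n z * (X ^ (2 * n) - herm n ^ 2 : ℝ[X]).eval z := by
    refine Finset.sum_congr rfl fun z hz => ?_
    rw [eval_sub, eval_pow, eval_pow, eval_X, mem_hermiteNodes.1 hz]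
    ring
  rw [h3, h]
  linarith

/-- Taylor's formula for `exp (iθ)` with the sharp bound for the remainder. -/
lemma norm_exp_mul_I_sub_sum_le (θ : ℝ) (n : ℕ) :
    ‖Complex.exp (θ * Complex.I) -
      ∑ j ∈ Finset.range n, (θ * Complex.I) ^ j / (j.factorial : ℂ)‖ ≤
      |θ| ^ n / n.factorial := by
  set w : ℂ := θ * Complex.I with hw
  have hwn : ‖w‖ = |θ| := by simp [hw]
  -- Along s ↦ sθ the derivative of each remainder is iθ times the preceding one, so the bound is
  -- integrated by induction, starting from |exp(isθ)| = 1.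
  have key : ∀ n : ℕ, ∀ s ∈ Set.Icc (0 : ℝ) 1, ‖Complex.exp (s * w) -
      ∑ j ∈ Finset.range n, (s * w) ^ j / (j.factorial : ℂ)‖ ≤ (|θ| * s) ^ n / n.factorial := by
    intro n
    induction n with
    | zero =>
      intro s _
      have : (s : ℂ) * w = ((s * θ : ℝ) : ℂ) * Complex.I := by rw [hw]; push_cast; ring
      simp only [Finset.range_zero, Finset.sum_empty, sub_zero, this, Complex.norm_exp_ofReal_mul_I]
      simp
    | succ n ih =>
      have hder : ∀ s : ℝ, HasDerivAt (fun s : ℝ => Complex.exp (s * w) -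
          ∑ j ∈ Finset.range (n + 1), (s * w) ^ j / (j.factorial : ℂ))
          (w * (Complex.exp (s * w) -
            ∑ j ∈ Finset.range n, (s * w) ^ j / (j.factorial : ℂ))) s := by
        intro s
        have h1 : HasDerivAt (fun s : ℝ => (s : ℂ) * w) w s := by
          simpa using (Complex.ofRealCLM.hasDerivAt (x := s)).mul_const w
        have h2 : HasDerivAt (fun s : ℝ => ∑ j ∈ Finset.range (n + 1),
            (s * w) ^ j / (j.factorial : ℂ))
            (∑ j ∈ Finset.range (n + 1), (j * (s * w) ^ (j - 1) * w) / (j.factorial : ℂ)) s :=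
          HasDerivAt.fun_sum fun j _ => (h1.pow j).div_const _
        refine (h1.cexp.sub h2).congr_deriv ?_
        rw [Finset.sum_range_succ', mul_sub, Finset.mul_sum]
        simp only [Nat.cast_zero, zero_mul, zero_div, add_zero, Nat.add_sub_cancel]
        congr 1
        · ring
        · refine Finset.sum_congr rfl fun j _ => ?_
          rw [Nat.factorial_succ]
          have : (j.factorial : ℂ) ≠ 0 := by exact_mod_cast j.factorial_ne_zero
          have h3 : ((j : ℂ) + 1) ≠ 0 := by exact_mod_cast j.succ_ne_zero
          push_cast
          field_simp
      refine image_norm_le_of_norm_deriv_right_le_deriv_boundary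
        (B' := fun s => |θ| * ((|θ| * s) ^ n / n.factorial))
        (fun s _ => (hder s).continuousAt.continuousWithinAt)
        (fun s _ => (hder s).hasDerivWithinAt) ?_ (fun s => ?_) ?_
      · simp [Finset.sum_range_succ']
      · have h1 : HasDerivAt (fun s : ℝ => |θ| * s) |θ| s := by
          simpa using (hasDerivAt_id s).const_mul |θ|
        refine ((h1.pow (n + 1)).div_const _).congr_deriv ?_
        rw [Nat.factorial_succ]
        have : (n.factorial : ℝ) ≠ 0 := by positivity
        push_cast
        field_simp
      · intro s hs
        rw [norm_mul, hwn]
        exact mul_le_mul_of_nonneg_left (ih s ⟨hs.1, hs.2.le⟩) (abs_nonneg _)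
  simpa using key n 1 (by simp)

/-- Error of the quadrature rule for the characteristic function. -/
lemma norm_sum_hermiteWeight_mul_exp_sub_le {n : ℕ} (hn : 0 < n) (a : ℝ) :
    ‖∑ z ∈ hermiteNodes n, (hermiteWeight n z : ℂ) * Complex.exp ((a * z : ℝ) * Complex.I) -
      (Real.exp (-a ^ 2 / 2) : ℂ)‖ ≤ 2 * ((a ^ 2 / 2) ^ n / n.factorial) := by
  set P : ℝ → ℂ := fun z => ∑ j ∈ Finset.range (2 * n),
    (((a * z : ℝ) : ℂ) * Complex.I) ^ j / (j.factorial : ℂ) with hP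
  have hexp : (Real.exp (-a ^ 2 / 2) : ℂ) =
      ∫ z, Complex.exp ((a * z : ℝ) * Complex.I) ∂gaussianReal 0 1 := by
    have h := charFun_gaussianReal (μ := 0) (v := 1) a
    rw [charFun_apply_real] at h
    push_cast at h ⊢
    rw [h]
    congr 1
    ring
  have hPeq : ∀ z, P z = ∑ j ∈ Finset.range (2 * n),
      ((a : ℂ) * Complex.I) ^ j / (j.factorial : ℂ) * (((X ^ j : ℝ[X]).eval z : ℝ) : ℂ) := by
    intro z
    refine Finset.sum_congr rfl fun j _ => ?_
    simp only [eval_pow, eval_X]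
    push_cast
    rw [mul_right_comm, mul_pow]
    ring
  have hInt : ∀ j : ℕ, Integrable (fun z : ℝ => ((a : ℂ) * Complex.I) ^ j / (j.factorial : ℂ) *
      (((X ^ j : ℝ[X]).eval z : ℝ) : ℂ)) (gaussianReal 0 1) := fun j =>
    ((integrable_eval_gaussianReal (X ^ j)).ofReal).const_mul _
  have hPint : Integrable P (gaussianReal 0 1) := by
    simp only [funext hPeq]
    exact integrable_finsetSum _ fun j _ => hInt j
  have hPE : ∑ z ∈ hermiteNodes n, (hermiteWeight n z : ℂ) * P z =
      ∫ z, P z ∂gaussianReal 0 1 := by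
    simp only [hPeq]
    rw [integral_finsetSum _ fun j _ => hInt j]
    simp only [Finset.mul_sum]
    rw [Finset.sum_comm]
    refine Finset.sum_congr rfl fun j hj => ?_
    rw [integral_const_mul, integral_complex_ofReal, ← gaussE_apply,
      ← sum_hermiteWeight_mul_eval (by rw [natDegree_X_pow]; exact Finset.mem_range.1 hj)]
    push_cast
    rw [Finset.mul_sum]
    exact Finset.sum_congr rfl fun z _ => by ring
  set c : ℝ := a ^ (2 * n) / (2 * n).factorial with hc
  have hc0 : 0 ≤ c := div_nonneg (by rw [pow_mul]; positivity) (by positivity)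
  -- The Taylor polynomial has degree below 2n and is integrated exactly. Only the remainder is
  -- left, once under the rule and once under the Gaussian law, and both times the Gaussian 2n-th
  -- moment bounds it; hence the factor 2.
  have hrem : ∀ z : ℝ, ‖Complex.exp ((a * z : ℝ) * Complex.I) - P z‖ ≤ c * z ^ (2 * n) := by
    intro z
    refine (norm_exp_mul_I_sub_sum_le (a * z) (2 * n)).trans (le_of_eq ?_)
    rw [abs_mul, mul_pow, pow_mul |a|, pow_mul |z|, sq_abs, sq_abs, ← pow_mul, ← pow_mul, hc]
    ring
  have hEexp : Integrable (fun z : ℝ => Complex.exp ((a * z : ℝ) * Complex.I))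
      (gaussianReal 0 1) :=
    Integrable.of_bound (C := 1) (Measurable.aestronglyMeasurable (by fun_prop))
      (Filter.Eventually.of_forall fun z => (Complex.norm_exp_ofReal_mul_I _).le)
  have h1 : ‖∑ z ∈ hermiteNodes n, (hermiteWeight n z : ℂ) *
      Complex.exp ((a * z : ℝ) * Complex.I) -
      ∑ z ∈ hermiteNodes n, (hermiteWeight n z : ℂ) * P z‖ ≤ c * gaussE (X ^ (2 * n)) := by
    rw [← Finset.sum_sub_distrib]
    refine (norm_sum_le _ _).trans ?_
    refine le_trans ?_ (mul_le_mul_of_nonneg_left (sum_hermiteWeight_mul_pow_le hn) hc0)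
    rw [Finset.mul_sum]
    refine Finset.sum_le_sum fun z _ => ?_
    rw [← mul_sub, norm_mul, Complex.norm_real, Real.norm_of_nonneg (hermiteWeight_nonneg n z)]
    nlinarith [mul_le_mul_of_nonneg_left (hrem z) (hermiteWeight_nonneg n z)]
  have h2 : ‖∫ z, P z ∂gaussianReal 0 1 -
      ∫ z, Complex.exp ((a * z : ℝ) * Complex.I) ∂gaussianReal 0 1‖ ≤
      c * gaussE (X ^ (2 * n)) := by
    rw [← integral_sub hPint hEexp]
    have hi : Integrable (fun z : ℝ => c * (X ^ (2 * n) : ℝ[X]).eval z) (gaussianReal 0 1) :=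
      (integrable_eval_gaussianReal _).const_mul _
    refine (norm_integral_le_of_norm_le hi (Filter.Eventually.of_forall fun z => ?_)).trans
      (le_of_eq ?_)
    · rw [norm_sub_rev]
      simpa using hrem z
    · rw [integral_const_mul, gaussE_apply]
  have h3 : c * gaussE (X ^ (2 * n)) = (a ^ 2 / 2) ^ n / n.factorial := by
    have h4 := gaussE_X_pow n
    have h5 : gaussE (X ^ (2 * n)) = (2 * n).factorial / (2 ^ n * n.factorial) :=
      eq_div_of_mul_eq (by positivity) h4
    rw [hc, h5, pow_mul, div_pow]
    have : ((2 * n).factorial : ℝ) ≠ 0 := by positivity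
    field_simp
  rw [hexp, ← h3]
  have := norm_add_le_of_le h1 h2
  rw [hPE, sub_add_sub_cancel] at this
  linarith

end Hermite

end PrivateGP
end

noncomputable section
open MeasureTheory ProbabilityTheory
namespace PrivateGP

/-! ### Quadrature Fourier features -/

open Matrix

section Features

/-- Telescoping, one factor at a time; factors of norm at most 1 do not amplify the errors. -/
lemma norm_prod_sub_prod_le {τ : Type*} (s : Finset τ) {f g : τ → ℂ} (hf : ∀ i ∈ s, ‖f i‖ ≤ 1)
    (hg : ∀ i ∈ s, ‖g i‖ ≤ 1) : ‖∏ i ∈ s, f i - ∏ i ∈ s, g i‖ ≤ ∑ i ∈ s, ‖f i - g i‖ := by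
  classical
  induction s using Finset.induction_on with
  | empty => simp
  | insert a s ha ih =>
    rw [Finset.prod_insert ha, Finset.prod_insert ha, Finset.sum_insert ha]
    have h1 : f a * ∏ i ∈ s, f i - g a * ∏ i ∈ s, g i =
        (f a - g a) * ∏ i ∈ s, f i + g a * (∏ i ∈ s, f i - ∏ i ∈ s, g i) := by ring
    have h2 : ‖∏ i ∈ s, f i‖ ≤ 1 := by
      rw [norm_prod]
      exact Finset.prod_le_one (fun i _ => norm_nonneg _)
        fun i hi => hf i (Finset.mem_insert_of_mem hi)
    rw [h1]
    refine (norm_add_le _ _).trans (add_le_add ?_ ?_)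
    · rw [norm_mul]
      exact mul_le_of_le_one_right (norm_nonneg _) h2
    · rw [norm_mul]
      exact (mul_le_of_le_one_left (norm_nonneg _) (hg a (Finset.mem_insert_self _ _))).trans
        (ih (fun i hi => hf i (Finset.mem_insert_of_mem hi))
          fun i hi => hg i (Finset.mem_insert_of_mem hi))

variable {d : ℕ} (ν : Fin d → ℝ) {n : ℕ}

/-- The counterpart of `IsDecomposable.eq_re_prod`, with each characteristic function replaced by
its quadrature sum. Sines and cosines combine through the formula for the cosine of a difference. -/
lemma qff_dotProduct (x y : Fin d → ℝ) :
    qff ν n x ⬝ᵥ qff ν n y = (∏ j, ∑ z ∈ hermiteNodes n, (hermiteWeight n z : ℂ) *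
      Complex.exp (((x j - y j) / ν j * z : ℝ) * Complex.I)).re := by
  have e : ∏ j, ∑ z ∈ hermiteNodes n, (hermiteWeight n z : ℂ) *
      Complex.exp (((x j - y j) / ν j * z : ℝ) * Complex.I) =
      ∑ z : Fin d → hermiteNodes n, ((∏ j, hermiteWeight n (z j) : ℝ) : ℂ) *
        Complex.exp ((∑ j, (x j - y j) / ν j * z j : ℝ) * Complex.I) := by
    simp only [← Finset.sum_coe_sort (hermiteNodes n)]
    rw [Finset.prod_univ_sum, Fintype.piFinset_univ]
    refine Finset.sum_congr rfl fun z _ => ?_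
    rw [Finset.prod_mul_distrib, ← Complex.exp_sum, ← Finset.sum_mul]
    push_cast
    rfl
  rw [e, Complex.re_sum, dotProduct, Fintype.sum_prod_type]
  refine Finset.sum_congr rfl fun z _ => ?_
  have hW : 0 ≤ ∏ j, hermiteWeight n (z j) :=
    Finset.prod_nonneg fun j _ => hermiteWeight_nonneg _ _
  have hs : ∑ j, (x j - y j) / ν j * (z j : ℝ) =
      ∑ j, (z j : ℝ) / ν j * x j - ∑ j, (z j : ℝ) / ν j * y j := by
    rw [← Finset.sum_sub_distrib]
    exact Finset.sum_congr rfl fun j _ => by ring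
  rw [Fintype.sum_bool, Complex.re_ofReal_mul, Complex.exp_ofReal_mul_I_re, hs, Real.cos_sub]
  simp only [qff, cond_true, cond_false]
  have := Real.mul_self_sqrt hW
  linear_combination (Real.cos (∑ j, (z j : ℝ) / ν j * x j) *
    Real.cos (∑ j, (z j : ℝ) / ν j * y j) + Real.sin (∑ j, (z j : ℝ) / ν j * x j) *
    Real.sin (∑ j, (z j : ℝ) / ν j * y j)) * this

/-- The weights sum to 1, so the features have norm exactly 1; the sensitivity and the potential
bounds both rely on this. -/
lemma qff_dotProduct_self (hn : 0 < n) (x : Fin d → ℝ) : qff ν n x ⬝ᵥ qff ν n x = 1 := by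
  rw [qff_dotProduct]
  have : ∑ z ∈ hermiteNodes n, (hermiteWeight n z : ℂ) = 1 := by
    exact_mod_cast sum_hermiteWeight hn
  simp [this]

/-- Constant in the bound for the approximation error of the features. -/
def featureConst : ℝ := ∑ j, 2 * Real.exp (Real.exp 1 / (2 * ν j ^ 2))

lemma featureConst_nonneg : 0 ≤ featureConst ν := Finset.sum_nonneg fun _ _ => by positivity

/-- One term (ec)ⁿ/n! is at most the whole series exp(ec). This trades the factorial decay for
e^{−n}, which suffices for a number of nodes of order log T. -/
lemma pow_div_factorial_le_exp_mul {c : ℝ} (hc : 0 ≤ c) (n : ℕ) :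
    c ^ n / n.factorial ≤ Real.exp (Real.exp 1 * c) * Real.exp (-n) := by
  have h := Real.pow_div_factorial_le_exp (Real.exp 1 * c) (by positivity) n
  rw [mul_pow, ← Real.exp_nat_mul, mul_one] at h
  rw [Real.exp_neg, ← div_eq_mul_inv, le_div_iff₀ (Real.exp_pos _)]
  calc _ = Real.exp n * c ^ n / n.factorial := by ring
    _ ≤ _ := h

variable {ν} {k : (Fin d → ℝ) → (Fin d → ℝ) → ℝ} {p : Fin d → Measure ℝ}

/-- Uniform approximation of the kernel by the features. -/
lemma abs_kernel_sub_qff_le (hk : IsDecomposable k p)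
    (hp : ∀ j, p j = gaussianReal 0 (1 / (ν j) ^ 2).toNNReal) (hn : 0 < n) {x y : Fin d → ℝ}
    (hx : x ∈ Cube d) (hy : y ∈ Cube d) :
    |k x y - qff ν n x ⬝ᵥ qff ν n y| ≤ featureConst ν * Real.exp (-n) := by
  rw [hk.eq_re_prod, qff_dotProduct, ← Complex.sub_re]
  refine (Complex.abs_re_le_norm _).trans ?_
  simp only [hp, charFun_gaussianReal_inv_sq]
  refine (norm_prod_sub_prod_le _ (fun j _ => ?_) fun j _ => ?_).trans ?_
  · rw [Complex.norm_real, Real.norm_of_nonneg (Real.exp_pos _).le]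
    exact Real.exp_le_one_iff.2 (by nlinarith [sq_nonneg ((x j - y j) / ν j)])
  · refine (norm_sum_le _ _).trans (le_of_eq ?_)
    rw [← sum_hermiteWeight hn]
    refine Finset.sum_congr rfl fun z _ => ?_
    rw [norm_mul, Complex.norm_exp_ofReal_mul_I, mul_one, Complex.norm_real,
      Real.norm_of_nonneg (hermiteWeight_nonneg n z)]
  · rw [featureConst, Finset.sum_mul]
    refine Finset.sum_le_sum fun j _ => ?_
    rw [norm_sub_rev]
    refine (norm_sum_hermiteWeight_mul_exp_sub_le hn _).trans ?_
    rw [mul_assoc]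
    refine mul_le_mul_of_nonneg_left ?_ zero_le_two
    refine (pow_div_factorial_le_exp_mul (by positivity) n).trans ?_
    refine mul_le_mul_of_nonneg_right (Real.exp_le_exp.2 ?_) (Real.exp_pos _).le
    have h1 : |x j - y j| ≤ 1 := by
      have := hx.1 j; have := hx.2 j; have := hy.1 j; have := hy.2 j
      simp only [Pi.zero_apply, Pi.one_apply] at *
      rw [abs_le]
      constructor <;> linarith
    have h2 : (x j - y j) ^ 2 ≤ 1 := (sq_le_one_iff_abs_le_one _).2 h1
    have h3 : ((x j - y j) / ν j) ^ 2 ≤ 1 / ν j ^ 2 := by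
      rw [div_pow]
      exact div_le_div_of_nonneg_right h2 (sq_nonneg _)
    calc _ ≤ Real.exp 1 * ((1 / ν j ^ 2) / 2) := by gcongr
      _ = _ := by rw [div_div, mul_comm (ν j ^ 2), mul_one_div]

end Features

/-! ### Approximation in the reproducing kernel Hilbert space -/

section RKHSApprox

variable {X ι : Type*} [Fintype ι] {H : Type*} [NormedAddCommGroup H] [InnerProductSpace ℝ H]
  [CompleteSpace H] [RKHS ℝ H X ℝ]

/-- The left side is ⟨Σ c_x k_x, f⟩ by the reproducing property, so this is Cauchy–Schwarz. It is
the dual constraint in `exists_feature_approx`. -/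
lemma sum_mul_apply_le (f : H) (s : Finset X) (c : X → ℝ) :
    ∑ x ∈ s, c x * f x ≤
      ‖f‖ * Real.sqrt (∑ x ∈ s, ∑ y ∈ s, c x * c y * RKHS.kernel H x y 1) := by
  set g : H := ∑ x ∈ s, c x • RKHS.kerFun H x (1 : ℝ) with hg
  have h1 : ∑ x ∈ s, c x * f x = inner ℝ g f := by
    rw [hg, sum_inner]
    refine Finset.sum_congr rfl fun x _ => ?_
    rw [real_inner_smul_left, RKHS.kerFun_inner]
    simp
  have h2 : ∑ x ∈ s, ∑ y ∈ s, c x * c y * RKHS.kernel H x y 1 = ‖g‖ ^ 2 := by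
    rw [← real_inner_self_eq_norm_sq, hg, sum_inner]
    refine Finset.sum_congr rfl fun x _ => ?_
    rw [inner_sum]
    refine Finset.sum_congr rfl fun y _ => ?_
    rw [real_inner_smul_left, real_inner_smul_right, RKHS.kerFun_inner, RKHS.kerFun_apply]
    simp [mul_assoc]
  rw [h1, h2, Real.sqrt_sq (norm_nonneg _), mul_comm]
  exact real_inner_le_norm g f

/-- If `⟨Φ(x), Φ(y)⟩` approximates the kernel uniformly up to `η`, then the functions in the ball
of radius `B` are approximated uniformly up to `B √η` by functions `⟨θ, Φ(x)⟩`, `‖θ‖ ≤ B`. -/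
lemma exists_feature_approx {Φ : X → ι → ℝ} {η B : ℝ} (hη : 0 ≤ η)
    (hΦ : ∀ x y, |RKHS.kernel H x y 1 - Φ x ⬝ᵥ Φ y| ≤ η) (f : H) (hf : ‖f‖ ≤ B) :
    ∃ θ : ι → ℝ, θ ⬝ᵥ θ ≤ B ^ 2 ∧ ∀ x, |f x - θ ⬝ᵥ Φ x| ≤ B * Real.sqrt η := by
  classical
  have hB : 0 ≤ B := (norm_nonneg f).trans hf
  set S : Set (ι → ℝ) := {θ | θ ⬝ᵥ θ ≤ B ^ 2} with hS
  have hSeq : S = (WithLp.toLp 2) ⁻¹' (Metric.closedBall (0 : EuclideanSpace ℝ ι) B) := by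
    ext θ
    rw [Set.mem_preimage, mem_closedBall_zero_iff, ← abs_of_nonneg (norm_nonneg _),
      ← abs_of_nonneg hB, ← sq_le_sq, EuclideanSpace.real_norm_sq_eq]
    simp [hS, dotProduct, sq]
  have hScompact : IsCompact S := by
    rw [hSeq]
    exact (PiLp.homeomorph 2 (fun _ : ι => ℝ)).symm.isCompact_preimage.2
      (isCompact_closedBall _ _)
  have hSconvex : Convex ℝ S := by
    rw [hSeq]
    exact (convex_closedBall _ _).linear_preimage (WithLp.linearEquiv 2 ℝ (ι → ℝ)).symm.toLinearMap
  have hcl : ∀ x, IsClosed {θ : ι → ℝ | |f x - θ ⬝ᵥ Φ x| ≤ B * Real.sqrt η} := fun x =>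
    isClosed_le (by unfold dotProduct; fun_prop) continuous_const
  -- The ball S is compact and each constraint on θ is closed, so finitely many points suffice.
  have hfin : ∀ u : Finset X,
      (S ∩ ⋂ x ∈ u, {θ : ι → ℝ | |f x - θ ⬝ᵥ Φ x| ≤ B * Real.sqrt η}).Nonempty := by
    intro u
    by_contra hempty
    let A : (ι → ℝ) →ₗ[ℝ] (u → ℝ) := Matrix.mulVecLin (Matrix.of fun (x : u) i => Φ x i)
    have hA : ∀ θ x, A θ x = θ ⬝ᵥ Φ x := by
      intro θ x
      simp only [A, mulVecLin_apply, mulVec, dotProduct_comm θ]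
      rfl
    have hAc : Continuous A := LinearMap.continuous_of_finiteDimensional A
    set δ : ℝ := B * Real.sqrt η with hδ
    have hδ0 : 0 ≤ δ := by positivity
    let b : u → ℝ := fun x => f x
    -- If no θ serves for u, the vectors of values of ⟨θ, Φ⟩ on u avoid the box of radius δ around
    -- the values of f, and Hahn–Banach separates the two convex sets strictly.
    obtain ⟨g, r, r', h1, hrr, h2⟩ := geometric_hahn_banach_compact_closed
      (s := A '' S) (t := Set.Icc (fun x => b x - δ) (fun x => b x + δ))
      (hSconvex.linear_image A) (hScompact.image hAc) (convex_Icc _ _) isClosed_Icc (by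
        rw [Set.disjoint_left]
        rintro _ ⟨θ, hθ, rfl⟩ ht
        refine hempty ⟨θ, hθ, ?_⟩
        simp only [Set.mem_iInter, Set.mem_ofPred_eq]
        intro x hx
        have l := ht.1 ⟨x, hx⟩
        have r := ht.2 ⟨x, hx⟩
        simp only [hA, b] at l r
        rw [abs_le]
        constructor <;> linarith)
    set c : u → ℝ := fun x => g (Pi.single x 1) with hc
    have hg : ∀ v : u → ℝ, g v = ∑ x, c x * v x := by
      intro v
      conv_lhs => rw [← Finset.univ_sum_single v]
      rw [map_sum]
      refine Finset.sum_congr rfl fun x _ => ?_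
      have : (Pi.single x (v x) : u → ℝ) = v x • Pi.single x (1 : ℝ) := by
        rw [← Pi.single_smul, smul_eq_mul, mul_one]
      rw [this, map_smul, smul_eq_mul, mul_comm]
    -- The functional is smallest on the box at the vertex given by the signs of c.
    have h3 : r < ∑ x, c x * b x - δ * ∑ x, |c x| := by
      have := h2 (fun x => b x - δ * SignType.sign (c x)) ⟨fun x => ?_, fun x => ?_⟩
      · rw [hg] at this
        refine hrr.trans (this.trans_le (le_of_eq ?_))
        rw [Finset.mul_sum, ← Finset.sum_sub_distrib]
        refine Finset.sum_congr rfl fun x _ => ?_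
        rw [← self_mul_sign (c x)]
        ring
      · rcases lt_trichotomy (c x) 0 with h | h | h <;> simp [h, sign_neg, sign_pos] <;> linarith
      · rcases lt_trichotomy (c x) 0 with h | h | h <;> simp [h, sign_neg, sign_pos] <;> linarith
    set w : ι → ℝ := ∑ x, c x • Φ x with hw
    -- The functional is largest on the ball at the multiple of w of norm B; the case w = 0 is
    -- separate because it cannot be normalised.
    have h4 : B * Real.sqrt (w ⬝ᵥ w) < r := by
      have hgA : ∀ θ, g (A θ) = θ ⬝ᵥ w := by
        intro θ
        rw [hg, hw, dotProduct_sum]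
        refine Finset.sum_congr rfl fun x _ => ?_
        rw [hA, dotProduct_smul, smul_eq_mul]
      rcases eq_or_ne (w ⬝ᵥ w) 0 with h0 | h0
      · have := h1 (A 0) ⟨0, by simp [hS]; positivity, rfl⟩
        rw [hgA, zero_dotProduct] at this
        rwa [h0, Real.sqrt_zero, mul_zero]
      · have hww : 0 < w ⬝ᵥ w := lt_of_le_of_ne (by simpa using dotProduct_star_self_nonneg w) h0.symm
        have hsq := Real.sqrt_pos.2 hww
        have hsq2 := Real.sq_sqrt hww.le
        have := h1 (A ((B / Real.sqrt (w ⬝ᵥ w)) • w)) ⟨_, by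
          simp only [hS, Set.mem_ofPred_eq, smul_dotProduct, dotProduct_smul, smul_eq_mul]
          rw [← mul_assoc, ← sq, div_pow, hsq2, div_mul_cancel₀ _ h0], rfl⟩
        rw [hgA, smul_dotProduct, smul_eq_mul] at this
        refine lt_of_eq_of_lt ?_ this
        rw [div_mul_eq_mul_div, mul_div_assoc, Real.div_sqrt]
    have h5 : ∑ x, c x * b x ≤ B * (Real.sqrt (w ⬝ᵥ w) + Real.sqrt η * ∑ x, |c x|) := by
      let c' : X → ℝ := fun x => if hx : x ∈ u then c ⟨x, hx⟩ else 0
      have hc' : ∀ x : u, c' x = c x := fun x => by simp [c']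
      have h6 := sum_mul_apply_le f u c'
      rw [← Finset.sum_coe_sort u] at h6
      simp only [← Finset.sum_coe_sort u, hc'] at h6
      refine h6.trans (mul_le_mul hf ?_ (Real.sqrt_nonneg _) hB)
      have hs0 : 0 ≤ ∑ x, |c x| := Finset.sum_nonneg fun _ _ => abs_nonneg _
      have hw0 : 0 ≤ w ⬝ᵥ w := by simpa using dotProduct_star_self_nonneg w
      refine Real.sqrt_le_iff.2 ⟨by positivity, ?_⟩
      -- Replacing the kernel by the features costs at most η(Σ|c|)². Taking roots bounds ⟨c, f⟩ by
      -- the support function of the ball plus that of the box, which contradicts the separation.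
      have h7 : ∑ x, ∑ y, c x * c y * RKHS.kernel H (x : X) (y : X) 1 ≤
          w ⬝ᵥ w + η * (∑ x, |c x|) ^ 2 := by
        have : w ⬝ᵥ w = ∑ x, ∑ y, c x * c y * (Φ x ⬝ᵥ Φ y) := by
          rw [hw, sum_dotProduct]
          refine Finset.sum_congr rfl fun x _ => ?_
          rw [dotProduct_sum]
          refine Finset.sum_congr rfl fun y _ => ?_
          rw [smul_dotProduct, dotProduct_smul, smul_eq_mul, smul_eq_mul]
          ring
        rw [this, sq, Finset.sum_mul_sum, Finset.mul_sum, ← Finset.sum_add_distrib]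
        refine Finset.sum_le_sum fun x _ => ?_
        rw [Finset.mul_sum, ← Finset.sum_add_distrib]
        refine Finset.sum_le_sum fun y _ => ?_
        have h8 : c x * c y * (RKHS.kernel H (x : X) (y : X) 1 - Φ x ⬝ᵥ Φ y) ≤
            |c x| * |c y| * η := by
          refine (le_abs_self _).trans ?_
          rw [abs_mul, abs_mul]
          exact mul_le_mul_of_nonneg_left (hΦ x y) (by positivity)
        linarith
      have h9 := Real.sq_sqrt hw0
      have h10 := Real.sq_sqrt hη
      have h11 : 0 ≤ Real.sqrt (w ⬝ᵥ w) * (Real.sqrt η * ∑ x, |c x|) := by positivity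
      calc _ ≤ w ⬝ᵥ w + η * (∑ x, |c x|) ^ 2 := h7
        _ ≤ _ := by rw [add_sq, mul_pow, h9, h10]; linarith
    rw [hδ] at h3
    linarith
  obtain ⟨θ, hθ, hθ'⟩ := hScompact.inter_iInter_nonempty _ hcl hfin
  exact ⟨θ, hθ, fun x => Set.mem_iInter.1 hθ' x⟩

end RKHSApprox

end PrivateGP
end

noncomputable section
open MeasureTheory ProbabilityTheory
namespace PrivateGP

/-! ### Product Gaussian measures -/

open Matrix

section GaussianPi

variable {τ : Type*} [Fintype τ]

lemma lintegral_ofReal_prod {μ : τ → Measure ℝ} [∀ i, SigmaFinite (μ i)] {f : τ → ℝ → ℝ}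
    (hf : ∀ i, Integrable (f i) (μ i)) (h0 : ∀ i x, 0 ≤ f i x) :
    ∫⁻ x, ENNReal.ofReal (∏ i, f i (x i)) ∂(Measure.pi μ) =
      ∏ i, ∫⁻ x, ENNReal.ofReal (f i x) ∂(μ i) := by
  rw [← ofReal_integral_eq_lintegral_ofReal (Integrable.fintype_prod hf)
    (Filter.Eventually.of_forall fun x => Finset.prod_nonneg fun i _ => h0 i _),
    integral_fintype_prod_eq_prod,
    ENNReal.ofReal_prod_of_nonneg fun i _ => integral_nonneg (h0 i)]
  refine Finset.prod_congr rfl fun i _ => ?_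
  rw [ofReal_integral_eq_lintegral_ofReal (hf i) (Filter.Eventually.of_forall (h0 i))]

lemma lintegral_exp_mul_gaussianReal (t : ℝ) (v : NNReal) :
    ∫⁻ x, ENNReal.ofReal (Real.exp (t * x)) ∂gaussianReal 0 v =
      ENNReal.ofReal (Real.exp (v * t ^ 2 / 2)) := by
  rw [← ofReal_integral_eq_lintegral_ofReal (integrable_exp_mul_gaussianReal t)
    (Filter.Eventually.of_forall fun _ => (Real.exp_pos _).le)]
  have := congrFun (mgf_fun_id_gaussianReal (μ := 0) (v := v)) t
  rw [mgf] at this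
  rw [this]
  simp

/-- Moment generating function of a product of centred Gaussian laws. -/
lemma lintegral_exp_dotProduct_pi_gaussianReal (t : τ → ℝ) (v : NNReal) :
    ∫⁻ x, ENNReal.ofReal (Real.exp (t ⬝ᵥ x)) ∂(Measure.pi fun _ : τ => gaussianReal 0 v) =
      ENNReal.ofReal (Real.exp (v * (t ⬝ᵥ t) / 2)) := by
  have e : ∀ x : τ → ℝ, Real.exp (t ⬝ᵥ x) = ∏ i, Real.exp (t i * x i) := fun x => by
    rw [dotProduct, Real.exp_sum]
  simp only [e]
  rw [lintegral_ofReal_prod (f := fun i x => Real.exp (t i * x))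
    (fun i => integrable_exp_mul_gaussianReal (t i)) fun i x => (Real.exp_pos _).le]
  simp only [lintegral_exp_mul_gaussianReal]
  rw [← ENNReal.ofReal_prod_of_nonneg fun i _ => (Real.exp_pos _).le, ← Real.exp_sum]
  congr 2
  rw [dotProduct, Finset.mul_sum, Finset.sum_div]
  exact Finset.sum_congr rfl fun i _ => by ring

lemma gaussianReal_eq_withDensity (c : ℝ) {v : NNReal} (hv : v ≠ 0) :
    gaussianReal c v = (gaussianReal 0 v).withDensity fun x =>
      ENNReal.ofReal (Real.exp (c * x / v - c ^ 2 / (2 * v))) := by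
  rw [gaussianReal_of_var_ne_zero _ hv, gaussianReal_of_var_ne_zero _ hv,
    ← withDensity_mul _ (measurable_gaussianPDF _ _) (by fun_prop)]
  congr 1
  ext x
  simp only [Pi.mul_apply, gaussianPDF, gaussianPDFReal]
  rw [← ENNReal.ofReal_mul (by positivity), mul_assoc _ (Real.exp _) (Real.exp _), ← Real.exp_add]
  have : (v : ℝ) ≠ 0 := by exact_mod_cast hv
  congr 3
  field_simp
  ring

lemma map_add_pi_gaussianReal (c : τ → ℝ) (v : NNReal) :
    (Measure.pi fun _ : τ => gaussianReal 0 v).map (fun x => x + c) =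
      Measure.pi fun i => gaussianReal (c i) v := by
  have h := Measure.pi_map_pi (μ := fun _ : τ => gaussianReal 0 v) (f := fun i x => x + c i)
    (fun i => by fun_prop)
  simp only [gaussianReal_map_add_const, zero_add] at h
  exact h

lemma pi_gaussianReal_eq_withDensity (c : τ → ℝ) {v : NNReal} (hv : v ≠ 0) :
    (Measure.pi fun i => gaussianReal (c i) v) =
      (Measure.pi fun _ : τ => gaussianReal 0 v).withDensity fun x =>
        ENNReal.ofReal (Real.exp (c ⬝ᵥ x / v - c ⬝ᵥ c / (2 * v))) := by
  refine Measure.pi_eq fun s hs => ?_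
  rw [withDensity_apply _ (MeasurableSet.univ_pi hs), Measure.restrict_pi_pi]
  have e : ∀ x : τ → ℝ, Real.exp (c ⬝ᵥ x / v - c ⬝ᵥ c / (2 * v)) =
      ∏ i, Real.exp (c i * x i / v - c i ^ 2 / (2 * v)) := fun x => by
    rw [← Real.exp_sum, Finset.sum_sub_distrib, dotProduct, dotProduct, Finset.sum_div,
      Finset.sum_div]
    simp only [sq]
  simp only [e]
  rw [lintegral_ofReal_prod (f := fun i x => Real.exp (c i * x / v - c i ^ 2 / (2 * v)))
    (fun i => ?_) fun i x => (Real.exp_pos _).le]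
  · refine Finset.prod_congr rfl fun i _ => ?_
    rw [gaussianReal_eq_withDensity (c i) hv, withDensity_apply _ (hs i)]
  · refine Integrable.integrableOn ?_
    have := (integrable_exp_mul_gaussianReal (μ := 0) (v := v) (c i / v)).mul_const
      (Real.exp (-(c i ^ 2 / (2 * v))))
    refine this.congr (Filter.Eventually.of_forall fun x => ?_)
    simp only
    rw [← Real.exp_add]
    congr 1
    ring

/-- Chernoff's bound for a linear functional of a Gaussian vector. -/
lemma pi_gaussianReal_dotProduct_ge_le (t : τ → ℝ) (v : NNReal) {D a : ℝ} (hD : 0 < D)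
    (ha : 0 ≤ a) (h : v * (t ⬝ᵥ t) ≤ D) :
    (Measure.pi fun _ : τ => gaussianReal 0 v) {x | a ≤ t ⬝ᵥ x} ≤
      ENNReal.ofReal (Real.exp (-a ^ 2 / (2 * D))) := by
  have hm : Measurable fun x : τ → ℝ => ENNReal.ofReal (Real.exp (((a / D) • t) ⬝ᵥ x)) := by
    unfold dotProduct
    fun_prop
  have h1 := mul_meas_ge_le_lintegral (μ := Measure.pi fun _ : τ => gaussianReal 0 v) hm
    (ENNReal.ofReal (Real.exp (a ^ 2 / D)))
  rw [lintegral_exp_dotProduct_pi_gaussianReal] at h1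
  have h2 : {x : τ → ℝ | a ≤ t ⬝ᵥ x} ⊆ {x | ENNReal.ofReal (Real.exp (a ^ 2 / D)) ≤
      ENNReal.ofReal (Real.exp (((a / D) • t) ⬝ᵥ x))} := by
    intro x hx
    refine ENNReal.ofReal_le_ofReal (Real.exp_le_exp.2 ?_)
    rw [smul_dotProduct, smul_eq_mul, sq, mul_div_right_comm]
    exact mul_le_mul_of_nonneg_left hx (by positivity)
  have h3 : v * (((a / D) • t) ⬝ᵥ ((a / D) • t)) / 2 ≤ a ^ 2 / D / 2 := by
    rw [smul_dotProduct, dotProduct_smul, smul_eq_mul, smul_eq_mul]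
    have : a ^ 2 / D = (a / D) ^ 2 * D := by field_simp
    rw [this]
    nlinarith [mul_le_mul_of_nonneg_left h (sq_nonneg (a / D))]
  have h4 : (Measure.pi fun _ : τ => gaussianReal 0 v) {x | a ≤ t ⬝ᵥ x} ≤
      ENNReal.ofReal (Real.exp (a ^ 2 / D / 2)) / ENNReal.ofReal (Real.exp (a ^ 2 / D)) := by
    rw [ENNReal.le_div_iff_mul_le (Or.inl (by simp [Real.exp_pos])) (Or.inl (by simp)), mul_comm]
    exact (mul_le_mul_right (measure_mono h2) _).trans
      (h1.trans (ENNReal.ofReal_le_ofReal (Real.exp_le_exp.2 h3)))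
  refine h4.trans (le_of_eq ?_)
  rw [← ENNReal.ofReal_div_of_pos (Real.exp_pos _), ← Real.exp_sub]
  congr 2
  ring

/-- The Gaussian mechanism. -/
lemma pi_gaussianReal_shift_le (c : τ → ℝ) {v : NNReal} (hv : v ≠ 0) {D α : ℝ} (hD : 0 < D)
    (hc : c ⬝ᵥ c / v ≤ D) (hDα : D ≤ α) {A : Set (τ → ℝ)} (hA : MeasurableSet A) :
    (Measure.pi fun _ : τ => gaussianReal 0 v) {x | x + c ∈ A} ≤
      ENNReal.ofReal (Real.exp α) * (Measure.pi fun _ : τ => gaussianReal 0 v) A +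
        ENNReal.ofReal (Real.exp (-α ^ 2 / (8 * D))) := by
  set γ : Measure (τ → ℝ) := Measure.pi fun _ : τ => gaussianReal 0 v with hγ
  have hv' : (0 : ℝ) < v := by exact_mod_cast pos_iff_ne_zero.2 hv
  -- The event that the log-likelihood ratio of the shifted law to γ is at most α.
  set E : Set (τ → ℝ) := {x | c ⬝ᵥ x / v - c ⬝ᵥ c / (2 * v) ≤ α} with hE
  have hlin : Measurable fun x : τ → ℝ => c ⬝ᵥ x := by
    unfold dotProduct
    fun_prop
  have hEm : MeasurableSet E :=
    measurableSet_le ((hlin.div_const _).sub_const _) measurable_const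
  have hadd : Measurable fun x : τ → ℝ => x + c := measurable_id.add_const c
  have h1 : γ {x | x + c ∈ A ∩ E} ≤ ENNReal.ofReal (Real.exp α) * γ A := by
    have : {x | x + c ∈ A ∩ E} = (fun x => x + c) ⁻¹' (A ∩ E) := rfl
    rw [this, ← Measure.map_apply hadd (hA.inter hEm), hγ, map_add_pi_gaussianReal,
      pi_gaussianReal_eq_withDensity c hv, withDensity_apply _ (hA.inter hEm), ← hγ]
    calc _ ≤ ∫⁻ x in A ∩ E, ENNReal.ofReal (Real.exp α) ∂γ := by
          refine setLIntegral_mono measurable_const fun x hx => ?_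
          exact ENNReal.ofReal_le_ofReal (Real.exp_le_exp.2 hx.2)
      _ = ENNReal.ofReal (Real.exp α) * γ (A ∩ E) := setLIntegral_const _ _
      _ ≤ _ := mul_le_mul_right (measure_mono Set.inter_subset_left) _
  -- At the shifted point the log-likelihood ratio is c·x/v + |c|²/(2v). The second term is at most
  -- D/2 ≤ α/2, so exceeding α forces a Gaussian variable of variance at most D above α/2.
  have h2 : γ {x | α / 2 ≤ (v : ℝ)⁻¹ • c ⬝ᵥ x} ≤
      ENNReal.ofReal (Real.exp (-α ^ 2 / (8 * D))) := by
    have hq : v * (((v : ℝ)⁻¹ • c) ⬝ᵥ ((v : ℝ)⁻¹ • c)) ≤ D := by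
      rw [smul_dotProduct, dotProduct_smul, smul_eq_mul, smul_eq_mul]
      refine le_trans (le_of_eq ?_) hc
      field_simp
    refine (pi_gaussianReal_dotProduct_ge_le _ v hD (by linarith) hq).trans (le_of_eq ?_)
    congr 2
    field_simp
    ring
  have h3 : {x | x + c ∈ A} ⊆ {x | x + c ∈ A ∩ E} ∪ {x | α / 2 ≤ (v : ℝ)⁻¹ • c ⬝ᵥ x} := by
    intro x hx
    by_cases hxE : x + c ∈ E
    · exact Or.inl ⟨hx, hxE⟩
    · refine Or.inr ?_
      simp only [hE, Set.mem_ofPred_eq, not_le, dotProduct_add] at hxE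
      rw [Set.mem_ofPred_eq, smul_dotProduct, smul_eq_mul]
      have e : (c ⬝ᵥ x + c ⬝ᵥ c) / v - c ⬝ᵥ c / (2 * v) =
          (v : ℝ)⁻¹ * (c ⬝ᵥ x) + c ⬝ᵥ c / v / 2 := by
        field_simp
        ring
      rw [e] at hxE
      linarith
  exact (measure_mono h3).trans ((measure_union_le _ _).trans (add_le_add h1 h2))

end GaussianPi

end PrivateGP
end

noncomputable section
open MeasureTheory ProbabilityTheory
namespace PrivateGP

/-! ### Privacy -/

open Matrix

section Privacy

/-- The matrix noise has one coordinate per unordered pair; choosing a representative of each pair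
bounds its sums by sums over all matrix entries. -/
lemma sum_sym2_le {ι : Type*} [Fintype ι] [DecidableEq ι] {g : Sym2 ι → ℝ} (hg : ∀ p, 0 ≤ g p) :
    ∑ p, g p ≤ ∑ i, ∑ j, g s(i, j) := by
  have hout : ∀ p : Sym2 ι, s((Quot.out p).1, (Quot.out p).2) = p := fun p => Quot.out_eq p
  have hinj : Function.Injective fun p : Sym2 ι => (Quot.out p : ι × ι) := fun p q h => by
    rw [← hout p, ← hout q]
    simp only at h
    rw [h]
  rw [← Fintype.sum_prod_type' (f := fun i j => g s(i, j))]
  calc ∑ p, g p = ∑ p ∈ Finset.univ.map ⟨_, hinj⟩, g s(p.1, p.2) := by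
        rw [Finset.sum_map]
        exact Finset.sum_congr rfl fun p _ => by rw [Function.Embedding.coeFn_mk, hout]
    _ ≤ ∑ p : ι × ι, g s(p.1, p.2) := Finset.sum_le_univ_sum_of_nonneg fun p => hg _

/-- The two blocks are shifted one after the other, each conditionally on the other, so the factor
e^α is paid twice. It is applied with half the privacy budget. -/
lemma prod_pi_gaussianReal_shift_le {τ τ' : Type*} [Fintype τ] [Fintype τ'] (a : τ → ℝ)
    (b : τ' → ℝ) {v v' : NNReal} (hv : v ≠ 0) (hv' : v' ≠ 0) {D D' α : ℝ} (hD : 0 < D)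
    (hD' : 0 < D') (ha : a ⬝ᵥ a / v ≤ D) (hb : b ⬝ᵥ b / v' ≤ D') (hDα : D ≤ α) (hDα' : D' ≤ α)
    {A : Set ((τ → ℝ) × (τ' → ℝ))} (hA : MeasurableSet A) :
    ((Measure.pi fun _ : τ => gaussianReal 0 v).prod
        (Measure.pi fun _ : τ' => gaussianReal 0 v')) {q | (q.1 + a, q.2 + b) ∈ A} ≤
      ENNReal.ofReal (Real.exp α) * (ENNReal.ofReal (Real.exp α) *
        ((Measure.pi fun _ : τ => gaussianReal 0 v).prod
          (Measure.pi fun _ : τ' => gaussianReal 0 v')) A +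
        ENNReal.ofReal (Real.exp (-α ^ 2 / (8 * D')))) +
        ENNReal.ofReal (Real.exp (-α ^ 2 / (8 * D))) := by
  set γ : Measure (τ → ℝ) := Measure.pi fun _ : τ => gaussianReal 0 v with hγ
  set γ' : Measure (τ' → ℝ) := Measure.pi fun _ : τ' => gaussianReal 0 v' with hγ'
  set A₁ : Set ((τ → ℝ) × (τ' → ℝ)) := {q | (q.1, q.2 + b) ∈ A} with hA₁
  have hm₁ : MeasurableSet A₁ := by
    have : Measurable fun q : (τ → ℝ) × (τ' → ℝ) => (q.1, q.2 + b) := by fun_prop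
    exact this hA
  have hm₂ : MeasurableSet {q : (τ → ℝ) × (τ' → ℝ) | (q.1 + a, q.2 + b) ∈ A} := by
    have : Measurable fun q : (τ → ℝ) × (τ' → ℝ) => (q.1 + a, q.2 + b) := by fun_prop
    exact this hA
  have h1 : (γ.prod γ') A₁ ≤ ENNReal.ofReal (Real.exp α) * (γ.prod γ') A +
      ENNReal.ofReal (Real.exp (-α ^ 2 / (8 * D'))) := by
    rw [Measure.prod_apply hm₁, Measure.prod_apply hA]
    calc _ ≤ ∫⁻ x, (ENNReal.ofReal (Real.exp α) * γ' (Prod.mk x ⁻¹' A) +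
          ENNReal.ofReal (Real.exp (-α ^ 2 / (8 * D')))) ∂γ := by
          refine lintegral_mono fun x => ?_
          exact pi_gaussianReal_shift_le b hv' hD' hb hDα' (measurable_prodMk_left hA)
      _ = _ := by
          rw [lintegral_add_right _ measurable_const, lintegral_const_mul _
            (measurable_measure_prodMk_left hA), lintegral_const, measure_univ, mul_one]
  have h2 : (γ.prod γ') {q | (q.1 + a, q.2 + b) ∈ A} ≤
      ENNReal.ofReal (Real.exp α) * (γ.prod γ') A₁ +
      ENNReal.ofReal (Real.exp (-α ^ 2 / (8 * D))) := by
    rw [Measure.prod_apply_symm hm₂, Measure.prod_apply_symm hm₁]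
    calc _ ≤ ∫⁻ y, (ENNReal.ofReal (Real.exp α) * γ ((fun x => (x, y)) ⁻¹' A₁) +
          ENNReal.ofReal (Real.exp (-α ^ 2 / (8 * D)))) ∂γ' := by
          refine lintegral_mono fun y => ?_
          exact pi_gaussianReal_shift_le a hv hD ha hDα (measurable_prodMk_right hm₁)
      _ = _ := by
          rw [lintegral_add_right _ measurable_const, lintegral_const_mul _
            (measurable_measure_prodMk_right hm₁), lintegral_const, measure_univ, mul_one]
  exact h2.trans (by gcongr)

variable {d : ℕ} (P : Params d)

lemma Params.Φ_dotProduct_self (hm : 0 < P.mbar) (x : Cube d) : P.Φ x ⬝ᵥ P.Φ x = 1 :=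
  qff_dotProduct_self P.ν hm x

lemma abs_dotProduct_le_one {ι : Type*} [Fintype ι] {u w : ι → ℝ} (hu : u ⬝ᵥ u = 1)
    (hw : w ⬝ᵥ w = 1) : |u ⬝ᵥ w| ≤ 1 := by
  classical
  have := abs_dotProduct_mulVec_le (PosSemidef.one (n := ι) (R := ℝ)) u w
  simpa [hu, hw] using this

/-- Difference of the matrix parts of two messages. -/
def gramShift {ι : Type*} (u w : ι → ℝ) : Sym2 ι → ℝ :=
  Sym2.lift ⟨fun i j => u i * u j - w i * w j, fun i j => by ring⟩

/-- The squared Frobenius norm of uuᵀ − wwᵀ is 2 − 2⟨u, w⟩², and counting each unordered pair once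
only decreases it. -/
lemma gramShift_dotProduct_self_le {ι : Type*} [Fintype ι] [DecidableEq ι] {u w : ι → ℝ}
    (hu : u ⬝ᵥ u = 1) (hw : w ⬝ᵥ w = 1) : gramShift u w ⬝ᵥ gramShift u w ≤ 2 := by
  have h1 := sum_sym2_le (g := fun p => gramShift u w p * gramShift u w p)
    fun p => mul_self_nonneg _
  refine h1.trans ?_
  have e : ∑ i, ∑ j, gramShift u w s(i, j) * gramShift u w s(i, j) =
      (u ⬝ᵥ u) * (u ⬝ᵥ u) + (w ⬝ᵥ w) * (w ⬝ᵥ w) - 2 * ((u ⬝ᵥ w) * (u ⬝ᵥ w)) := by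
    simp only [dotProduct]
    rw [Finset.sum_mul_sum, Finset.sum_mul_sum, Finset.sum_mul_sum, Finset.mul_sum,
      ← Finset.sum_add_distrib, ← Finset.sum_sub_distrib]
    refine Finset.sum_congr rfl fun i _ => ?_
    rw [Finset.mul_sum, ← Finset.sum_add_distrib, ← Finset.sum_sub_distrib]
    refine Finset.sum_congr rfl fun j _ => ?_
    simp only [gramShift, Sym2.lift_mk]
    ring
  rw [e, hu, hw]
  nlinarith [mul_self_nonneg (u ⬝ᵥ w)]

/-- Changing the user amounts to translating the noise, which reduces privacy to the Gaussian
mechanism. -/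
lemma Params.message_eq (s : P.State) (x x' : Cube d) (y y' : ℝ) (N : Sym2 P.Idx → ℝ)
    (n : P.Idx → ℝ) : P.message s x y N n =
      P.message s x' y' (N + gramShift (P.Φ x) (P.Φ x')) (n + (y • P.Φ x - y' • P.Φ x')) := by
  unfold Params.message
  congr 1
  · ext i j
    simp only [Pi.add_apply, gramShift, Sym2.lift_mk]
    ring
  · ext i
    simp only [Pi.add_apply, Pi.sub_apply, Pi.smul_apply, smul_eq_mul]
    ring

lemma Params.measurable_message (s : P.State) (x : Cube d) :
    Measurable fun q : ℝ × (Sym2 P.Idx → ℝ) × (P.Idx → ℝ) => P.message s x q.1 q.2.1 q.2.2 := by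
  unfold Params.message
  refine Measurable.prodMk ?_ ?_
  · refine measurable_pi_lambda _ fun i => measurable_pi_lambda _ fun j => ?_
    fun_prop
  · refine measurable_pi_lambda _ fun i => ?_
    fun_prop

instance : IsProbabilityMeasure P.noiseLaw := by
  unfold Params.noiseLaw
  infer_instance

/-- Privacy of the message for fixed rewards. -/
lemma Params.noiseLaw_message_le (hm : 0 < P.mbar) (hσX : 0 < P.σX) (hσu : 0 < P.σu)
    {D D' Y α : ℝ} (hD : 0 < D) (hD' : 0 < D') (hDα : D ≤ α) (hDα' : D' ≤ α)
    (h1 : 2 / P.σX ^ 2 ≤ D) (h2 : 4 * Y ^ 2 / P.σu ^ 2 ≤ D') (s : P.State) (x x' : Cube d)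
    {y y' : ℝ} (hy : |y| ≤ Y) (hy' : |y'| ≤ Y) {S : Set P.State} (hS : MeasurableSet S) :
    P.noiseLaw {q | P.message s x y q.1 q.2 ∈ S} ≤
      ENNReal.ofReal (Real.exp α) * (ENNReal.ofReal (Real.exp α) *
        P.noiseLaw {q | P.message s x' y' q.1 q.2 ∈ S} +
        ENNReal.ofReal (Real.exp (-α ^ 2 / (8 * D')))) +
        ENNReal.ofReal (Real.exp (-α ^ 2 / (8 * D))) := by
  have hu := P.Φ_dotProduct_self hm x
  have hw := P.Φ_dotProduct_self hm x'
  have hX2 : 0 < P.σX ^ 2 := by positivity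
  have hu2 : 0 < P.σu ^ 2 := by positivity
  have hS' : MeasurableSet {q : (Sym2 P.Idx → ℝ) × (P.Idx → ℝ) |
      P.message s x' y' q.1 q.2 ∈ S} :=
    ((P.measurable_message s x').comp (measurable_prodMk_left (x := y'))) hS
  have key := prod_pi_gaussianReal_shift_le (gramShift (P.Φ x) (P.Φ x'))
    (y • P.Φ x - y' • P.Φ x') (v := (P.σX ^ 2).toNNReal) (v' := (P.σu ^ 2).toNNReal)
    (by simpa using hX2.ne') (by simpa using hu2.ne') hD hD' ?_ ?_ hDα hDα' hS'
  · refine le_trans (le_of_eq ?_) key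
    simp only [Params.message_eq P s x x' y y', Set.mem_ofPred_eq]
    rfl
  · rw [Real.coe_toNNReal _ hX2.le]
    exact (div_le_div_of_nonneg_right (gramShift_dotProduct_self_le hu hw) hX2.le).trans h1
  · rw [Real.coe_toNNReal _ hu2.le]
    refine (div_le_div_of_nonneg_right ?_ hu2.le).trans h2
    have hc := abs_le.1 (abs_dotProduct_le_one hu hw)
    have e : (y • P.Φ x - y' • P.Φ x') ⬝ᵥ (y • P.Φ x - y' • P.Φ x') =
        y ^ 2 + y' ^ 2 - 2 * (y * y') * (P.Φ x ⬝ᵥ P.Φ x') := by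
      simp only [sub_dotProduct, dotProduct_sub, smul_dotProduct, dotProduct_smul, smul_eq_mul, hu,
        hw, dotProduct_comm (P.Φ x') (P.Φ x)]
      ring
    rw [e]
    have hyy := abs_le.1 hy
    have hyy' := abs_le.1 hy'
    have hY : 0 ≤ Y := (abs_nonneg y).trans hy
    have q1 : y ^ 2 ≤ Y ^ 2 := sq_le_sq' hyy.1 hyy.2
    have q2 : y' ^ 2 ≤ Y ^ 2 := sq_le_sq' hyy'.1 hyy'.2
    have q3 : |(y * y') * (P.Φ x ⬝ᵥ P.Φ x')| ≤ Y * Y * 1 := by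
      rw [abs_mul, abs_mul]
      gcongr
      exact abs_le.2 hc
    have := (abs_le.1 q3).1
    nlinarith

/-- Tail of the reward. -/
lemma User.response_tail {B ρ : ℝ} (hρ : 0 < ρ) (U : User d B ρ) (x : Cube d) {r : ℝ}
    (hr : 0 ≤ r) : U.response x {y | ¬ |y| ≤ B + r} ≤
      2 * ENNReal.ofReal (Real.exp (-r ^ 2 / (2 * ρ ^ 2))) := by
  have := U.isProbability x
  have hsub := U.subgaussian x
  have hmean := abs_le.1 (U.abs_mean_le x)
  set m := ∫ y', y' ∂(U.response x) with hmdef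
  have h1 := hsub.measure_ge_le hr
  have h2 := hsub.neg.measure_ge_le hr
  have hcoe : (((ρ ^ 2).toNNReal : NNReal) : ℝ) = ρ ^ 2 := Real.coe_toNNReal _ (by positivity)
  rw [hcoe] at h1 h2
  have h1' := ENNReal.ofReal_le_ofReal h1
  have h2' := ENNReal.ofReal_le_ofReal h2
  rw [ofReal_measureReal] at h1' h2'
  have hsubset : {y | ¬ |y| ≤ B + r} ⊆ {y | r ≤ y - m} ∪ {y | r ≤ (-fun y => y - m) y} := by
    intro y hy
    simp only [Set.mem_ofPred_eq, not_le] at hy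
    rcases lt_abs.1 hy with h | h
    · left
      simp only [Set.mem_ofPred_eq]
      linarith
    · right
      simp only [Set.mem_ofPred_eq, Pi.neg_apply]
      linarith
  rw [two_mul]
  exact (measure_mono hsubset).trans ((measure_union_le _ _).trans (add_le_add h1' h2'))

lemma Params.messageLaw_apply (s : P.State) (x : Cube d) (r : Measure ℝ) [IsProbabilityMeasure r]
    {S : Set P.State} (hS : MeasurableSet S) :
    P.messageLaw s x r S = ∫⁻ y, P.noiseLaw {q | P.message s x y q.1 q.2 ∈ S} ∂r := by
  rw [Params.messageLaw, Measure.map_apply (P.measurable_message s x) hS,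
    Measure.prod_apply (P.measurable_message s x hS)]
  rfl

/-- Privacy of a mixture over the reward from privacy for bounded rewards. -/
lemma lintegral_le_of_forall_good {r r' : Measure ℝ} [IsProbabilityMeasure r]
    [IsProbabilityMeasure r'] {f g : ℝ → ENNReal} (hg : Measurable g)
    (hf1 : ∀ y, f y ≤ 1) {G : Set ℝ} (hG : MeasurableSet G) {a b c : ENNReal}
    (h : ∀ y ∈ G, ∀ y' ∈ G, f y ≤ a * g y' + b) (hr : r Gᶜ ≤ c) (hr' : r' Gᶜ ≤ c) :
    ∫⁻ y, f y ∂r ≤ a * ∫⁻ y, g y ∂r' + (b + c + c) := by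
  -- The inequality for good pairs is averaged first over y with y' fixed, then over y'. Each
  -- averaging pays c for the bad set, where the trivial bound 1 is used.
  have h1 : ∀ y' ∈ G, ∫⁻ y, f y ∂r ≤ a * g y' + (b + c) := by
    intro y' hy'
    calc ∫⁻ y, f y ∂r ≤ ∫⁻ y, ((a * g y' + b) + Gᶜ.indicator 1 y) ∂r := by
          refine lintegral_mono fun y => ?_
          by_cases hy : y ∈ G
          · exact (h y hy y' hy').trans le_self_add
          · rw [Set.indicator_of_mem (show y ∈ Gᶜ from hy)]
            exact (hf1 y).trans le_add_self
      _ = (a * g y' + b) + r Gᶜ := by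
          rw [lintegral_add_left measurable_const, lintegral_const, measure_univ, mul_one,
            lintegral_indicator_one hG.compl]
      _ ≤ (a * g y' + b) + c := by gcongr
      _ = _ := by rw [add_assoc]
  have h0 : ∫⁻ y, f y ∂r ≤ 1 :=
    (lintegral_mono hf1).trans (by simp)
  calc ∫⁻ y, f y ∂r = ∫⁻ _, (∫⁻ y, f y ∂r) ∂r' := by simp
    _ ≤ ∫⁻ y', ((a * g y' + (b + c)) + Gᶜ.indicator 1 y') ∂r' := by
        refine lintegral_mono fun y' => ?_
        by_cases hy : y' ∈ G
        · exact (h1 y' hy).trans le_self_add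
        · rw [Set.indicator_of_mem (show y' ∈ Gᶜ from hy)]
          exact h0.trans le_add_self
    _ = (a * ∫⁻ y, g y ∂r' + (b + c)) + r' Gᶜ := by
        rw [lintegral_add_left (by fun_prop), lintegral_add_right _ measurable_const,
          lintegral_const_mul _ hg, lintegral_const, measure_univ, mul_one,
          lintegral_indicator_one hG.compl]
    _ ≤ (a * ∫⁻ y, g y ∂r' + (b + c)) + c := by gcongr
    _ = _ := by ring

/-- Sufficient noise levels for local joint differential privacy. -/
lemma Params.localJDP_of_noise (hm : 0 < P.mbar) (hσX : 0 < P.σX) (hσu : 0 < P.σu)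
    (hρ : 0 < P.ρ) {α α₀ β : ℝ} (hα : 0 < α) (hαα : α ≤ α₀) (hβ : 0 < β) (hβ1 : β < 1)
    (h1 : 2 * (32 * (2 + α₀)) * Real.log (5 / β) / α ^ 2 ≤ P.σX ^ 2)
    (h2 : 4 * (32 * (2 + α₀)) * (P.B + P.ρ * Real.sqrt (2 * Real.log (8 / β))) ^ 2 *
      Real.log (5 / β) / α ^ 2 ≤ P.σu ^ 2) :
    P.LocalJDP α β := by
  rintro t - s ⟨⟨U, x⟩, -⟩ ⟨⟨U', x'⟩, -⟩ S hS
  have := U.isProbability x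
  have := U'.isProbability x'
  simp only
  set ℓ := Real.log (5 / β) with hℓ
  have hexp1 : Real.exp 1 ≤ 5 := (Real.exp_one_lt_d9.le).trans (by norm_num)
  have hℓ1 : 1 ≤ ℓ := by
    rw [hℓ, Real.le_log_iff_exp_le (by positivity), le_div_iff₀ hβ]
    nlinarith [Real.exp_pos 1]
  -- With D = α²/(Kℓ) and budget α/2 per block, the tail exp(−(α/2)²/(8D)) equals exp(−(2 + α₀)ℓ).
  -- The part 2ℓ yields at most β/25, and α₀ℓ ≥ α offsets the factor e^{α/2} in front of one of the
  -- tails.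
  set K := 32 * (2 + α₀) with hK
  have hα₀ : 0 < α₀ := hα.trans_le hαα
  have hK0 : 0 < K := by positivity
  -- A reward exceeds B + r in absolute value with probability at most 2·exp(−log(8/β)) = β/4. Two
  -- such terms, one per user, and β/2 for the Gaussian tails add up to β.
  set r := P.ρ * Real.sqrt (2 * Real.log (8 / β)) with hr
  have hlog8 : 0 ≤ Real.log (8 / β) := Real.log_nonneg (by rw [le_div_iff₀ hβ]; linarith)
  have hr0 : 0 ≤ r := by positivity
  set Y := P.B + r with hY
  set D := α ^ 2 / (K * ℓ) with hDdef
  have hD : 0 < D := by positivity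
  have hDα : D ≤ α / 2 := by
    rw [hDdef, div_le_iff₀ (by positivity)]
    have : 2 * α ≤ K * ℓ := by
      calc 2 * α ≤ K * 1 := by rw [hK]; linarith
        _ ≤ K * ℓ := by gcongr
    nlinarith
  have hX2 : 0 < P.σX ^ 2 := by positivity
  have hu2 : 0 < P.σu ^ 2 := by positivity
  have hD1 : 2 / P.σX ^ 2 ≤ D := by
    rw [hDdef, div_le_div_iff₀ hX2 (by positivity)]
    rw [div_le_iff₀ (by positivity)] at h1
    linarith
  have hD2 : 4 * Y ^ 2 / P.σu ^ 2 ≤ D := by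
    rw [hDdef, div_le_div_iff₀ hu2 (by positivity)]
    rw [div_le_iff₀ (by positivity)] at h2
    linarith
  set e := ENNReal.ofReal (Real.exp (-(α / 2) ^ 2 / (8 * D))) with he
  set E := ENNReal.ofReal (Real.exp (α / 2)) with hE
  have htail : E * e + e ≤ ENNReal.ofReal (β / 2) := by
    have q1 : -(α / 2) ^ 2 / (8 * D) = -((2 + α₀) * ℓ) := by
      rw [hDdef, hK]
      field_simp
      ring
    have q2 : Real.exp (-((2 + α₀) * ℓ)) ≤ β / 5 * (1 / 5) * Real.exp (-α) := by
      have q3 : -((2 + α₀) * ℓ) ≤ -ℓ + -ℓ + -α := by nlinarith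
      have q4 : Real.exp (-ℓ) = β / 5 := by
        rw [Real.exp_neg, hℓ, Real.exp_log (by positivity), inv_div]
      refine (Real.exp_le_exp.2 q3).trans ?_
      rw [Real.exp_add, Real.exp_add, q4]
      gcongr
    have q5 : Real.exp (α / 2) * Real.exp (-α) ≤ 1 := by
      rw [← Real.exp_add]
      exact Real.exp_le_one_iff.2 (by linarith)
    have q6 : Real.exp (-α) ≤ 1 := Real.exp_le_one_iff.2 (by linarith)
    rw [he, hE, q1, ← ENNReal.ofReal_mul (Real.exp_pos _).le,
      ← ENNReal.ofReal_add (by positivity) (by positivity)]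
    refine ENNReal.ofReal_le_ofReal ?_
    have q7 := mul_le_mul_of_nonneg_left q2 (Real.exp_pos (α / 2)).le
    nlinarith
  have hbad : ∀ (U : User d P.B P.ρ) (x : Cube d),
      U.response x {y | |y| ≤ Y}ᶜ ≤ ENNReal.ofReal (β / 4) := by
    intro U x
    refine (User.response_tail hρ U x hr0).trans (le_of_eq ?_)
    have q1 : -r ^ 2 / (2 * P.ρ ^ 2) = -Real.log (8 / β) := by
      rw [hr, mul_pow, Real.sq_sqrt (by positivity)]
      field_simp
    rw [q1, Real.exp_neg, Real.exp_log (by positivity), inv_div,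
      show (2 : ENNReal) = ENNReal.ofReal 2 by simp, ← ENNReal.ofReal_mul zero_le_two]
    congr 1
    ring
  have hG : MeasurableSet {y : ℝ | |y| ≤ Y} := measurableSet_le (by fun_prop) measurable_const
  rw [P.messageLaw_apply s x _ hS, P.messageLaw_apply s x' _ hS]
  have hmeas : Measurable fun y => P.noiseLaw {q | P.message s x' y q.1 q.2 ∈ S} :=
    measurable_measure_prodMk_left (P.measurable_message s x' hS)
  refine (lintegral_le_of_forall_good (a := ENNReal.ofReal (Real.exp α)) (b := E * e + e)
    (c := ENNReal.ofReal (β / 4)) hmeas (fun y => prob_le_one) hG ?_ (hbad U x)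
    (hbad U' x')).trans ?_
  · intro y hy y' hy'
    refine (P.noiseLaw_message_le hm hσX hσu hD hD hDα hDα hD1 hD2 s x x' hy hy' hS).trans
      (le_of_eq ?_)
    have : ENNReal.ofReal (Real.exp α) = E * E := by
      rw [hE, ← ENNReal.ofReal_mul (Real.exp_pos _).le, ← Real.exp_add]
      congr 2
      ring
    rw [this, ← hE, ← he]
    ring
  · gcongr
    calc _ ≤ ENNReal.ofReal (β / 2) + ENNReal.ofReal (β / 4) + ENNReal.ofReal (β / 4) := by gcongr
      _ = ENNReal.ofReal β := by
        rw [← ENNReal.ofReal_add (by positivity) (by positivity),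
          ← ENNReal.ofReal_add (by positivity) (by positivity)]
        congr 1
        ring

end Privacy

end PrivateGP
end

noncomputable section
open MeasureTheory ProbabilityTheory
namespace PrivateGP

/-! ### Self-normalised concentration -/

open Matrix Filter Topology
open scoped ENNReal

section SelfNormalised

/-- Conditional sub-Gaussianity, integrated against a nonnegative weight. -/
lemma lintegral_mul_exp_le {Ω : Type*} {m : MeasurableSpace Ω} [mΩ : MeasurableSpace Ω]
    {μ : Measure Ω} [IsProbabilityMeasure μ] (hm : m ≤ mΩ) {ε : Ω → ℝ} (hε : Measurable ε)
    {ρ a : ℝ} (hInt : Integrable (fun ω => Real.exp (a * ε ω)) μ)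
    (hsub : μ[fun ω => Real.exp (a * ε ω) | m] ≤ᵐ[μ] fun _ => Real.exp (ρ ^ 2 * a ^ 2 / 2))
    {W : Ω → ℝ≥0∞} (hW : Measurable[m] W) :
    ∫⁻ ω, W ω * ENNReal.ofReal (Real.exp (a * ε ω - ρ ^ 2 * a ^ 2 / 2)) ∂μ ≤ ∫⁻ ω, W ω ∂μ := by
  set f : Ω → ℝ≥0∞ := fun ω => ENNReal.ofReal (Real.exp (a * ε ω - ρ ^ 2 * a ^ 2 / 2)) with hf
  have hfm : Measurable f := by fun_prop
  -- The conditional bound says that tilting by f does not increase the measure of any set in m.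
  -- Comparing the two measures on m treats all m-measurable weights at once, with no integrability
  -- condition.
  have h1 : (μ.withDensity f).trim hm ≤ μ.trim hm := by
    refine Measure.le_iff.2 fun B hB => ?_
    rw [trim_measurableSet_eq hm hB, trim_measurableSet_eq hm hB, withDensity_apply _ (hm _ hB)]
    have e : ∀ ω, f ω = ENNReal.ofReal (Real.exp (a * ε ω)) *
        ENNReal.ofReal (Real.exp (-(ρ ^ 2 * a ^ 2 / 2))) := fun ω => by
      rw [← ENNReal.ofReal_mul (Real.exp_pos _).le, ← Real.exp_add, ← sub_eq_add_neg]
    simp only [e]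
    rw [lintegral_mul_const _ (by fun_prop), ← ofReal_integral_eq_lintegral_ofReal hInt.integrableOn
      (Eventually.of_forall fun _ => (Real.exp_pos _).le), ← setIntegral_condExp hm hInt hB]
    have h2 : ∫ ω in B, (μ[fun ω => Real.exp (a * ε ω) | m]) ω ∂μ ≤
        ∫ _ in B, Real.exp (ρ ^ 2 * a ^ 2 / 2) ∂μ :=
      integral_mono_ae integrable_condExp.integrableOn (integrable_const _)
        (ae_restrict_of_ae hsub)
    rw [setIntegral_const, smul_eq_mul] at h2
    refine (mul_le_mul_left (ENNReal.ofReal_le_ofReal h2) _).trans (le_of_eq ?_)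
    rw [← ENNReal.ofReal_mul (by positivity), mul_assoc, ← Real.exp_add, add_neg_cancel,
      Real.exp_zero, mul_one, ofReal_measureReal]
  calc ∫⁻ ω, W ω * f ω ∂μ = ∫⁻ ω, W ω ∂(μ.withDensity f) := by
        rw [lintegral_withDensity_eq_lintegral_mul _ hfm (hW.mono hm le_rfl)]
        simp only [Pi.mul_apply, mul_comm]
    _ = ∫⁻ ω, W ω ∂((μ.withDensity f).trim hm) := (lintegral_trim hm hW).symm
    _ ≤ ∫⁻ ω, W ω ∂(μ.trim hm) := lintegral_mono' h1 le_rfl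
    _ = ∫⁻ ω, W ω ∂μ := lintegral_trim hm hW

/-- The same with a multiplier that is random but known. -/
lemma lintegral_mul_exp_le_of_measurable {Ω : Type*} {m : MeasurableSpace Ω} [mΩ : MeasurableSpace Ω]
    {μ : Measure Ω} [IsProbabilityMeasure μ] (hm : m ≤ mΩ) {ε : Ω → ℝ}
    (hε : Measurable ε) {ρ : ℝ} (hInt : ∀ a, Integrable (fun ω => Real.exp (a * ε ω)) μ)
    (hsub : ∀ a, μ[fun ω => Real.exp (a * ε ω) | m] ≤ᵐ[μ]
      fun _ => Real.exp (ρ ^ 2 * a ^ 2 / 2))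
    {W : Ω → ℝ≥0∞} (hW : Measurable[m] W) {Z : Ω → ℝ} (hZ : Measurable[m] Z) :
    ∫⁻ ω, W ω * ENNReal.ofReal (Real.exp (Z ω * ε ω - ρ ^ 2 * Z ω ^ 2 / 2)) ∂μ ≤
      ∫⁻ ω, W ω ∂μ := by
  have hW' := hW.mono hm le_rfl
  have hZ' := hZ.mono hm le_rfl
  set F : ℝ → Ω → ℝ≥0∞ := fun a ω => ENNReal.ofReal (Real.exp (a * ε ω - ρ ^ 2 * a ^ 2 / 2))
    with hF
  -- Z rounded down to a multiple of 1/(n+1) has countably many values, each on a set of m, where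
  -- the multiplier is constant. Fatou's lemma gives the limit.
  set Zn : ℕ → Ω → ℝ := fun n ω => (⌊(n + 1 : ℝ) * Z ω⌋ : ℝ) / (n + 1) with hZn
  have hstep : ∀ n, ∫⁻ ω, W ω * F (Zn n ω) ω ∂μ ≤ ∫⁻ ω, W ω ∂μ := by
    intro n
    have hfl : Measurable[m] fun ω => ⌊(n + 1 : ℝ) * Z ω⌋ :=
      Int.measurable_floor.comp ((measurable_const_mul _).comp hZ)
    have hset : ∀ k : ℤ, MeasurableSet[m] {ω | ⌊(n + 1 : ℝ) * Z ω⌋ = k} := fun k =>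
      hfl (measurableSet_singleton k)
    have hpt : ∀ ω, ∀ g : ℤ → ℝ≥0∞,
        ∑' k : ℤ, {ω | ⌊(n + 1 : ℝ) * Z ω⌋ = k}.indicator (fun _ => g k) ω =
          g ⌊(n + 1 : ℝ) * Z ω⌋ := by
      intro ω g
      rw [tsum_eq_single ⌊(n + 1 : ℝ) * Z ω⌋]
      · simp
      · intro k hk
        rw [Set.indicator_of_notMem]
        exact fun h => hk (Eq.symm h)
    have hWk : ∀ k : ℤ, Measurable[m] fun ω =>
        {ω | ⌊(n + 1 : ℝ) * Z ω⌋ = k}.indicator (fun _ => (1 : ℝ≥0∞)) ω * W ω := fun k =>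
      (Measurable.indicator measurable_const (hset k)).mul hW
    calc ∫⁻ ω, W ω * F (Zn n ω) ω ∂μ
        = ∫⁻ ω, ∑' k : ℤ, ({ω | ⌊(n + 1 : ℝ) * Z ω⌋ = k}.indicator (fun _ => (1 : ℝ≥0∞)) ω *
            W ω) * F ((k : ℝ) / (n + 1)) ω ∂μ := by
          refine lintegral_congr fun ω => ?_
          rw [← hpt ω fun k => W ω * F ((k : ℝ) / (n + 1)) ω]
          refine tsum_congr fun k => ?_
          by_cases h : ω ∈ {ω | ⌊(n + 1 : ℝ) * Z ω⌋ = k}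
          · rw [Set.indicator_of_mem h, Set.indicator_of_mem h, one_mul]
          · rw [Set.indicator_of_notMem h, Set.indicator_of_notMem h, zero_mul, zero_mul]
      _ = ∑' k : ℤ, ∫⁻ ω, ({ω | ⌊(n + 1 : ℝ) * Z ω⌋ = k}.indicator (fun _ => (1 : ℝ≥0∞)) ω *
            W ω) * F ((k : ℝ) / (n + 1)) ω ∂μ :=
          lintegral_tsum fun k => (((hWk k).mono hm le_rfl).mul (by fun_prop)).aemeasurable
      _ ≤ ∑' k : ℤ, ∫⁻ ω, {ω | ⌊(n + 1 : ℝ) * Z ω⌋ = k}.indicator (fun _ => (1 : ℝ≥0∞)) ω *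
            W ω ∂μ :=
          ENNReal.tsum_le_tsum fun k => lintegral_mul_exp_le hm hε (hInt _) (hsub _) (hWk k)
      _ = ∫⁻ ω, ∑' k : ℤ, {ω | ⌊(n + 1 : ℝ) * Z ω⌋ = k}.indicator (fun _ => (1 : ℝ≥0∞)) ω *
            W ω ∂μ :=
          (lintegral_tsum fun k => ((hWk k).mono hm le_rfl).aemeasurable).symm
      _ = ∫⁻ ω, W ω ∂μ := by
          refine lintegral_congr fun ω => ?_
          rw [ENNReal.tsum_mul_right, hpt ω fun _ => 1, one_mul]
  have hZlim : ∀ ω, Tendsto (fun n => Zn n ω) atTop (𝓝 (Z ω)) := by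
    intro ω
    have h2 : Tendsto (fun n : ℕ => Z ω - 1 / ((n : ℝ) + 1)) atTop (𝓝 (Z ω)) := by
      simpa using tendsto_const_nhds.sub (tendsto_one_div_add_atTop_nhds_zero_nat (𝕜 := ℝ))
    refine tendsto_of_tendsto_of_tendsto_of_le_of_le h2 tendsto_const_nhds (fun n => ?_) fun n => ?_
    · have h0 : (0 : ℝ) < (n : ℝ) + 1 := by positivity
      simp only [hZn]
      rw [le_div_iff₀ h0, sub_mul, div_mul_cancel₀ _ h0.ne']
      linarith [Int.sub_one_lt_floor (((n : ℝ) + 1) * Z ω)]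
    · have h0 : (0 : ℝ) < (n : ℝ) + 1 := by positivity
      simp only [hZn]
      rw [div_le_iff₀ h0]
      linarith [Int.floor_le (((n : ℝ) + 1) * Z ω)]
  have hlim : ∀ ω, Tendsto (fun n => W ω * F (Zn n ω) ω) atTop (𝓝 (W ω * F (Z ω) ω)) := by
    intro ω
    refine ENNReal.Tendsto.const_mul ?_ (Or.inl ?_)
    · refine ENNReal.tendsto_ofReal ((Real.continuous_exp.tendsto _).comp ?_)
      exact ((hZlim ω).mul_const _).sub ((((hZlim ω).pow 2).const_mul _).div_const _)
    · simp [hF, Real.exp_pos]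
  have hFm : ∀ n, Measurable fun ω => W ω * F (Zn n ω) ω := by
    intro n
    have : Measurable (Zn n) := by
      have h1 : Measurable fun ω => ⌊(n + 1 : ℝ) * Z ω⌋ := (hZ'.const_mul _).floor
      have h2 : Measurable fun ω => ((⌊(n + 1 : ℝ) * Z ω⌋ : ℤ) : ℝ) :=
        (measurable_of_countable fun k : ℤ => (k : ℝ)).comp h1
      exact h2.div_const _
    simp only [hF]
    fun_prop
  calc ∫⁻ ω, W ω * F (Z ω) ω ∂μ = ∫⁻ ω, liminf (fun n => W ω * F (Zn n ω) ω) atTop ∂μ :=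
        lintegral_congr fun ω => (hlim ω).liminf_eq.symm
    _ ≤ liminf (fun n => ∫⁻ ω, W ω * F (Zn n ω) ω ∂μ) atTop := lintegral_liminf_le hFm
    _ ≤ liminf (fun _ : ℕ => ∫⁻ ω, W ω ∂μ) atTop := liminf_le_liminf (Eventually.of_forall hstep)
    _ = _ := liminf_const _

variable {Ω : Type*} [mΩ : MeasurableSpace Ω] {μ : Measure Ω} [IsProbabilityMeasure μ]

/-- Ville's maximal inequality over a finite horizon. -/
lemma mul_measure_exists_le {ℱ : Filtration ℕ mΩ} {M : ℕ → Ω → ℝ≥0∞} {T : ℕ}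
    (hM : ∀ t ≤ T, Measurable[ℱ t] (M t))
    (hsuper : ∀ t < T, ∀ A, MeasurableSet[ℱ t] A → ∫⁻ ω in A, M (t + 1) ω ∂μ ≤ ∫⁻ ω in A, M t ω ∂μ)
    (c : ℝ≥0∞) : c * μ {ω | ∃ t ≤ T, c ≤ M t ω} ≤ ∫⁻ ω, M 0 ω ∂μ := by
  have hMm : ∀ t ≤ T, Measurable (M t) := fun t ht => (hM t ht).mono (ℱ.le t) le_rfl
  -- The induction carries a sharper quantity: c times the probability that the level has been
  -- reached, plus the expectation of M_t on the paths that are still below it.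
  have key : ∀ t ≤ T, MeasurableSet[ℱ t] {ω | ∃ s ≤ t, c ≤ M s ω} ∧
      c * μ {ω | ∃ s ≤ t, c ≤ M s ω} + ∫⁻ ω in {ω | ∃ s ≤ t, c ≤ M s ω}ᶜ, M t ω ∂μ ≤
        ∫⁻ ω, M 0 ω ∂μ := by
    intro t
    induction t with
    | zero =>
      intro _
      have e : {ω | ∃ s ≤ 0, c ≤ M s ω} = {ω | c ≤ M 0 ω} := by
        ext ω
        simp
      have hms : MeasurableSet[ℱ 0] {ω | c ≤ M 0 ω} :=
        measurableSet_le measurable_const (hM 0 (by omega))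
      rw [e]
      refine ⟨hms, ?_⟩
      rw [← lintegral_add_compl (μ := μ) (M 0) (ℱ.le 0 _ hms)]
      refine add_le_add ?_ le_rfl
      calc c * μ {ω | c ≤ M 0 ω} = ∫⁻ _ in {ω | c ≤ M 0 ω}, c ∂μ := (setLIntegral_const _ _).symm
        _ ≤ _ := setLIntegral_mono (hMm 0 (by omega)) fun ω hω => hω
    | succ t ih =>
      intro ht
      obtain ⟨ihm, ihle⟩ := ih (by omega)
      set B := {ω | ∃ s ≤ t, c ≤ M s ω} with hB
      set E := {ω | c ≤ M (t + 1) ω} with hE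
      have e : {ω | ∃ s ≤ t + 1, c ≤ M s ω} = B ∪ (Bᶜ ∩ E) := by
        ext ω
        simp only [hB, hE, Set.mem_union, Set.mem_inter_iff, Set.mem_compl_iff, Set.mem_ofPred_eq]
        constructor
        · rintro ⟨s, hs, h⟩
          by_cases hb : ∃ s ≤ t, c ≤ M s ω
          · exact Or.inl hb
          · refine Or.inr ⟨hb, ?_⟩
            rcases Nat.lt_or_ge s (t + 1) with h1 | h1
            · exact absurd ⟨s, by omega, h⟩ hb
            · obtain rfl : s = t + 1 := by omega
              exact h
        · rintro (⟨s, hs, h⟩ | ⟨-, h⟩)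
          · exact ⟨s, by omega, h⟩
          · exact ⟨t + 1, le_rfl, h⟩
      have hEm : MeasurableSet[ℱ (t + 1)] E := measurableSet_le measurable_const (hM _ ht)
      have hBm : MeasurableSet[ℱ (t + 1)] B := ℱ.mono (Nat.le_succ t) _ ihm
      have hBm' := ℱ.le _ _ hBm
      have hEm' := ℱ.le _ _ hEm
      rw [e]
      refine ⟨hBm.union (hBm.compl.inter hEm), ?_⟩
      have h1 : c * μ (Bᶜ ∩ E) ≤ ∫⁻ ω in Bᶜ ∩ E, M (t + 1) ω ∂μ := by
        calc c * μ (Bᶜ ∩ E) = ∫⁻ _ in Bᶜ ∩ E, c ∂μ := (setLIntegral_const _ _).symm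
          _ ≤ _ := setLIntegral_mono (hMm _ ht) fun ω hω => hω.2
      have h2 : (B ∪ (Bᶜ ∩ E))ᶜ = Bᶜ \ E := by
        ext ω
        simp only [Set.mem_compl_iff, Set.mem_union, Set.mem_inter_iff, Set.mem_sdiff]
        tauto
      have h3 := lintegral_inter_add_sdiff (μ := μ) (M (t + 1)) Bᶜ hEm'
      rw [h2]
      calc _ ≤ c * (μ B + μ (Bᶜ ∩ E)) + ∫⁻ ω in Bᶜ \ E, M (t + 1) ω ∂μ := by
            exact add_le_add (mul_le_mul_right (measure_union_le _ _) _) le_rfl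
        _ ≤ c * μ B + (∫⁻ ω in Bᶜ ∩ E, M (t + 1) ω ∂μ + ∫⁻ ω in Bᶜ \ E, M (t + 1) ω ∂μ) := by
            rw [mul_add, add_assoc]
            exact add_le_add le_rfl (add_le_add h1 le_rfl)
        _ = c * μ B + ∫⁻ ω in Bᶜ, M (t + 1) ω ∂μ := by rw [h3]
        _ ≤ c * μ B + ∫⁻ ω in Bᶜ, M t ω ∂μ := by
            exact add_le_add le_rfl (hsuper t (by omega) _ ihm.compl)
        _ ≤ _ := ihle
  exact le_self_add.trans (key T le_rfl).2

variable {ι : Type*} [Fintype ι] [DecidableEq ι]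

/-- Self-normalised bound for vector-valued martingales, by the method of mixtures. -/
lemma measure_selfNormalised_le {ℱ : Filtration ℕ mΩ} {X : ℕ → Ω → ι → ℝ} {ε : ℕ → Ω → ℝ} {T : ℕ}
    {ρ c δ : ℝ} (hρ : 0 < ρ) (hc : 0 < c) (hδ : 0 < δ)
    (hX : ∀ t < T, Measurable[ℱ t] (X t)) (hε : ∀ t < T, Measurable[ℱ (t + 1)] (ε t))
    (hInt : ∀ t < T, ∀ a : ℝ, Integrable (fun ω => Real.exp (a * ε t ω)) μ)
    (hsub : ∀ t < T, ∀ a : ℝ, μ[fun ω => Real.exp (a * ε t ω) | ℱ t] ≤ᵐ[μ]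
      fun _ => Real.exp (ρ ^ 2 * a ^ 2 / 2)) :
    μ {ω | ∃ t ≤ T, ρ ^ 2 * (Real.log (c⁻¹ • (c • (1 : Matrix ι ι ℝ) +
        ∑ s ∈ Finset.range t, vecMulVec (X s ω) (X s ω))).det + 2 * Real.log (1 / δ)) <
        (∑ s ∈ Finset.range t, ε s ω • X s ω) ⬝ᵥ (c • (1 : Matrix ι ι ℝ) +
          ∑ s ∈ Finset.range t, vecMulVec (X s ω) (X s ω))⁻¹ *ᵥ
          (∑ s ∈ Finset.range t, ε s ω • X s ω)} ≤ ENNReal.ofReal δ := by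
  set S : ℕ → Ω → ι → ℝ := fun t ω => ∑ s ∈ Finset.range t, ε s ω • X s ω with hS
  set G : ℕ → Ω → Matrix ι ι ℝ := fun t ω => c • (1 : Matrix ι ι ℝ) +
    ∑ s ∈ Finset.range t, vecMulVec (X s ω) (X s ω) with hG
  have hGpd : ∀ t ω, (G t ω).PosDef := fun t ω => (posDef_smul_one hc).add_posSemidef
    (posSemidef_sum _ fun s _ => posSemidef_vecMulVec _)
  -- For fixed x the process exp q is a supermartingale. As G contains c·I, integrating over x
  -- against Lebesgue measure is an unnormalised Gaussian mixture.
  set q : (ι → ℝ) → ℕ → Ω → ℝ := fun x t ω => x ⬝ᵥ S t ω - ρ ^ 2 * (x ⬝ᵥ G t ω *ᵥ x) / 2 with hq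
  have hqs : ∀ x t ω, q x (t + 1) ω = q x t ω +
      ((x ⬝ᵥ X t ω) * ε t ω - ρ ^ 2 * (x ⬝ᵥ X t ω) ^ 2 / 2) := by
    intro x t ω
    have e1 : S (t + 1) ω = S t ω + ε t ω • X t ω := Finset.sum_range_succ _ _
    have e2 : G (t + 1) ω = G t ω + vecMulVec (X t ω) (X t ω) := by
      simp only [hG, Finset.sum_range_succ, add_assoc]
    have e3 : x ⬝ᵥ vecMulVec (X t ω) (X t ω) *ᵥ x = (x ⬝ᵥ X t ω) ^ 2 := by
      rw [vecMulVec_mulVec, dotProduct_smul, dotProduct_comm (X t ω) x]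
      simp [sq]
    simp only [hq, e1, e2, dotProduct_add, add_mulVec, e3, dotProduct_smul, smul_eq_mul]
    ring
  -- This expansion in coordinates shows that q is jointly measurable in x and ω with respect to ℱ
  -- t.
  have hq0 : ∀ x t ω, q x t ω = ∑ i, x i * (∑ s ∈ Finset.range t, ε s ω * X s ω i) -
      ρ ^ 2 * (c * ∑ i, x i * x i + ∑ s ∈ Finset.range t, (∑ i, x i * X s ω i) ^ 2) / 2 := by
    intro x t ω
    induction t with
    | zero =>
      simp only [hq, hS, hG, Finset.range_zero, Finset.sum_empty, add_zero, quadForm_smul_one,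
        dotProduct_zero, mul_zero, Finset.sum_const_zero]
      rfl
    | succ t ih =>
      rw [hqs, ih]
      simp only [Finset.sum_range_succ, mul_add, Finset.sum_add_distrib, dotProduct]
      rw [Finset.sum_mul]
      have : ∑ i, x i * X t ω i * ε t ω = ∑ i, x i * (ε t ω * X t ω i) :=
        Finset.sum_congr rfl fun i _ => by ring
      rw [this]
      ring
  have hqm : ∀ t ≤ T, Measurable[(inferInstance : MeasurableSpace (ι → ℝ)).prod (ℱ t)]
      fun z : (ι → ℝ) × Ω => q z.1 t z.2 := by
    intro t ht
    simp only [hq0]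
    have hXm : ∀ s ∈ Finset.range t, ∀ i, Measurable[ℱ t] fun ω => X s ω i := fun s hs i =>
      (measurable_pi_apply i).comp ((hX s (by have := Finset.mem_range.1 hs; omega)).mono
        (ℱ.mono (Finset.mem_range.1 hs).le) le_rfl)
    have hεm : ∀ s ∈ Finset.range t, Measurable[ℱ t] (ε s) := fun s hs =>
      (hε s (by have := Finset.mem_range.1 hs; omega)).mono
        (ℱ.mono (Finset.mem_range.1 hs)) le_rfl
    let _ := ℱ t
    refine Measurable.sub ?_ (Measurable.div_const (Measurable.const_mul (Measurable.add ?_ ?_) _) _)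
    · refine Finset.measurable_sum _ fun i _ => Measurable.mul (by fun_prop) ?_
      exact Finset.measurable_sum _ fun s hs =>
        ((hεm s hs).comp measurable_snd).mul ((hXm s hs i).comp measurable_snd)
    · fun_prop
    · refine Finset.measurable_sum _ fun s hs => Measurable.pow_const ?_ _
      exact Finset.measurable_sum _ fun i _ => Measurable.mul (by fun_prop)
        ((hXm s hs i).comp measurable_snd)
  set M : ℕ → Ω → ℝ≥0∞ := fun t ω => ∫⁻ x, ENNReal.ofReal (Real.exp (q x t ω)) with hM
  have hMeq : ∀ t ω, M t ω = ENNReal.ofReal (Real.sqrt ((2 * Real.pi) ^ Fintype.card ι /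
      ((ρ ^ 2) • G t ω).det) * Real.exp (S t ω ⬝ᵥ (G t ω)⁻¹ *ᵥ S t ω / (2 * ρ ^ 2))) := by
    intro t ω
    have hpd : ((ρ ^ 2) • G t ω).PosDef := (hGpd t ω).smul (by positivity)
    have h := lintegral_exp_linear_sub_quadForm hpd (S t ω)
    have hinv : ((ρ ^ 2) • G t ω)⁻¹ = (ρ ^ 2)⁻¹ • (G t ω)⁻¹ := by
      have hu : IsUnit (G t ω).det := (Matrix.isUnit_iff_isUnit_det _).1 (hGpd t ω).isUnit
      apply Matrix.inv_eq_left_inv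
      rw [smul_mul_smul_comm, inv_mul_cancel₀ (by positivity), one_smul, nonsing_inv_mul _ hu]
    rw [hinv] at h
    simp only [smul_mulVec, dotProduct_smul, smul_eq_mul] at h
    refine Eq.trans ?_ (h.trans ?_)
    · rfl
    · congr 3
      field_simp
  have hMm : ∀ t ≤ T, Measurable[ℱ t] (M t) := by
    intro t ht
    have h1 : Measurable[(inferInstance : MeasurableSpace (ι → ℝ)).prod (ℱ t)]
        fun z : (ι → ℝ) × Ω => ENNReal.ofReal (Real.exp (q z.1 t z.2)) :=
      ENNReal.measurable_ofReal.comp (Real.measurable_exp.comp (hqm t ht))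
    exact @Measurable.lintegral_prod_left' (ι → ℝ) Ω _ (ℱ t) volume _ _ h1
  have hqm' : ∀ t ≤ T, Measurable fun z : (ι → ℝ) × Ω => q z.1 t z.2 := fun t ht =>
    (hqm t ht).mono (sup_le_sup le_rfl (MeasurableSpace.comap_mono (ℱ.le t))) le_rfl
  have hsuper : ∀ t < T, ∀ A, MeasurableSet[ℱ t] A →
      ∫⁻ ω in A, M (t + 1) ω ∂μ ≤ ∫⁻ ω in A, M t ω ∂μ := by
    intro t ht A hA
    have hswap : ∀ u ≤ T, ∫⁻ ω in A, M u ω ∂μ =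
        ∫⁻ x, ∫⁻ ω in A, ENNReal.ofReal (Real.exp (q x u ω)) ∂μ := fun u hu =>
      lintegral_lintegral_swap (ENNReal.measurable_ofReal.comp (Real.measurable_exp.comp
        ((hqm' u hu).comp measurable_swap))).aemeasurable
    rw [hswap _ ht, hswap _ ht.le]
    refine lintegral_mono fun x => ?_
    have hqx : Measurable[ℱ t] fun ω => q x t ω := by
      let _ := ℱ t
      exact (hqm t ht.le).comp measurable_prodMk_left
    have hW : Measurable[ℱ t] fun ω =>
        A.indicator (fun ω => ENNReal.ofReal (Real.exp (q x t ω))) ω :=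
      Measurable.indicator (ENNReal.measurable_ofReal.comp (Real.measurable_exp.comp hqx)) hA
    have hZ : Measurable[ℱ t] fun ω => x ⬝ᵥ X t ω := by
      let _ := ℱ t
      exact Finset.measurable_sum _ fun i _ =>
        ((measurable_pi_apply i).comp (hX t ht)).const_mul _
    have h := lintegral_mul_exp_le_of_measurable (ℱ.le t) ((hε t ht).mono (ℱ.le _) le_rfl)
      (hInt t ht) (hsub t ht) hW hZ
    rw [lintegral_indicator (ℱ.le t _ hA)] at h
    refine le_trans (le_of_eq ?_) h
    rw [← lintegral_indicator (ℱ.le t _ hA)]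
    refine lintegral_congr fun ω => ?_
    by_cases hω : ω ∈ A
    · rw [Set.indicator_of_mem hω, Set.indicator_of_mem hω,
        ← ENNReal.ofReal_mul (Real.exp_pos _).le, ← Real.exp_add, hqs]
    · rw [Set.indicator_of_notMem hω, Set.indicator_of_notMem hω, zero_mul]
  set c₀ : ℝ := Real.sqrt ((2 * Real.pi) ^ Fintype.card ι /
    ((ρ ^ 2) • (c • (1 : Matrix ι ι ℝ))).det) with hc₀
  have hdet0 : 0 < ((ρ ^ 2) • (c • (1 : Matrix ι ι ℝ))).det :=
    ((posDef_smul_one hc).smul (by positivity : 0 < ρ ^ 2)).det_pos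
  have hc₀pos : 0 < c₀ := Real.sqrt_pos.2 (by positivity)
  have hM0 : ∫⁻ ω, M 0 ω ∂μ = ENNReal.ofReal c₀ := by
    have : ∀ ω, M 0 ω = ENNReal.ofReal c₀ := by
      intro ω
      rw [hMeq]
      simp [hS, hG, hc₀]
    simp [this]
  -- M_0 is the constant c₀, so the level c₀/δ is reached with probability at most δ. In the closed
  -- form of M_t the determinant relative to t = 0 becomes the log-determinant penalty.
  have hville := mul_measure_exists_le hMm hsuper (ENNReal.ofReal (c₀ / δ))
  rw [hM0] at hville
  have hsubset : {ω | ∃ t ≤ T, ρ ^ 2 * (Real.log (c⁻¹ • G t ω).det + 2 * Real.log (1 / δ)) <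
      S t ω ⬝ᵥ (G t ω)⁻¹ *ᵥ S t ω} ⊆ {ω | ∃ t ≤ T, ENNReal.ofReal (c₀ / δ) ≤ M t ω} := by
    rintro ω ⟨t, ht, h⟩
    refine ⟨t, ht, ?_⟩
    rw [hMeq]
    refine ENNReal.ofReal_le_ofReal ?_
    have hdG : 0 < (c⁻¹ • G t ω).det := ((hGpd t ω).smul (inv_pos.2 hc)).det_pos
    have e1 : ((ρ ^ 2) • G t ω).det =
        ((ρ ^ 2) • (c • (1 : Matrix ι ι ℝ))).det * (c⁻¹ • G t ω).det := by
      rw [← det_mul, smul_mul_assoc, smul_mul_assoc, one_mul, smul_smul c, mul_inv_cancel₀ hc.ne',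
        one_smul]
    have e2 : Real.sqrt ((2 * Real.pi) ^ Fintype.card ι / ((ρ ^ 2) • G t ω).det) =
        c₀ * Real.exp (-(Real.log (c⁻¹ • G t ω).det / 2)) := by
      rw [e1, ← div_div, Real.sqrt_div' _ hdG.le, ← hc₀, Real.exp_neg, Real.exp_half,
        Real.exp_log hdG, div_eq_mul_inv]
    rw [e2, mul_assoc, ← Real.exp_add, div_eq_mul_inv]
    refine mul_le_mul_of_nonneg_left ?_ hc₀pos.le
    have e3 : δ⁻¹ = Real.exp (Real.log (1 / δ)) := by
      rw [Real.exp_log (by positivity), one_div]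
    rw [e3]
    refine Real.exp_le_exp.2 ?_
    have e4 : (Real.log (c⁻¹ • G t ω).det + 2 * Real.log (1 / δ)) / 2 ≤
        S t ω ⬝ᵥ (G t ω)⁻¹ *ᵥ S t ω / (2 * ρ ^ 2) := by
      rw [div_le_div_iff₀ two_pos (by positivity)]
      nlinarith
    linarith
  refine (measure_mono hsubset).trans ?_
  have hpos : ENNReal.ofReal (c₀ / δ) ≠ 0 := by
    simp only [ne_eq, ENNReal.ofReal_eq_zero, not_le]
    positivity
  rw [mul_comm, ← ENNReal.le_div_iff_mul_le (Or.inl hpos) (Or.inl ENNReal.ofReal_ne_top)] at hville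
  refine hville.trans (le_of_eq ?_)
  rw [← ENNReal.ofReal_div_of_pos (by positivity)]
  congr 1
  field_simp

end SelfNormalised

end PrivateGP
end

noncomputable section
open MeasureTheory ProbabilityTheory
namespace PrivateGP

/-! ### Concentration of the privacy noise -/

open Matrix
open scoped ENNReal Pointwise

section NoiseConcentration

/-- Exponential moments of sums of independent copies adapted to a filtration. -/
lemma lintegral_exp_sum_le {Ω E : Type*} [mΩ : MeasurableSpace Ω] [mE : MeasurableSpace E]
    {μ : Measure Ω} [IsProbabilityMeasure μ] {ℱ : Filtration ℕ mΩ} {Y : ℕ → Ω → E} {T : ℕ}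
    {κ : Measure E} (hY : ∀ t < T, Measurable[ℱ (t + 1)] (Y t))
    (hlaw : ∀ t < T, μ.map (Y t) = κ)
    (hind : ∀ t < T, Indep (MeasurableSpace.comap (Y t) mE) (ℱ t) μ)
    {g : E → ℝ} (hg : Measurable g) {C : ℝ≥0∞}
    (hC : ∫⁻ y, ENNReal.ofReal (Real.exp (g y)) ∂κ ≤ C) :
    ∀ t ≤ T, ∫⁻ ω, ENNReal.ofReal (Real.exp (∑ s ∈ Finset.range t, g (Y s ω))) ∂μ ≤ C ^ t := by
  intro t
  induction t with
  | zero => simp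
  | succ t ih =>
    intro ht
    have hYm : Measurable (Y t) := (hY t ht).mono (ℱ.le _) le_rfl
    have hF : Measurable[ℱ t] fun ω =>
        ENNReal.ofReal (Real.exp (∑ s ∈ Finset.range t, g (Y s ω))) := by
      refine ENNReal.measurable_ofReal.comp (Real.measurable_exp.comp ?_)
      refine Finset.measurable_sum _ fun s hs => hg.comp ?_
      have := Finset.mem_range.1 hs
      exact (hY s (by omega)).mono (ℱ.mono this) le_rfl
    have hG : Measurable[MeasurableSpace.comap (Y t) mE] fun ω =>
        ENNReal.ofReal (Real.exp (g (Y t ω))) :=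
      (ENNReal.measurable_ofReal.comp (Real.measurable_exp.comp hg)).comp (comap_measurable _)
    have h := lintegral_mul_eq_lintegral_mul_lintegral_of_independent_measurableSpace
      (ℱ.le t) hYm.comap_le (hind t ht).symm hF hG
    have e : ∫⁻ ω, ENNReal.ofReal (Real.exp (g (Y t ω))) ∂μ =
        ∫⁻ y, ENNReal.ofReal (Real.exp (g y)) ∂κ := by
      rw [← hlaw t ht, lintegral_map (by fun_prop) hYm]
    calc _ = ∫⁻ ω, ENNReal.ofReal (Real.exp (∑ s ∈ Finset.range t, g (Y s ω))) *
          ENNReal.ofReal (Real.exp (g (Y t ω))) ∂μ := by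
          refine lintegral_congr fun ω => ?_
          rw [Finset.sum_range_succ, Real.exp_add, ENNReal.ofReal_mul (Real.exp_pos _).le]
      _ = _ := h
      _ ≤ C ^ t * C := by
          rw [e]
          exact mul_le_mul' (ih (by omega)) hC
      _ = C ^ (t + 1) := (pow_succ _ _).symm

variable {Ω : Type*} [mΩ : MeasurableSpace Ω] {μ : Measure Ω} [IsProbabilityMeasure μ]
  {ι : Type*} [Fintype ι] [DecidableEq ι]

/-- Exponential moment of the squared norm of a sub-Gaussian vector. -/
lemma lintegral_exp_sq_le {S : Ω → ι → ℝ} (hS : Measurable S) {v a : ℝ} (ha : 0 < a)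
    (hav : a * v < 1)
    (h : ∀ c, ∫⁻ ω, ENNReal.ofReal (Real.exp (c ⬝ᵥ S ω)) ∂μ ≤
      ENNReal.ofReal (Real.exp (v * (c ⬝ᵥ c) / 2))) :
    ∫⁻ ω, ENNReal.ofReal (Real.exp (a * (S ω ⬝ᵥ S ω) / 2)) ∂μ ≤
      ENNReal.ofReal (Real.sqrt (((1 - a * v) ^ Fintype.card ι)⁻¹)) := by
  have hb : 0 < a⁻¹ - v := by
    have : a * (a⁻¹ - v) = 1 - a * v := by
      field_simp
    have h2 : 0 < a * (a⁻¹ - v) := by linarith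
    exact pos_of_mul_pos_right h2 ha.le
  -- The square is linearised: exp(a|s|²/2) is, up to a constant, a Gaussian integral of exp(c·s),
  -- and after exchanging the integrals the bound on linear exponential moments applies.
  have h1 : ∀ s : ι → ℝ, ∫⁻ c, ENNReal.ofReal (Real.exp (c ⬝ᵥ s - a⁻¹ * (c ⬝ᵥ c) / 2)) =
      ENNReal.ofReal (Real.sqrt ((2 * Real.pi) ^ Fintype.card ι * a ^ Fintype.card ι)) *
        ENNReal.ofReal (Real.exp (a * (s ⬝ᵥ s) / 2)) := by
    intro s
    have := lintegral_exp_linear_sub_quadForm (posDef_smul_one (ι := ι) (inv_pos.2 ha)) s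
    simp only [quadForm_smul_one, inv_smul_one (inv_pos.2 ha).ne', inv_inv] at this
    rw [this, ← ENNReal.ofReal_mul (Real.sqrt_nonneg _)]
    congr 3
    rw [det_smul, det_one, mul_one, inv_pow, div_inv_eq_mul]
  have h2 : ∫⁻ c : ι → ℝ, ENNReal.ofReal (Real.exp (-((a⁻¹ - v) * (c ⬝ᵥ c) / 2))) =
      ENNReal.ofReal (Real.sqrt ((2 * Real.pi) ^ Fintype.card ι / (a⁻¹ - v) ^ Fintype.card ι)) := by
    have := lintegral_exp_linear_sub_quadForm (posDef_smul_one (ι := ι) hb) 0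
    simpa [quadForm_smul_one, det_smul] using this
  have hm : Measurable fun z : Ω × (ι → ℝ) =>
      ENNReal.ofReal (Real.exp (z.2 ⬝ᵥ S z.1 - a⁻¹ * (z.2 ⬝ᵥ z.2) / 2)) := by
    simp only [dotProduct]
    fun_prop
  have h3 : ENNReal.ofReal (Real.sqrt ((2 * Real.pi) ^ Fintype.card ι * a ^ Fintype.card ι)) *
      ∫⁻ ω, ENNReal.ofReal (Real.exp (a * (S ω ⬝ᵥ S ω) / 2)) ∂μ ≤
      ENNReal.ofReal (Real.sqrt ((2 * Real.pi) ^ Fintype.card ι /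
        (a⁻¹ - v) ^ Fintype.card ι)) := by
    rw [← lintegral_const_mul' _ _ ENNReal.ofReal_ne_top]
    simp only [← h1]
    rw [lintegral_lintegral_swap hm.aemeasurable, ← h2]
    refine lintegral_mono fun c => ?_
    have e : ∀ ω, ENNReal.ofReal (Real.exp (c ⬝ᵥ S ω - a⁻¹ * (c ⬝ᵥ c) / 2)) =
        ENNReal.ofReal (Real.exp (c ⬝ᵥ S ω)) *
          ENNReal.ofReal (Real.exp (-(a⁻¹ * (c ⬝ᵥ c) / 2))) := fun ω => by
      rw [← ENNReal.ofReal_mul (Real.exp_pos _).le, ← Real.exp_add, sub_eq_add_neg]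
    simp only [e]
    rw [lintegral_mul_const' _ _ ENNReal.ofReal_ne_top]
    refine (mul_le_mul_left (h c) _).trans (le_of_eq ?_)
    rw [← ENNReal.ofReal_mul (Real.exp_pos _).le, ← Real.exp_add]
    congr 2
    ring
  have hpos : 0 < Real.sqrt ((2 * Real.pi) ^ Fintype.card ι * a ^ Fintype.card ι) :=
    Real.sqrt_pos.2 (by positivity)
  rw [mul_comm, ← ENNReal.le_div_iff_mul_le (Or.inl (by simpa using hpos))
    (Or.inl ENNReal.ofReal_ne_top), ← ENNReal.ofReal_div_of_pos hpos,
    ← Real.sqrt_div (by positivity)] at h3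
  refine h3.trans (le_of_eq ?_)
  congr 2
  have e : 1 - a * v = a * (a⁻¹ - v) := by field_simp
  rw [e, mul_pow]
  generalize a⁻¹ - v = b at hb
  field_simp
  ring

/-- Tail bound for the norm of a sub-Gaussian vector. -/
lemma measure_le_dotProduct_self_le [Nonempty ι] {S : Ω → ι → ℝ} (hS : Measurable S) {v s : ℝ}
    (hv : 0 < v) (hs : 0 < s)
    (h : ∀ c, ∫⁻ ω, ENNReal.ofReal (Real.exp (c ⬝ᵥ S ω)) ∂μ ≤
      ENNReal.ofReal (Real.exp (v * (c ⬝ᵥ c) / 2))) :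
    μ {ω | v * (Real.sqrt (Fintype.card ι) + s) ^ 2 ≤ S ω ⬝ᵥ S ω} ≤
      ENNReal.ofReal (Real.exp (-(s ^ 2 / 2))) := by
  set n := Fintype.card ι with hn
  have hn0 : (0 : ℝ) < n := by exact_mod_cast Fintype.card_pos
  set w := Real.sqrt n with hw
  have hw0 : 0 < w := Real.sqrt_pos.2 hn0
  have hww : w ^ 2 = n := Real.sq_sqrt hn0.le
  set r := w + s with hr
  have hr0 : 0 < r := by positivity
  -- The optimal Chernoff parameter at level v r², given by 1 − a v = w²/r². With 1 + s/w ≤ exp(s/w)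
  -- the resulting exponent is sw − (r² − w²)/2 = −s²/2.
  set a := (1 - w ^ 2 / r ^ 2) / v with ha
  have hlt : w ^ 2 / r ^ 2 < 1 := by
    rw [div_lt_one (by positivity)]
    nlinarith
  have ha0 : 0 < a := div_pos (by linarith) hv
  have hav : a * v = 1 - w ^ 2 / r ^ 2 := div_mul_cancel₀ _ hv.ne'
  have hwr : 0 < w ^ 2 / r ^ 2 := by positivity
  have h1 := lintegral_exp_sq_le hS ha0 (by rw [hav]; linarith) h
  have hmeas : Measurable fun ω => ENNReal.ofReal (Real.exp (a * (S ω ⬝ᵥ S ω) / 2)) := by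
    simp only [dotProduct]
    fun_prop
  have h2 := (mul_meas_ge_le_lintegral (μ := μ) hmeas
    (ENNReal.ofReal (Real.exp (a * (v * r ^ 2) / 2)))).trans h1
  have hsub : {ω | v * r ^ 2 ≤ S ω ⬝ᵥ S ω} ⊆ {ω | ENNReal.ofReal (Real.exp (a * (v * r ^ 2) / 2)) ≤
      ENNReal.ofReal (Real.exp (a * (S ω ⬝ᵥ S ω) / 2))} := by
    intro ω hω
    refine ENNReal.ofReal_le_ofReal (Real.exp_le_exp.2 ?_)
    have := mul_le_mul_of_nonneg_left (a := a) hω ha0.le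
    linarith
  refine (measure_mono hsub).trans ?_
  rw [mul_comm, ← ENNReal.le_div_iff_mul_le (Or.inl (by simp [Real.exp_pos]))
    (Or.inl ENNReal.ofReal_ne_top), ← ENNReal.ofReal_div_of_pos (Real.exp_pos _)] at h2
  refine h2.trans (ENNReal.ofReal_le_ofReal ?_)
  have e1 : Real.sqrt (((1 - a * v) ^ n)⁻¹) = (r / w) ^ n := by
    rw [hav, show (1 - (1 - w ^ 2 / r ^ 2)) = ((r / w) ^ 2)⁻¹ by rw [div_pow, inv_div]; ring,
      inv_pow, inv_inv, ← pow_mul, mul_comm 2 n, pow_mul, Real.sqrt_sq (by positivity)]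
  have e2 : (r / w) ^ n ≤ Real.exp (s * w) := by
    have h3 : r / w ≤ Real.exp (s / w) := by
      have := Real.add_one_le_exp (s / w)
      rwa [show r / w = s / w + 1 by rw [hr]; field_simp; ring]
    refine (pow_le_pow_left₀ (by positivity) h3 n).trans (le_of_eq ?_)
    rw [← Real.exp_nat_mul, ← hww]
    congr 1
    field_simp
  rw [e1, div_le_iff₀ (Real.exp_pos _), ← Real.exp_add]
  refine e2.trans (Real.exp_le_exp.2 (le_of_eq ?_))
  have : a * (v * r ^ 2) = r ^ 2 - w ^ 2 := by
    rw [← mul_assoc, hav]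
    field_simp
  rw [this, hr]
  ring

/-- Near an extremal eigenvector the Rayleigh quotient of a symmetric matrix stays large. -/
lemma le_quadForm_of_near_extremal {A : Matrix ι ι ℝ} (hA : A.IsSymm) {r : ℝ} (hr : 0 ≤ r)
    (hAr : ∀ y, |y ⬝ᵥ A *ᵥ y| ≤ r * (y ⬝ᵥ y)) {u : ι → ℝ} (hu : u ⬝ᵥ u = 1)
    (hAu : u ⬝ᵥ A *ᵥ u = r) {x : ι → ℝ} (hx : (x - u) ⬝ᵥ (x - u) ≤ 1 / 9) :
    7 / 9 * r * (x ⬝ᵥ x) ≤ x ⬝ᵥ A *ᵥ x := by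
  have hpsd : (r • (1 : Matrix ι ι ℝ) - A).PosSemidef := by
    refine posSemidef_of_forall ?_ fun y => ?_
    · exact ((isSymm_one).smul r).sub hA
    · rw [sub_mulVec, dotProduct_sub, quadForm_smul_one]
      linarith [(abs_le.1 (hAr y)).2]
  -- As u annihilates the nonnegative form r·I − A, it is an eigenvector, and x splits along u
  -- without cross terms. Being within 1/3 of u gives c² ≥ (8/9)|x|², whence r(2c² − |x|²) ≥ (7/9)
  -- r|x|².
  have hz : (r • (1 : Matrix ι ι ℝ) - A) *ᵥ u = 0 := by
    refine (hpsd.dotProduct_mulVec_zero_iff u).1 ?_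
    rw [star_trivial, sub_mulVec, dotProduct_sub, quadForm_smul_one, hu, hAu]
    ring
  have hAu' : A *ᵥ u = r • u := by
    rw [sub_mulVec, smul_mulVec, one_mulVec, sub_eq_zero] at hz
    exact hz.symm
  set c := u ⬝ᵥ x with hc
  have hxu : x ⬝ᵥ u = c := dotProduct_comm _ _
  have hw := (abs_le.1 (hAr (x - c • u))).1
  have e1 : (x - c • u) ⬝ᵥ A *ᵥ (x - c • u) = x ⬝ᵥ A *ᵥ x - r * c ^ 2 := by
    have h1 : u ⬝ᵥ A *ᵥ x = r * c := by
      rw [hA.dotProduct_mulVec_comm, hAu', dotProduct_smul, hxu, smul_eq_mul]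
    simp only [mulVec_sub, mulVec_smul, sub_dotProduct, dotProduct_sub, smul_dotProduct,
      dotProduct_smul, hAu', h1, hxu, hu, smul_eq_mul]
    ring
  have e2 : (x - c • u) ⬝ᵥ (x - c • u) = x ⬝ᵥ x - c ^ 2 := by
    simp only [sub_dotProduct, dotProduct_sub, smul_dotProduct, dotProduct_smul, hxu, hu,
      smul_eq_mul, ← hc]
    ring
  have e3 : (x - u) ⬝ᵥ (x - u) = x ⬝ᵥ x - 2 * c + 1 := by
    simp only [sub_dotProduct, dotProduct_sub, hxu, hu, ← hc]
    ring
  rw [e1, e2] at hw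
  rw [e3] at hx
  have hxx : 0 ≤ x ⬝ᵥ x := by
    simpa using dotProduct_star_self_nonneg x
  have h4 : 8 / 9 * (x ⬝ᵥ x) ≤ c ^ 2 := by
    nlinarith [sq_nonneg (x ⬝ᵥ x - 8 / 9)]
  nlinarith

/-- A quadratic form attains its largest absolute value on the unit sphere. -/
lemma exists_extremal [Nonempty ι] (A : Matrix ι ι ℝ) :
    ∃ u : ι → ℝ, u ⬝ᵥ u = 1 ∧ ∀ y, |y ⬝ᵥ A *ᵥ y| ≤ |u ⬝ᵥ A *ᵥ u| * (y ⬝ᵥ y) := by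
  have hcont : Continuous fun x : ι → ℝ => x ⬝ᵥ x := by fun_prop
  have hcomp : IsCompact {x : ι → ℝ | x ⬝ᵥ x = 1} := by
    refine Metric.isCompact_of_isClosed_isBounded (isClosed_eq hcont continuous_const) ?_
    refine (Metric.isBounded_closedBall (x := (0 : ι → ℝ)) (r := 1)).subset fun x hx => ?_
    rw [mem_closedBall_zero_iff, pi_norm_le_iff_of_nonneg zero_le_one]
    intro i
    rw [Real.norm_eq_abs, ← sq_le_one_iff_abs_le_one]
    have : x i * x i ≤ x ⬝ᵥ x :=
      Finset.single_le_sum (f := fun i => x i * x i) (fun i _ => mul_self_nonneg _)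
        (Finset.mem_univ i)
    rw [show x ⬝ᵥ x = 1 from hx] at this
    nlinarith
  have hne : {x : ι → ℝ | x ⬝ᵥ x = 1}.Nonempty :=
    ⟨Pi.single (Classical.arbitrary ι) 1, by simp⟩
  obtain ⟨u, hu, hmax⟩ := hcomp.exists_isMaxOn hne
    (f := fun x => |x ⬝ᵥ A *ᵥ x|) (by fun_prop)
  refine ⟨u, hu, fun y => ?_⟩
  rcases eq_or_ne y 0 with rfl | hy
  · simp
  have hyy : 0 < y ⬝ᵥ y := by
    have := dotProduct_star_self_pos_iff.2 hy
    simpa using this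
  set t := Real.sqrt (y ⬝ᵥ y) with ht
  have ht0 : 0 < t := Real.sqrt_pos.2 hyy
  have htt : t ^ 2 = y ⬝ᵥ y := Real.sq_sqrt hyy.le
  have h1 := hmax (a := t⁻¹ • y) (by
    simp only [Set.mem_ofPred_eq, smul_dotProduct, dotProduct_smul, smul_eq_mul, ← htt]
    field_simp)
  simp only [Set.mem_ofPred_eq, mulVec_smul, smul_dotProduct, dotProduct_smul, smul_eq_mul, abs_mul,
    abs_of_pos (inv_pos.2 ht0)] at h1
  rw [← htt]
  calc |y ⬝ᵥ A *ᵥ y| = t ^ 2 * (t⁻¹ * (t⁻¹ * |y ⬝ᵥ A *ᵥ y|)) := by field_simp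
    _ ≤ t ^ 2 * |u ⬝ᵥ A *ᵥ u| := by gcongr
    _ = _ := mul_comm _ _

/-- Tail bound for the spectral norm of a random symmetric matrix with sub-Gaussian quadratic
form, by a volumetric argument. -/
lemma measure_exists_quadForm_ge_le [Nonempty ι] {A : Ω → Matrix ι ι ℝ}
    (hAm : ∀ i j, Measurable fun ω => A ω i j) (hsymm : ∀ ω, (A ω).IsSymm) {v l : ℝ}
    (hv : 0 < v) (hl : 0 < l)
    (h : ∀ x : ι → ℝ, x ⬝ᵥ x = 1 → ∀ a : ℝ,
      ∫⁻ ω, ENNReal.ofReal (Real.exp (a * (x ⬝ᵥ A ω *ᵥ x))) ∂μ ≤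
        ENNReal.ofReal (Real.exp (v * a ^ 2))) :
    μ {ω | ∃ x : ι → ℝ, l * (x ⬝ᵥ x) < |x ⬝ᵥ A ω *ᵥ x|} ≤
      ENNReal.ofReal (2 * 4 ^ Fintype.card ι * Real.exp (-((7 / 9 * l) ^ 2 / (4 * v)))) := by
  set b : (ι → ℝ) → Set (ι → ℝ) := fun u => {x | (x - u) ⬝ᵥ (x - u) ≤ 1 / 9} with hb
  set K : Set (ι → ℝ) := {x | x ⬝ᵥ x ≤ 16 / 9} with hK
  have hbm : ∀ u, MeasurableSet (b u) := fun u =>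
    (isClosed_le (by fun_prop) continuous_const).measurableSet
  have hKm : MeasurableSet K := (isClosed_le (by fun_prop) continuous_const).measurableSet
  have hvolb : ∀ u, volume (b u) = volume (b 0) := by
    intro u
    have : b u = (fun x => x + -u) ⁻¹' b 0 := by
      ext x
      simp [hb, sub_eq_add_neg]
    rw [this, measure_preimage_add_right]
  have hvolK : volume K = ENNReal.ofReal (4 ^ Fintype.card ι) * volume (b 0) := by
    have e : K = (4 : ℝ) • b 0 := by
      ext x
      rw [Set.mem_smul_set_iff_inv_smul_mem₀ (by norm_num)]
      simp only [hK, hb, Set.mem_ofPred_eq, sub_zero, smul_dotProduct, dotProduct_smul, smul_eq_mul]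
      constructor <;> intro h <;> linarith
    rw [e, Measure.addHaar_smul]
    congr 2
    simp
  have hb0 : volume (b 0) ≠ 0 := by
    have ho : IsOpen {x : ι → ℝ | x ⬝ᵥ x < 1 / 9} := isOpen_lt (by fun_prop) continuous_const
    have := ho.measure_pos (volume : Measure (ι → ℝ)) ⟨0, by simp⟩
    refine (this.trans_le (measure_mono fun x hx => ?_)).ne'
    have hx' : x ⬝ᵥ x < 1 / 9 := hx
    simpa [hb] using hx'.le
  have hbt : volume (b 0) ≠ ∞ := by
    refine ((measure_mono (t := Metric.closedBall (0 : ι → ℝ) 1) fun x hx => ?_).trans_lt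
      measure_closedBall_lt_top).ne
    rw [mem_closedBall_zero_iff, pi_norm_le_iff_of_nonneg zero_le_one]
    intro i
    rw [Real.norm_eq_abs, ← sq_le_one_iff_abs_le_one]
    have h1 : x i * x i ≤ x ⬝ᵥ x :=
      Finset.single_le_sum (f := fun i => x i * x i) (fun i _ => mul_self_nonneg _)
        (Finset.mem_univ i)
    have h2 : x ⬝ᵥ x ≤ 1 / 9 := by simpa [hb] using hx
    nlinarith
  -- Integrating over the ball K of radius 4/3 replaces a union bound over a net. If the spectral
  -- norm exceeds l, the ball of radius 1/3 about an extremal unit vector lies in K and all its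
  -- points have Rayleigh quotient at least (7/9)l in absolute value, with one sign. F(a) and F(−a)
  -- cover the two signs, and the ratio of volumes is 4ⁿ.
  set F : ℝ → Ω → ℝ≥0∞ := fun a ω =>
    ∫⁻ x in K, ENNReal.ofReal (Real.exp (a * (x ⬝ᵥ A ω *ᵥ x / (x ⬝ᵥ x)))) with hF
  have hjm : ∀ a : ℝ, Measurable fun z : Ω × (ι → ℝ) =>
      ENNReal.ofReal (Real.exp (a * (z.2 ⬝ᵥ A z.1 *ᵥ z.2 / (z.2 ⬝ᵥ z.2)))) := by
    intro a
    have : ∀ i j, Measurable fun z : Ω × (ι → ℝ) => A z.1 i j := fun i j =>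
      (hAm i j).comp measurable_fst
    simp only [dotProduct, mulVec]
    fun_prop
  have hFint : ∀ a, ∫⁻ ω, F a ω ∂μ ≤ volume K * ENNReal.ofReal (Real.exp (v * a ^ 2)) := by
    intro a
    rw [lintegral_lintegral_swap (hjm a).aemeasurable, mul_comm, ← setLIntegral_const]
    refine lintegral_mono fun x => ?_
    rcases eq_or_ne x 0 with rfl | hx
    · simp only [zero_dotProduct, zero_div, mul_zero, Real.exp_zero, lintegral_const, measure_univ,
        mul_one]
      exact ENNReal.ofReal_le_ofReal (Real.one_le_exp (by positivity))
    have hxx : 0 < x ⬝ᵥ x := by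
      have := dotProduct_star_self_pos_iff.2 hx
      simpa using this
    set t := Real.sqrt (x ⬝ᵥ x) with ht
    have ht0 : 0 < t := Real.sqrt_pos.2 hxx
    have htt : t ^ 2 = x ⬝ᵥ x := Real.sq_sqrt hxx.le
    have h1 := h (t⁻¹ • x) (by
      simp only [smul_dotProduct, dotProduct_smul, smul_eq_mul, ← htt]
      field_simp) a
    refine le_trans (le_of_eq (lintegral_congr fun ω => ?_)) h1
    congr 3
    simp only [mulVec_smul, smul_dotProduct, dotProduct_smul, smul_eq_mul, ← htt]
    field_simp
  have hFm : ∀ a, Measurable (F a) := fun a => (hjm a).lintegral_prod_right'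
  -- The minimiser of v a² − (7/9) l a.
  set a := 7 / 18 * l / v with ha
  have ha0 : 0 < a := by positivity
  have hlow : ∀ ω, (∃ x : ι → ℝ, l * (x ⬝ᵥ x) < |x ⬝ᵥ A ω *ᵥ x|) →
      volume (b 0) * ENNReal.ofReal (Real.exp (a * (7 / 9 * l))) ≤ F a ω + F (-a) ω := by
    rintro ω ⟨x, hx⟩
    obtain ⟨u, hu, hmax⟩ := exists_extremal (A ω)
    set r := |u ⬝ᵥ A ω *ᵥ u| with hr
    have hlr : l ≤ r := by
      by_contra hcon
      have hxx : 0 ≤ x ⬝ᵥ x := by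
        simpa using dotProduct_star_self_nonneg x
      nlinarith [hmax x]
    have hbK : b u ⊆ K := by
      intro y hy
      have h1 := abs_dotProduct_mulVec_le (PosSemidef.one (n := ι) (R := ℝ)) (y - u) u
      simp only [one_mulVec, hu] at h1
      have h2 : (y - u) ⬝ᵥ (y - u) ≤ 1 / 9 := hy
      have h3 : Real.sqrt ((y - u) ⬝ᵥ (y - u)) ≤ 1 / 3 :=
        Real.sqrt_le_iff.2 ⟨by norm_num, by linarith⟩
      simp only [Real.sqrt_one, mul_one] at h1
      have h4 : y ⬝ᵥ y = (y - u) ⬝ᵥ (y - u) + 2 * ((y - u) ⬝ᵥ u) + u ⬝ᵥ u := by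
        simp only [sub_dotProduct, dotProduct_sub, dotProduct_comm u y]
        ring
      change y ⬝ᵥ y ≤ 16 / 9
      linarith [le_abs_self ((y - u) ⬝ᵥ u)]
    have hgen : ∀ (e : ℝ) (A' : Matrix ι ι ℝ), A'.IsSymm → (∀ y, y ⬝ᵥ A' *ᵥ y = e * (y ⬝ᵥ A ω *ᵥ y)) →
        (∀ y, |y ⬝ᵥ A' *ᵥ y| ≤ r * (y ⬝ᵥ y)) → u ⬝ᵥ A' *ᵥ u = r →
        volume (b 0) * ENNReal.ofReal (Real.exp (a * (7 / 9 * l))) ≤ F (a * e) ω := by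
      intro e A' hs he hm hr'
      rw [mul_comm, ← hvolb u, ← setLIntegral_const]
      refine le_trans ?_ (lintegral_mono_set hbK)
      refine setLIntegral_mono (by
        have := (hjm (a * e)).comp (measurable_prodMk_left (x := ω))
        exact this) fun y hy => ?_
      refine ENNReal.ofReal_le_ofReal (Real.exp_le_exp.2 ?_)
      have h1 := le_quadForm_of_near_extremal hs (hl.le.trans hlr) hm hu hr' hy
      rw [he] at h1
      have hyy : 0 < y ⬝ᵥ y := by
        have hy0 : y ≠ 0 := by
          rintro rfl
          have : (0 - u) ⬝ᵥ (0 - u) ≤ 1 / 9 := hy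
          simp only [zero_sub, neg_dotProduct, dotProduct_neg, neg_neg, hu] at this
          norm_num at this
        have := dotProduct_star_self_pos_iff.2 hy0
        simpa using this
      rw [mul_assoc]
      refine mul_le_mul_of_nonneg_left ?_ ha0.le
      rw [← mul_div_assoc, le_div_iff₀ hyy]
      nlinarith
    rcases le_total 0 (u ⬝ᵥ A ω *ᵥ u) with h0 | h0
    · have := hgen 1 (A ω) (hsymm ω) (fun y => (one_mul _).symm) hmax (abs_of_nonneg h0).symm
      rw [mul_one] at this
      exact this.trans le_self_add
    · have := hgen (-1) (-A ω) (hsymm ω).neg (fun y => by simp [neg_mulVec])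
        (fun y => by simpa [neg_mulVec] using hmax y)
        (by rw [neg_mulVec, dotProduct_neg]; exact (abs_of_nonpos h0).symm)
      rw [mul_neg_one] at this
      exact this.trans le_add_self
  have hmark := (mul_meas_ge_le_lintegral (μ := μ) ((hFm a).add (hFm (-a)))
    (volume (b 0) * ENNReal.ofReal (Real.exp (a * (7 / 9 * l)))))
  simp only [Pi.add_apply] at hmark
  rw [lintegral_add_left (hFm a)] at hmark
  replace hmark := (mul_le_mul_right (measure_mono hlow) _).trans hmark
  have hup := add_le_add (hFint a) (hFint (-a))
  rw [neg_sq, ← two_mul, hvolK] at hup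
  replace hmark := hmark.trans hup
  set Pr := μ {ω | ∃ x : ι → ℝ, l * (x ⬝ᵥ x) < |x ⬝ᵥ A ω *ᵥ x|} with hPr
  have h5 : volume (b 0) * (ENNReal.ofReal (Real.exp (a * (7 / 9 * l))) * Pr) ≤
      volume (b 0) * ENNReal.ofReal (2 * 4 ^ Fintype.card ι * Real.exp (v * a ^ 2)) := by
    rw [← mul_assoc]
    refine hmark.trans (le_of_eq ?_)
    rw [ENNReal.ofReal_mul (by positivity), ENNReal.ofReal_mul (by positivity), ENNReal.ofReal_ofNat]
    ring
  rw [ENNReal.mul_le_mul_iff_right hb0 hbt, mul_comm, ← ENNReal.le_div_iff_mul_le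
    (Or.inl (by simp [Real.exp_pos])) (Or.inl ENNReal.ofReal_ne_top),
    ← ENNReal.ofReal_div_of_pos (Real.exp_pos _)] at h5
  refine h5.trans (le_of_eq ?_)
  rw [mul_div_assoc, ← Real.exp_sub]
  congr 3
  rw [ha]
  field_simp
  ring

end NoiseConcentration

end PrivateGP
end

noncomputable section
open MeasureTheory ProbabilityTheory
namespace PrivateGP

/-! ### The good event of a run -/

open Matrix
open scoped ENNReal

section GoodEvent

/-- Coefficients of the quadratic form `x ↦ xᵀ N x` of a symmetric matrix given by its entries
indexed by unordered pairs. -/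
def symCoeff {ι : Type*} [Fintype ι] [DecidableEq ι] (x : ι → ℝ) (p : Sym2 ι) : ℝ :=
  ∑ z : ι × ι with s(z.1, z.2) = p, x z.1 * x z.2

lemma symCoeff_dotProduct {ι : Type*} [Fintype ι] [DecidableEq ι] (x : ι → ℝ) (N : Sym2 ι → ℝ) :
    symCoeff x ⬝ᵥ N = x ⬝ᵥ (Matrix.of fun i j => N s(i, j)) *ᵥ x := by
  have h1 : symCoeff x ⬝ᵥ N = ∑ z : ι × ι, x z.1 * x z.2 * N s(z.1, z.2) := by
    rw [← Finset.sum_fiberwise (s := Finset.univ) (g := fun z : ι × ι => s(z.1, z.2))]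
    refine Finset.sum_congr rfl fun p _ => ?_
    rw [symCoeff, Finset.sum_mul]
    refine Finset.sum_congr rfl fun z hz => ?_
    rw [(Finset.mem_filter.1 hz).2]
  rw [h1, Fintype.sum_prod_type]
  refine Finset.sum_congr rfl fun i _ => ?_
  simp only [mulVec, dotProduct, of_apply, Finset.mul_sum]
  exact Finset.sum_congr rfl fun j _ => by ring

/-- An unordered pair comes from at most two ordered ones, so Cauchy–Schwarz on each fibre costs a
factor 2. For unit x the variance of xᵀNx is thus at most 2σ_X². -/
lemma symCoeff_dotProduct_self_le {ι : Type*} [Fintype ι] [DecidableEq ι] (x : ι → ℝ) :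
    symCoeff x ⬝ᵥ symCoeff x ≤ 2 * (x ⬝ᵥ x) ^ 2 := by
  have hcard : ∀ p : Sym2 ι, (Finset.univ.filter fun z : ι × ι => s(z.1, z.2) = p).card ≤ 2 := by
    intro p
    induction p with
    | h i j =>
      refine (Finset.card_le_card (t := {(i, j), (j, i)}) fun z hz => ?_).trans Finset.card_le_two
      have := Sym2.eq_iff.1 (Finset.mem_filter.1 hz).2
      simp only [Finset.mem_insert, Finset.mem_singleton, Prod.ext_iff]
      exact this
  have h1 : ∀ p, symCoeff x p * symCoeff x p ≤
      2 * ∑ z : ι × ι with s(z.1, z.2) = p, (x z.1 * x z.2) ^ 2 := by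
    intro p
    rw [← sq]
    refine sq_sum_le_card_mul_sum_sq.trans ?_
    refine mul_le_mul_of_nonneg_right (by exact_mod_cast hcard p)
      (Finset.sum_nonneg fun _ _ => sq_nonneg _)
  refine (Finset.sum_le_sum fun p _ => h1 p).trans (le_of_eq ?_)
  rw [← Finset.mul_sum, Finset.sum_fiberwise, Fintype.sum_prod_type, sq (x ⬝ᵥ x)]
  simp only [dotProduct]
  rw [Finset.sum_mul_sum]
  congr 1
  exact Finset.sum_congr rfl fun i _ => Finset.sum_congr rfl fun j _ => by ring

variable {d : ℕ} (P : Params d)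

lemma Params.card_Idx : Fintype.card P.Idx = 2 * P.m := by
  rw [Fintype.card_prod, Fintype.card_fun, Fintype.card_coe, card_hermiteNodes, Fintype.card_bool,
    Fintype.card_fin, Params.m, mul_comm]

lemma Params.nonempty_Idx (hm : 0 < P.mbar) : Nonempty P.Idx := by
  rw [← Fintype.card_pos_iff, P.card_Idx, Params.m]
  positivity

lemma Params.lintegral_exp_vector (c : P.Idx → ℝ) :
    ∫⁻ z, ENNReal.ofReal (Real.exp (c ⬝ᵥ z.2)) ∂P.noiseLaw =
      ENNReal.ofReal (Real.exp (P.σu ^ 2 * (c ⬝ᵥ c) / 2)) := by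
  have hm : Measurable fun y : P.Idx → ℝ => ENNReal.ofReal (Real.exp (c ⬝ᵥ y)) := by
    simp only [dotProduct]
    fun_prop
  rw [Params.noiseLaw, lintegral_prod
    (fun z : (Sym2 P.Idx → ℝ) × (P.Idx → ℝ) => ENNReal.ofReal (Real.exp (c ⬝ᵥ z.2)))
    (hm.comp measurable_snd).aemeasurable]
  simp only [lintegral_exp_dotProduct_pi_gaussianReal, lintegral_const, measure_univ, mul_one]
  rw [Real.coe_toNNReal _ (sq_nonneg _)]

lemma Params.lintegral_exp_matrix_le {x : P.Idx → ℝ} (hx : x ⬝ᵥ x = 1) (a : ℝ) :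
    ∫⁻ z, ENNReal.ofReal (Real.exp (a * (symCoeff x ⬝ᵥ z.1))) ∂P.noiseLaw ≤
      ENNReal.ofReal (Real.exp (P.σX ^ 2 * a ^ 2)) := by
  have hm : Measurable fun y : Sym2 P.Idx → ℝ =>
      ENNReal.ofReal (Real.exp ((a • symCoeff x) ⬝ᵥ y)) := by
    simp only [dotProduct]
    fun_prop
  have e : ∀ y : Sym2 P.Idx → ℝ, a * (symCoeff x ⬝ᵥ y) = (a • symCoeff x) ⬝ᵥ y := fun y => by
    rw [smul_dotProduct, smul_eq_mul]
  simp only [e]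
  rw [Params.noiseLaw, lintegral_prod
    (fun z : (Sym2 P.Idx → ℝ) × (P.Idx → ℝ) => ENNReal.ofReal (Real.exp ((a • symCoeff x) ⬝ᵥ z.1)))
    (hm.comp measurable_fst).aemeasurable]
  simp only [lintegral_const, measure_univ, mul_one]
  rw [lintegral_exp_dotProduct_pi_gaussianReal, Real.coe_toNNReal _ (sq_nonneg _)]
  refine ENNReal.ofReal_le_ofReal (Real.exp_le_exp.2 ?_)
  have h := symCoeff_dotProduct_self_le x
  rw [hx] at h
  simp only [smul_dotProduct, dotProduct_smul, smul_eq_mul]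
  have h2 : P.σX ^ 2 * a ^ 2 * (symCoeff x ⬝ᵥ symCoeff x) ≤ P.σX ^ 2 * a ^ 2 * 2 :=
    mul_le_mul_of_nonneg_left (by linarith) (by positivity)
  linarith

/-- Numerical bound for the tail of the accumulated matrix noise. -/
lemma two_mul_four_pow_mul_exp_le {n T : ℕ} (hn : 1 ≤ n) {L ζ : ℝ} (hT : 0 < T) (hζ : 0 < ζ)
    (hζ1 : ζ < 1) (hL : L = Real.log (2 * T / ζ)) :
    2 * 4 ^ n * Real.exp (-(49 / 81 * (2 * Real.sqrt n + L) ^ 2)) ≤ ζ / (2 * T ^ 2) := by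
  have hT' : (1 : ℝ) ≤ T := by exact_mod_cast hT
  have hn' : (1 : ℝ) ≤ n := by exact_mod_cast hn
  have hL0 : 0 ≤ L := by
    rw [hL]
    refine Real.log_nonneg ?_
    rw [le_div_iff₀ hζ]
    linarith
  have h4 : (4 : ℝ) ^ n ≤ Real.exp (2 * n) := by
    have h2 : (4 : ℝ) ≤ Real.exp 2 := by
      have := Real.exp_one_gt_d9
      have e : Real.exp 2 = Real.exp 1 * Real.exp 1 := by
        rw [← Real.exp_add]
        norm_num
      rw [e]
      nlinarith
    calc (4 : ℝ) ^ n ≤ Real.exp 2 ^ n := pow_le_pow_left₀ (by norm_num) h2 n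
      _ = _ := by rw [← Real.exp_nat_mul, mul_comm]
  set w := Real.sqrt n with hw
  have hw1 : 1 ≤ w := Real.one_le_sqrt.2 hn'
  have hww : w ^ 2 = n := Real.sq_sqrt (by positivity)
  have hexp : Real.exp (-(2 * L)) = ζ ^ 2 / (2 * T) ^ 2 := by
    have : Real.exp L = 2 * T / ζ := by
      rw [hL, Real.exp_log (by positivity)]
    rw [two_mul L, Real.exp_neg, Real.exp_add, this]
    field_simp
  calc 2 * 4 ^ n * Real.exp (-(49 / 81 * (2 * w + L) ^ 2))
      ≤ 2 * Real.exp (2 * n) * Real.exp (-(49 / 81 * (2 * w + L) ^ 2)) := by gcongr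
    _ = 2 * Real.exp (2 * n - (49 / 81 * (2 * w + L) ^ 2)) := by
        rw [mul_assoc, ← Real.exp_add, sub_eq_add_neg]
    -- Since 4·49/81 > 2, the square of 2√n outweighs 2n, and the cross term 4√n·L outweighs 2L
    -- because √n ≥ 1.
    _ ≤ 2 * Real.exp (-(2 * L)) := by
        gcongr
        rw [← hww]
        nlinarith [mul_nonneg hL0 (sub_nonneg.2 hw1), sq_nonneg L]
    _ = ζ * (ζ / (2 * T ^ 2)) := by
        rw [hexp]
        field_simp
    _ ≤ ζ / (2 * T ^ 2) := by
        have : 0 ≤ ζ / (2 * (T : ℝ) ^ 2) := by positivity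
        nlinarith

/-- The matrix noise accumulated before round `t + 1`. -/
def Params.accMatrix {Ω : Type*} (N : ℕ → Ω → Sym2 P.Idx → ℝ) (t : ℕ) (ω : Ω) :
    Matrix P.Idx P.Idx ℝ :=
  Matrix.of fun i j => ∑ s ∈ Finset.range t, N s ω s(i, j)

/-- The vector noise accumulated before round `t + 1`. -/
def Params.accVector {Ω : Type*} (n : ℕ → Ω → P.Idx → ℝ) (t : ℕ) (ω : Ω) : P.Idx → ℝ :=
  ∑ s ∈ Finset.range t, n s ω

lemma Params.accMatrix_isSymm {Ω : Type*} (N : ℕ → Ω → Sym2 P.Idx → ℝ) (t : ℕ) (ω : Ω) :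
    (P.accMatrix N t ω).IsSymm := by
  ext i j
  simp only [transpose_apply, Params.accMatrix, of_apply]
  exact Finset.sum_congr rfl fun s _ => by rw [Sym2.eq_swap]

lemma Params.quadForm_accMatrix {Ω : Type*} (N : ℕ → Ω → Sym2 P.Idx → ℝ) (t : ℕ) (ω : Ω)
    (x : P.Idx → ℝ) :
    x ⬝ᵥ P.accMatrix N t ω *ᵥ x = ∑ s ∈ Finset.range t, symCoeff x ⬝ᵥ N s ω := by
  have e : P.accMatrix N t ω =
      Matrix.of fun i j => (∑ s ∈ Finset.range t, N s ω) s(i, j) := by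
    ext i j
    simp [Params.accMatrix, Finset.sum_apply]
  rw [e, ← symCoeff_dotProduct, dotProduct_sum]

/-- The accumulated privacy noise is well behaved in all rounds with high probability. -/
lemma Params.IsRun.measure_noise_le {Ω : Type*} [mΩ : MeasurableSpace Ω] {μ : Measure Ω}
    [IsProbabilityMeasure μ] {f : Cube d → ℝ} {ℱ : Filtration ℕ mΩ} {D : ℕ → Ω → Set (Cube d)}
    {x : ℕ → Ω → Cube d} {ε : ℕ → Ω → ℝ} {N : ℕ → Ω → Sym2 P.Idx → ℝ} {n : ℕ → Ω → P.Idx → ℝ}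
    (h : P.IsRun μ f ℱ D x ε N n) (hT : 0 < P.T) (hm : 0 < P.mbar) (hσX : 0 < P.σX)
    (hσu : 0 < P.σu) (hζ : 0 < P.ζ) (hζ1 : P.ζ < 1) :
    μ {ω | ∃ t < P.T, (∃ y, P.lamMin * (y ⬝ᵥ y) < |y ⬝ᵥ P.accMatrix N t ω *ᵥ y|) ∨
      P.σu ^ 2 * P.T * (Real.sqrt (2 * P.m) + Real.sqrt (2 * Real.log (2 * P.T / P.ζ))) ^ 2 <
        P.accVector n t ω ⬝ᵥ P.accVector n t ω} ≤ ENNReal.ofReal (P.ζ / 2) := by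
  have hne := P.nonempty_Idx hm
  have hT' : (1 : ℝ) ≤ P.T := by exact_mod_cast hT
  have hcard : ((Fintype.card P.Idx : ℕ) : ℝ) = 2 * P.m := by
    rw [P.card_Idx]
    push_cast
    rfl
  have hcard1 : 1 ≤ Fintype.card P.Idx := Fintype.card_pos
  set L := Real.log (2 * P.T / P.ζ) with hL
  have hL0 : 0 < L := by
    refine Real.log_pos ?_
    rw [lt_div_iff₀ hζ]
    linarith
  have hpair : ∀ t < P.T, Measurable[ℱ (t + 1)] fun ω => (N t ω, n t ω) := fun t ht =>
    Measurable.prodMk (h.measurable_matrix t ht) (h.measurable_vector t ht)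
  have hind : ∀ t < P.T, Indep (MeasurableSpace.comap (fun ω => (N t ω, n t ω)) inferInstance)
      (ℱ t) μ := fun t ht => indep_of_indep_of_le_right (h.noise_indep t ht) le_sup_left
  have hLam : 0 < P.Lam := by
    rw [Params.Lam]
    have h1 := Real.sqrt_nonneg (2 * (P.m : ℝ))
    have h2 : 0 < Real.sqrt P.T := Real.sqrt_pos.2 (by linarith)
    exact mul_pos h2 (by linarith)
  have hlm : 0 < P.lamMin := mul_pos hσX hLam
  have hmat : ∀ t < P.T, 0 < t →
      μ {ω | ∃ y, P.lamMin * (y ⬝ᵥ y) < |y ⬝ᵥ P.accMatrix N t ω *ᵥ y|} ≤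
        ENNReal.ofReal (P.ζ / (2 * P.T ^ 2)) := by
    intro t ht ht0
    have ht' : (0 : ℝ) < t := by exact_mod_cast ht0
    refine (measure_exists_quadForm_ge_le (A := P.accMatrix N t) (v := t * P.σX ^ 2)
      (fun i j => ?_) (P.accMatrix_isSymm N t) (by positivity) hlm fun y hy a => ?_).trans
      (ENNReal.ofReal_le_ofReal ?_)
    · simp only [Params.accMatrix, of_apply]
      refine Finset.measurable_sum _ fun s hs => ?_
      have := Finset.mem_range.1 hs
      exact (measurable_pi_apply _).comp
        ((h.measurable_matrix s (by omega)).mono (ℱ.le _) le_rfl)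
    · have hg : Measurable fun z : (Sym2 P.Idx → ℝ) × (P.Idx → ℝ) =>
          a * (symCoeff y ⬝ᵥ z.1) := by
        simp only [dotProduct]
        fun_prop
      have := lintegral_exp_sum_le hpair h.noise_law hind hg (P.lintegral_exp_matrix_le hy a) t
        ht.le
      simp only [P.quadForm_accMatrix, Finset.mul_sum]
      refine this.trans (le_of_eq ?_)
      rw [← ENNReal.ofReal_pow (Real.exp_pos _).le, ← Real.exp_nat_mul, mul_assoc]
    · refine le_trans ?_ (two_mul_four_pow_mul_exp_le hcard1 hT hζ hζ1 hL)
      gcongr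
      rw [hcard, Params.lamMin, Params.Lam, ← hL, le_div_iff₀ (by positivity)]
      have htT : (t : ℝ) ≤ P.T := by exact_mod_cast ht.le
      have e : (7 / 9 * (P.σX * (Real.sqrt P.T * (4 * Real.sqrt (2 * P.m) + 2 * L)))) ^ 2 =
          49 / 81 * (2 * Real.sqrt (2 * P.m) + L) ^ 2 * (4 * (P.T * P.σX ^ 2)) := by
        have := Real.sq_sqrt (show (0 : ℝ) ≤ P.T by positivity)
        rw [mul_pow, mul_pow, mul_pow, this]
        ring
      rw [e]
      gcongr
  have hvec : ∀ t < P.T, 0 < t →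
      μ {ω | P.σu ^ 2 * P.T * (Real.sqrt (2 * P.m) + Real.sqrt (2 * L)) ^ 2 <
        P.accVector n t ω ⬝ᵥ P.accVector n t ω} ≤ ENNReal.ofReal (P.ζ / (2 * P.T)) := by
    intro t ht ht0
    have ht' : (0 : ℝ) < t := by exact_mod_cast ht0
    have hs : 0 < Real.sqrt (2 * L) := Real.sqrt_pos.2 (by positivity)
    have hSm : Measurable (P.accVector n t) := by
      have : P.accVector n t = fun ω => ∑ s ∈ Finset.range t, n s ω := rfl
      rw [this]
      refine Finset.measurable_sum _ fun s hs => ?_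
      have := Finset.mem_range.1 hs
      exact (h.measurable_vector s (by omega)).mono (ℱ.le _) le_rfl
    have hb := measure_le_dotProduct_self_le (μ := μ) hSm (v := t * P.σu ^ 2) (s := Real.sqrt (2 * L))
      (by positivity) hs fun c => by
        have hg : Measurable fun z : (Sym2 P.Idx → ℝ) × (P.Idx → ℝ) => c ⬝ᵥ z.2 := by
          simp only [dotProduct]
          fun_prop
        have := lintegral_exp_sum_le hpair h.noise_law hind hg (P.lintegral_exp_vector c).le t
          ht.le
        simp only [Params.accVector, dotProduct_sum]
        refine this.trans (le_of_eq ?_)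
        rw [← ENNReal.ofReal_pow (Real.exp_pos _).le, ← Real.exp_nat_mul]
        congr 2
        ring
    refine (measure_mono fun ω hω => ?_).trans (hb.trans (le_of_eq ?_))
    · have htT : (t : ℝ) ≤ P.T := by exact_mod_cast ht.le
      rw [Set.mem_ofPred_eq] at hω ⊢
      refine le_trans ?_ hω.le
      rw [hcard, mul_comm (t : ℝ)]
      gcongr
    · rw [Real.sq_sqrt (by positivity), mul_div_cancel_left₀ _ two_ne_zero, Real.exp_neg, hL,
        Real.exp_log (by positivity), inv_div]
  -- No noise has accumulated before the first round, so the union bound has T − 1 terms. This keeps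
  -- the total below ζ/2, as (T−1)(ζ/(2T²) + ζ/(2T)) = ζ/2 − ζ/(2T²).
  have hcover : {ω | ∃ t < P.T, (∃ y, P.lamMin * (y ⬝ᵥ y) < |y ⬝ᵥ P.accMatrix N t ω *ᵥ y|) ∨
      P.σu ^ 2 * P.T * (Real.sqrt (2 * P.m) + Real.sqrt (2 * L)) ^ 2 <
        P.accVector n t ω ⬝ᵥ P.accVector n t ω} ⊆ ⋃ t ∈ Finset.Ico 1 P.T,
      ({ω | ∃ y, P.lamMin * (y ⬝ᵥ y) < |y ⬝ᵥ P.accMatrix N t ω *ᵥ y|} ∪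
        {ω | P.σu ^ 2 * P.T * (Real.sqrt (2 * P.m) + Real.sqrt (2 * L)) ^ 2 <
        P.accVector n t ω ⬝ᵥ P.accVector n t ω}) := by
    rintro ω ⟨t, ht, hω⟩
    rcases Nat.eq_zero_or_pos t with rfl | ht0
    · exfalso
      rcases hω with ⟨y, hy⟩ | hy
      · have e : P.accMatrix N 0 ω = 0 := by
          ext i j
          simp [Params.accMatrix]
        have h0 : 0 ≤ y ⬝ᵥ y := by
          simpa using dotProduct_star_self_nonneg y
        rw [e, zero_mulVec, dotProduct_zero, abs_zero] at hy
        nlinarith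
      · simp only [Params.accVector, Finset.range_zero, Finset.sum_empty, dotProduct_zero] at hy
        have : 0 ≤ P.σu ^ 2 * P.T * (Real.sqrt (2 * P.m) + Real.sqrt (2 * L)) ^ 2 := by positivity
        linarith
    · simp only [Set.mem_iUnion]
      exact ⟨t, Finset.mem_Ico.2 ⟨ht0, ht⟩, hω⟩
  refine (measure_mono hcover).trans ((measure_biUnion_finset_le _ _).trans ?_)
  calc _ ≤ ∑ t ∈ Finset.Ico 1 P.T, ENNReal.ofReal (P.ζ / (2 * P.T ^ 2) + P.ζ / (2 * P.T)) := by
        refine Finset.sum_le_sum fun t ht => (measure_union_le _ _).trans ?_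
        rw [ENNReal.ofReal_add (by positivity) (by positivity)]
        have := Finset.mem_Ico.1 ht
        exact add_le_add (hmat t this.2 this.1) (hvec t this.2 this.1)
    _ = ENNReal.ofReal ((P.T - 1) * (P.ζ / (2 * P.T ^ 2) + P.ζ / (2 * P.T))) := by
        rw [Finset.sum_const, Nat.card_Ico, nsmul_eq_mul, ENNReal.ofReal_mul (by linarith)]
        congr 1
        rw [← ENNReal.ofReal_natCast, Nat.cast_sub hT, Nat.cast_one]
    _ ≤ ENNReal.ofReal (P.ζ / 2) := by
        refine ENNReal.ofReal_le_ofReal ?_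
        have e : ((P.T : ℝ) - 1) * (P.ζ / (2 * P.T ^ 2) + P.ζ / (2 * P.T)) =
            P.ζ / 2 - P.ζ / (2 * P.T ^ 2) := by
          field_simp
          ring
        rw [e]
        have : 0 ≤ P.ζ / (2 * (P.T : ℝ) ^ 2) := by positivity
        linarith

end GoodEvent

end PrivateGP
end

noncomputable section
open MeasureTheory ProbabilityTheory
namespace PrivateGP

/-! ### Perturbed ridge regression -/

open Matrix

section Ridge

variable {ι : Type*} [Fintype ι] [DecidableEq ι]

/-- The Gram matrix of the first `t` feature vectors. -/
def gramSum (X : ℕ → ι → ℝ) (t : ℕ) : Matrix ι ι ℝ :=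
  ∑ s ∈ Finset.range t, vecMulVec (X s) (X s)

lemma gramSum_posSemidef (X : ℕ → ι → ℝ) (t : ℕ) : (gramSum X t).PosSemidef :=
  posSemidef_sum _ fun _ _ => posSemidef_vecMulVec _

lemma gramSum_mulVec (X : ℕ → ι → ℝ) (t : ℕ) (θ : ι → ℝ) :
    gramSum X t *ᵥ θ = ∑ s ∈ Finset.range t, (θ ⬝ᵥ X s) • X s := by
  rw [gramSum, sum_mulVec]
  refine Finset.sum_congr rfl fun s _ => ?_
  rw [vecMulVec_mulVec, dotProduct_comm]
  ext i
  simp [mul_comm]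

lemma trace_gramSum (X : ℕ → ι → ℝ) (t : ℕ) :
    (gramSum X t).trace = ∑ s ∈ Finset.range t, X s ⬝ᵥ X s := by
  rw [gramSum, trace_sum]
  exact Finset.sum_congr rfl fun s _ => trace_vecMulVec _ _

lemma log_det_add_gramSum_le {c : ℝ} (hc : 0 < c) {X : ℕ → ι → ℝ} {t : ℕ}
    {V : Matrix ι ι ℝ} (hV : V.IsSymm)
    (h : ∀ y, y ⬝ᵥ (c • (1 : Matrix ι ι ℝ) + gramSum X t) *ᵥ y ≤ y ⬝ᵥ V *ᵥ y) :
    Real.log (c⁻¹ • (c • (1 : Matrix ι ι ℝ) + gramSum X t)).det ≤ Real.log (c⁻¹ • V).det := by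
  have hG : (c • (1 : Matrix ι ι ℝ) + gramSum X t).PosDef :=
    (posDef_smul_one hc).add_posSemidef (gramSum_posSemidef X t)
  have h2 := hG.smul (inv_pos.2 hc)
  refine Real.log_le_log h2.det_pos (det_le_det h2 (hV.smul _) fun y => ?_)
  rw [smul_mulVec, smul_mulVec, dotProduct_smul, dotProduct_smul]
  exact mul_le_mul_of_nonneg_left (h y) (inv_pos.2 hc).le

/-! ### Ridge regression with regulariser 2l·I + A + lam·I, where A is noise of spectral norm at
most l -/

section Perturbed

variable {X : ℕ → ι → ℝ} {t : ℕ} {A V : Matrix ι ι ℝ} {l lam : ℝ}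

lemma isSymm_of_eq_gramSum_add (hA : A.IsSymm)
    (hV : V = gramSum X t + ((2 * l) • (1 : Matrix ι ι ℝ) + A) + lam • 1) : V.IsSymm := by
  rw [hV]
  exact ((gramSum_posSemidef X t).isSymm_real.add ((isSymm_one.smul _).add hA)).add
    (isSymm_one.smul _)

/-- The shift 2l·I dominates the noise A with l to spare. Hence V can be exchanged for the noiseless
matrix with regulariser lam + l in every inverse norm. -/
lemma quadForm_le_of_eq_gramSum_add (hAl : ∀ y, |y ⬝ᵥ A *ᵥ y| ≤ l * (y ⬝ᵥ y))
    (hV : V = gramSum X t + ((2 * l) • (1 : Matrix ι ι ℝ) + A) + lam • 1) (y : ι → ℝ) :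
    y ⬝ᵥ ((lam + l) • (1 : Matrix ι ι ℝ) + gramSum X t) *ᵥ y ≤ y ⬝ᵥ V *ᵥ y := by
  rw [hV]
  simp only [add_mulVec, dotProduct_add, quadForm_smul_one]
  linarith [(abs_le.1 (hAl y)).1]

lemma posDef_of_eq_gramSum_add (hA : A.IsSymm) (hl : 0 < l) (hlam : 0 < lam)
    (hAl : ∀ y, |y ⬝ᵥ A *ᵥ y| ≤ l * (y ⬝ᵥ y))
    (hV : V = gramSum X t + ((2 * l) • (1 : Matrix ι ι ℝ) + A) + lam • 1) : V.PosDef := by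
  refine posDef_of_forall (isSymm_of_eq_gramSum_add hA hV) fun y hy => ?_
  have h : ((lam + l) • (1 : Matrix ι ι ℝ) + gramSum X t).PosDef :=
    (posDef_smul_one (by positivity)).add_posSemidef (gramSum_posSemidef X t)
  have h1 := h.dotProduct_mulVec_pos hy
  rw [star_trivial] at h1
  exact h1.trans_le (quadForm_le_of_eq_gramSum_add hAl hV y)

lemma mul_le_quadForm_of_eq_gramSum_add (hlam : 0 < lam)
    (hAl : ∀ y, |y ⬝ᵥ A *ᵥ y| ≤ l * (y ⬝ᵥ y))
    (hV : V = gramSum X t + ((2 * l) • (1 : Matrix ι ι ℝ) + A) + lam • 1) (y : ι → ℝ) :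
    l * (y ⬝ᵥ y) ≤ y ⬝ᵥ V *ᵥ y := by
  have h := quadForm_le_of_eq_gramSum_add hAl hV y
  rw [add_mulVec, dotProduct_add, quadForm_smul_one] at h
  have h1 := (gramSum_posSemidef X t).quadForm_nonneg y
  have h2 : 0 ≤ y ⬝ᵥ y := by simpa using dotProduct_star_self_nonneg y
  nlinarith

/-- Confidence bound for ridge regression with perturbed Gram matrix and response vector and with
a misspecified linear model. -/
lemma abs_dotProduct_ridge_sub_le (hA : A.IsSymm) (hl : 0 < l) (hlam : 0 < lam)
    (hAl : ∀ y, |y ⬝ᵥ A *ᵥ y| ≤ l * (y ⬝ᵥ y))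
    (hV : V = gramSum X t + ((2 * l) • (1 : Matrix ι ι ℝ) + A) + lam • 1)
    (hX : ∀ s, X s ⬝ᵥ X s = 1) {θ : ι → ℝ} {B : ℝ} (hB : 0 ≤ B) (hθ : θ ⬝ᵥ θ ≤ B ^ 2)
    {b ε : ℕ → ℝ} {δ : ℝ} (hδ : 0 ≤ δ) (hb : ∀ s, |b s| ≤ δ) {S : ι → ℝ} {k e : ℝ} (hk : 0 ≤ k)
    (hS : S ⬝ᵥ S ≤ k ^ 2 * l)
    (he : Real.sqrt ((∑ s ∈ Finset.range t, ε s • X s) ⬝ᵥ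
      ((lam + l) • (1 : Matrix ι ι ℝ) + gramSum X t)⁻¹ *ᵥ
        (∑ s ∈ Finset.range t, ε s • X s)) ≤ e) {u : ι → ℝ}
    (hu : u = ∑ s ∈ Finset.range t, (θ ⬝ᵥ X s + b s + ε s) • X s + S) {z : ι → ℝ}
    (hz : z ⬝ᵥ z = 1) :
    |z ⬝ᵥ V⁻¹ *ᵥ u - z ⬝ᵥ θ| ≤
      (B * Real.sqrt (3 * l + lam) + k + e) * Real.sqrt (z ⬝ᵥ V⁻¹ *ᵥ z) + t * δ / l := by
  have hVp := posDef_of_eq_gramSum_add hA hl hlam hAl hV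
  have hVi : V⁻¹.PosSemidef := hVp.inv.posSemidef
  have hVl := mul_le_quadForm_of_eq_gramSum_add hlam hAl hV
  have hunit : IsUnit V.det := (Matrix.isUnit_iff_isUnit_det V).1 hVp.isUnit
  set Q : Matrix ι ι ℝ := (2 * l) • (1 : Matrix ι ι ℝ) + A + lam • 1 with hQ
  have hVQ : V = gramSum X t + Q := by rw [hV, hQ, add_assoc]
  have hQs : Q.IsSymm := ((isSymm_one.smul _).add hA).add (isSymm_one.smul _)
  have hQq : ∀ y, y ⬝ᵥ Q *ᵥ y = (2 * l + lam) * (y ⬝ᵥ y) + y ⬝ᵥ A *ᵥ y := by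
    intro y
    rw [hQ]
    simp only [add_mulVec, dotProduct_add, quadForm_smul_one]
    ring
  have hyy : ∀ y : ι → ℝ, 0 ≤ y ⬝ᵥ y := fun y => by simpa using dotProduct_star_self_nonneg y
  have hQp : Q.PosDef := by
    refine posDef_of_forall hQs fun y hy => ?_
    rw [hQq]
    have h1 : 0 < y ⬝ᵥ y := by
      have := dotProduct_star_self_pos_iff.2 hy
      simpa using this
    nlinarith [(abs_le.1 (hAl y)).1]
  set wb := ∑ s ∈ Finset.range t, b s • X s with hwb
  set wε := ∑ s ∈ Finset.range t, ε s • X s with hwε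
  -- The error is V⁻¹ applied to four terms: misspecification, reward noise, vector noise, and the
  -- bias −Qθ of the perturbed regulariser Q.
  have hsplit : V⁻¹ *ᵥ u - θ = V⁻¹ *ᵥ (wb + wε + S + Q *ᵥ (-θ)) := by
    have h1 : θ = V⁻¹ *ᵥ (V *ᵥ θ) := by
      rw [mulVec_mulVec, nonsing_inv_mul _ hunit, one_mulVec]
    have h2 : u - V *ᵥ θ = wb + wε + S + Q *ᵥ (-θ) := by
      rw [hu, hVQ, add_mulVec, gramSum_mulVec, mulVec_neg]
      simp only [add_smul, Finset.sum_add_distrib]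
      rw [← hwb, ← hwε]
      abel
    rw [← h2, mulVec_sub, ← h1]
  have hdiff : z ⬝ᵥ V⁻¹ *ᵥ u - z ⬝ᵥ θ = z ⬝ᵥ V⁻¹ *ᵥ (wb + wε + S + Q *ᵥ (-θ)) := by
    rw [← hsplit, dotProduct_sub]
  have hcs := abs_dotProduct_mulVec_le hVi z (wb + wε + S + Q *ᵥ (-θ))
  rw [← hdiff] at hcs
  have ht1 := sqrt_quadForm_add_le hVi (wb + wε + S) (Q *ᵥ (-θ))
  have ht2 := sqrt_quadForm_add_le hVi (wb + wε) S
  have ht3 := sqrt_quadForm_add_le hVi wb wε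
  have hGp : ((lam + l) • (1 : Matrix ι ι ℝ) + gramSum X t).PosDef :=
    (posDef_smul_one (by positivity)).add_posSemidef (gramSum_posSemidef X t)
  have hε' : Real.sqrt (wε ⬝ᵥ V⁻¹ *ᵥ wε) ≤ e :=
    (Real.sqrt_le_sqrt (quadForm_inv_le hGp hVp (quadForm_le_of_eq_gramSum_add hAl hV) wε)).trans he
  have hS' : Real.sqrt (S ⬝ᵥ V⁻¹ *ᵥ S) ≤ k := by
    refine Real.sqrt_le_iff.2 ⟨hk, (quadForm_inv_le_div hl hVp hVl S).trans ?_⟩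
    rwa [div_le_iff₀ hl]
  -- From V ≥ Q, the V⁻¹-norm of Qθ is at most the Q-norm of θ, and Q ≤ (3l + lam)·I.
  have hQ' : Real.sqrt ((Q *ᵥ (-θ)) ⬝ᵥ V⁻¹ *ᵥ (Q *ᵥ (-θ))) ≤ B * Real.sqrt (3 * l + lam) := by
    refine Real.sqrt_le_iff.2 ⟨by positivity, ?_⟩
    have h1 := quadForm_inv_le hQp hVp (fun y => by
      rw [hVQ, add_mulVec (gramSum X t) Q y, dotProduct_add]
      linarith [(gramSum_posSemidef X t).quadForm_nonneg y]) (Q *ᵥ (-θ))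
    rw [quadForm_inv_mulVec hQp, hQq] at h1
    have h2 := (abs_le.1 (hAl (-θ))).2
    have h3 : (-θ) ⬝ᵥ (-θ) = θ ⬝ᵥ θ := by simp
    rw [h3] at h1 h2
    rw [mul_pow, Real.sq_sqrt (by positivity)]
    nlinarith [hyy θ]
  have hzl : z ⬝ᵥ V⁻¹ *ᵥ z ≤ 1 / l := by
    have := quadForm_inv_le_div hl hVp hVl z
    rwa [hz] at this
  -- The misspecification is a combination of t unit vectors with coefficients at most δ. This crude
  -- bound keeps it as a separate additive term, outside the confidence multiplier.
  have hwbn : wb ⬝ᵥ wb ≤ (t * δ) ^ 2 := by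
    have h1 : ∀ r, |wb ⬝ᵥ X r| ≤ t * δ := by
      intro r
      rw [hwb, sum_dotProduct]
      refine (Finset.abs_sum_le_sum_abs _ _).trans ?_
      refine (Finset.sum_le_sum (g := fun _ => δ) fun s _ => ?_).trans (by simp)
      rw [smul_dotProduct, smul_eq_mul, abs_mul]
      have := abs_dotProduct_le_one (hX s) (hX r)
      calc |b s| * |X s ⬝ᵥ X r| ≤ δ * 1 := mul_le_mul (hb s) this (abs_nonneg _) hδ
        _ = δ := mul_one _
    have h2 : wb ⬝ᵥ wb = ∑ s ∈ Finset.range t, b s * (wb ⬝ᵥ X s) := by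
      conv_lhs => rw [hwb]
      rw [← hwb, dotProduct_comm, hwb, dotProduct_sum]
      refine Finset.sum_congr rfl fun s _ => ?_
      rw [dotProduct_smul, smul_eq_mul]
    rw [h2]
    refine (Finset.sum_le_sum (g := fun _ => δ * (t * δ)) fun s _ => ?_).trans (le_of_eq ?_)
    · refine (le_abs_self _).trans ?_
      rw [abs_mul]
      exact mul_le_mul (hb s) (h1 s) (abs_nonneg _) hδ
    · rw [Finset.sum_const, Finset.card_range, nsmul_eq_mul]
      ring
  have hwb' : Real.sqrt (z ⬝ᵥ V⁻¹ *ᵥ z) * Real.sqrt (wb ⬝ᵥ V⁻¹ *ᵥ wb) ≤ t * δ / l := by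
    rw [← Real.sqrt_mul (hVi.quadForm_nonneg z)]
    refine Real.sqrt_le_iff.2 ⟨by positivity, ?_⟩
    have h1 := quadForm_inv_le_div hl hVp hVl wb
    calc z ⬝ᵥ V⁻¹ *ᵥ z * (wb ⬝ᵥ V⁻¹ *ᵥ wb) ≤ 1 / l * ((t * δ) ^ 2 / l) := by
          refine mul_le_mul hzl (h1.trans ?_) (hVi.quadForm_nonneg wb) (by positivity)
          gcongr
      _ = (t * δ / l) ^ 2 := by
          field_simp
  have hz0 := Real.sqrt_nonneg (z ⬝ᵥ V⁻¹ *ᵥ z)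
  calc _ ≤ Real.sqrt (z ⬝ᵥ V⁻¹ *ᵥ z) * (Real.sqrt (wb ⬝ᵥ V⁻¹ *ᵥ wb) +
        (B * Real.sqrt (3 * l + lam) + k + e)) := by
        refine hcs.trans (mul_le_mul_of_nonneg_left ?_ hz0)
        linarith
    _ ≤ _ := by
        rw [mul_add]
        linarith

/-- The logarithm of the determinant is bounded by the trace: the unit features contribute t, and
l·I + A at most 2l per dimension. This makes the width deterministic. -/
lemma log_det_le_of_eq_gramSum_add (hA : A.IsSymm) (hl : 0 < l) (hlam : 0 < lam)
    (hAl : ∀ y, |y ⬝ᵥ A *ᵥ y| ≤ l * (y ⬝ᵥ y))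
    (hV : V = gramSum X t + ((2 * l) • (1 : Matrix ι ι ℝ) + A) + lam • 1)
    (hX : ∀ s, X s ⬝ᵥ X s = 1) :
    Real.log ((lam + l)⁻¹ • V).det ≤ t / l + 2 * Fintype.card ι := by
  have hc : 0 < lam + l := by positivity
  have hK : (gramSum X t + (l • (1 : Matrix ι ι ℝ) + A)).PosSemidef := by
    refine (gramSum_posSemidef X t).add (posSemidef_of_forall ((isSymm_one.smul _).add hA)
      fun y => ?_)
    rw [add_mulVec, dotProduct_add, quadForm_smul_one]
    linarith [(abs_le.1 (hAl y)).1]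
  have e : (lam + l)⁻¹ • V =
      1 + (lam + l)⁻¹ • (gramSum X t + (l • (1 : Matrix ι ι ℝ) + A)) := by
    have h1 : V = (lam + l) • (1 : Matrix ι ι ℝ) +
        (gramSum X t + (l • (1 : Matrix ι ι ℝ) + A)) := by
      rw [hV, add_smul, two_mul, add_smul]
      abel
    rw [h1, smul_add, smul_smul, inv_mul_cancel₀ hc.ne', one_smul]
  rw [e]
  refine (log_det_one_add_le_trace (hK.smul (inv_pos.2 hc).le)).trans ?_
  have htr : A.trace ≤ l * Fintype.card ι := by
    have : ∀ i, A i i ≤ l := by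
      intro i
      have h1 := (abs_le.1 (hAl (Pi.single i 1))).2
      simpa using h1
    calc A.trace ≤ ∑ _ : ι, l := Finset.sum_le_sum fun i _ => this i
      _ = _ := by
        rw [Finset.sum_const, nsmul_eq_mul, Finset.card_univ, mul_comm]
  rw [trace_smul, trace_add, trace_add, trace_smul, trace_one, trace_gramSum]
  simp only [hX, Finset.sum_const, Finset.card_range, nsmul_eq_mul, mul_one, smul_eq_mul]
  rw [inv_mul_le_iff₀ hc]
  have h0 : (0 : ℝ) ≤ t / l + 2 * Fintype.card ι := by positivity
  have h1 : l * (t / l + 2 * Fintype.card ι) = t + 2 * l * Fintype.card ι := by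
    field_simp
  nlinarith

end Perturbed

/-- Sylvester's identity for Gram matrices. -/
lemma det_one_add_smul_gramSum (X : ℕ → ι → ℝ) (T : ℕ) (c : ℝ) :
    (1 + c • gramSum X T).det =
      (1 + c • Matrix.of fun a b : Fin T => X a ⬝ᵥ X b).det := by
  set R : Matrix (Fin T) ι ℝ := Matrix.of fun a => X a with hR
  have e1 : gramSum X T = Rᵀ * R := by
    ext i j
    rw [gramSum, Matrix.sum_apply, mul_apply, Finset.sum_range]
    rfl
  have e2 : (Matrix.of fun a b : Fin T => X a ⬝ᵥ X b) = R * Rᵀ := by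
    ext a b
    rfl
  rw [e1, e2, ← Matrix.smul_mul, ← Matrix.mul_smul, ← transpose_smul, transpose_smul,
    Matrix.smul_mul, ← Matrix.mul_smul, det_one_add_mul_comm, Matrix.smul_mul, Matrix.mul_smul]

/-- Comparison of the log determinants of a kernel matrix and of its approximation. -/
lemma log_det_one_add_smul_le_of_approx {T : ℕ} {K K' : Matrix (Fin T) (Fin T) ℝ}
    (hK : K.PosSemidef) (hK' : K'.PosSemidef) {η c : ℝ} (hη : 0 ≤ η) (hc : 0 ≤ c)
    (h : ∀ a b, |K a b - K' a b| ≤ η) :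
    Real.log (1 + c • K').det ≤ c * T ^ 2 * η + Real.log (1 + c • K).det := by
  have hp : (1 + c • K').PosDef := PosDef.one.add_posSemidef (hK'.smul hc)
  have hpK : (1 + c • K).PosDef := PosDef.one.add_posSemidef (hK.smul hc)
  -- An entrywise error η changes the form by at most η(Σ|y_a|)² ≤ Tη|y|², so 1 + cK' ≤ (1 + cTη)(1
  -- + cK). The determinant raises the scalar to the power T, which gives T².
  have hq : ∀ y : Fin T → ℝ, y ⬝ᵥ K' *ᵥ y ≤ y ⬝ᵥ K *ᵥ y + T * η * (y ⬝ᵥ y) := by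
    intro y
    have h1 : y ⬝ᵥ K' *ᵥ y - y ⬝ᵥ K *ᵥ y = ∑ a, ∑ b, y a * y b * (K' a b - K a b) := by
      simp only [dotProduct, mulVec, Finset.mul_sum, ← Finset.sum_sub_distrib]
      exact Finset.sum_congr rfl fun a _ => Finset.sum_congr rfl fun b _ => by ring
    have h2 : ∑ a, ∑ b, y a * y b * (K' a b - K a b) ≤ ∑ a, ∑ b, |y a| * |y b| * η := by
      refine Finset.sum_le_sum fun a _ => Finset.sum_le_sum fun b _ => ?_
      refine (le_abs_self _).trans ?_
      rw [abs_mul, abs_mul, abs_sub_comm]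
      exact mul_le_mul_of_nonneg_left (h a b) (by positivity)
    have h3 : ∑ a, ∑ b, |y a| * |y b| * η = (∑ a, |y a|) ^ 2 * η := by
      rw [sq, Finset.sum_mul_sum, Finset.sum_mul]
      exact Finset.sum_congr rfl fun a _ => by rw [Finset.sum_mul]
    have h4 : (∑ a, |y a|) ^ 2 ≤ T * (y ⬝ᵥ y) := by
      refine sq_sum_le_card_mul_sum_sq.trans (le_of_eq ?_)
      rw [Finset.card_univ, Fintype.card_fin]
      congr 1
      exact Finset.sum_congr rfl fun a _ => by rw [sq_abs, sq]
    nlinarith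
  set g := 1 + c * (T * η) with hg
  have hg1 : 1 ≤ g := by
    have : 0 ≤ c * (T * η) := by positivity
    linarith
  have hle : (1 + c • K').det ≤ (g • (1 + c • K)).det := by
    refine det_le_det hp (hpK.posSemidef.isSymm_real.smul _) fun y => ?_
    have hyy : 0 ≤ y ⬝ᵥ y := by simpa using dotProduct_star_self_nonneg y
    have h0 := hK.quadForm_nonneg y
    simp only [smul_mulVec, add_mulVec, one_mulVec, dotProduct_add, dotProduct_smul, smul_eq_mul]
    have h1 := mul_le_mul_of_nonneg_left (hq y) hc
    have h2 : 0 ≤ (g - 1) * (c * (y ⬝ᵥ K *ᵥ y)) := mul_nonneg (by linarith) (by positivity)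
    have h3 : g * (y ⬝ᵥ y) = y ⬝ᵥ y + c * (T * η * (y ⬝ᵥ y)) := by
      rw [hg]
      ring
    nlinarith
  refine (Real.log_le_log hp.det_pos hle).trans ?_
  rw [det_smul, Fintype.card_fin, Real.log_mul (by positivity) hpK.det_pos.ne', Real.log_pow]
  have h5 : Real.log g ≤ c * (T * η) := by
    have := Real.log_le_sub_one_of_pos (show 0 < g by linarith)
    linarith
  have h6 : (T : ℝ) * Real.log g ≤ T * (c * (T * η)) := by gcongr
  nlinarith

end Ridge

end PrivateGP
end

noncomputable section
open MeasureTheory ProbabilityTheory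
namespace PrivateGP

/-! ### Regret on the good event -/

open Matrix

section Regret

namespace Params

variable {d : ℕ} (P : Params d)

lemma approxError_nonneg : 0 ≤ P.approxError := by
  rw [approxError]
  positivity

/-- Uniform bound for the width `ρ β_t^{1/2}` of the confidence intervals. -/
def width : ℝ :=
  P.B * Real.sqrt (P.lamMax + P.lam) + P.T * P.B * P.approxError / Real.sqrt P.lamMin + P.κ +
    P.ρ * Real.sqrt (P.T / P.lamMin + 2 * (2 * P.m) + 2 * Real.log (2 / P.ζ))

variable {Ω : Type*} {f : Cube d → ℝ} {x : ℕ → Ω → Cube d} {ε : ℕ → Ω → ℝ}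
  {N : ℕ → Ω → Sym2 P.Idx → ℝ} {n : ℕ → Ω → P.Idx → ℝ}

/-- The initial state supplies exactly the shift 2λ_min·I, so the server's matrix has the form that
the perturbed ridge estimates require. -/
lemma V_serverState (ω : Ω) (t : ℕ) :
    P.V (P.serverState f x ε N n ω t) = gramSum (fun s => P.Φ (x s ω)) t +
      ((2 * P.lamMin) • (1 : Matrix P.Idx P.Idx ℝ) + P.accMatrix N t ω) + P.lam • 1 := by
  rw [V]
  congr 1
  ext i j
  rw [of_apply]
  induction t with
  | zero =>
    simp [serverState, init, gramSum, accMatrix, lamMin, mul_assoc]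
  | succ t ih =>
    simp only [serverState, message, ih]
    simp only [gramSum, accMatrix, Finset.sum_range_succ, Matrix.add_apply, of_apply,
      vecMulVec_apply]
    ring

lemma serverState_snd (ω : Ω) (t : ℕ) :
    (P.serverState f x ε N n ω t).2 =
      ∑ s ∈ Finset.range t, (f (x s ω) + ε s ω) • P.Φ (x s ω) + P.accVector n t ω := by
  induction t with
  | zero => simp [serverState, init, accVector]
  | succ t ih =>
    simp only [serverState, message, ih]
    ext i
    simp only [accVector, Finset.sum_range_succ, Pi.add_apply, Pi.smul_apply, smul_eq_mul]
    ring

/-- The regret bound on the event where the privacy noise and the reward noise are well behaved. -/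
lemma regret_le_of_good {D : ℕ → Ω → Set (Cube d)} {ω : Ω} (hm : 0 < P.mbar) (hσu : 0 < P.σu)
    (hρ : 0 < P.ρ) (hB : 0 ≤ P.B) (hlam : 0 < P.lam) (hζ : 0 < P.ζ) (hζ1 : P.ζ < 1)
    (hl : 1 ≤ P.lamMin) {θ : P.Idx → ℝ} (hθ : θ ⬝ᵥ θ ≤ P.B ^ 2) {δ : ℝ} (hδ : 0 ≤ δ)
    (hf : ∀ y, |f y - θ ⬝ᵥ P.Φ y| ≤ δ)
    (hact : ∀ t < P.T, P.IsAction (t + 1) (P.serverState f x ε N n ω t) (D t ω) (x t ω))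
    (hmat : ∀ t < P.T, ∀ y, |y ⬝ᵥ P.accMatrix N t ω *ᵥ y| ≤ P.lamMin * (y ⬝ᵥ y))
    (hvec : ∀ t < P.T, P.accVector n t ω ⬝ᵥ P.accVector n t ω ≤ P.σu ^ 2 * P.T *
      (Real.sqrt (2 * P.m) + Real.sqrt (2 * Real.log (2 * P.T / P.ζ))) ^ 2)
    (hself : ∀ t < P.T, (∑ s ∈ Finset.range t, ε s ω • P.Φ (x s ω)) ⬝ᵥ
      ((P.lam + P.lamMin) • (1 : Matrix P.Idx P.Idx ℝ) + gramSum (fun s => P.Φ (x s ω)) t)⁻¹ *ᵥ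
        (∑ s ∈ Finset.range t, ε s ω • P.Φ (x s ω)) ≤
      P.ρ ^ 2 * (Real.log ((P.lam + P.lamMin)⁻¹ • ((P.lam + P.lamMin) •
        (1 : Matrix P.Idx P.Idx ℝ) + gramSum (fun s => P.Φ (x s ω)) t)).det +
          2 * Real.log (2 / P.ζ))) :
    P.regret f D x ω ≤ 2 * P.width * (Real.sqrt P.T * Real.sqrt (2 *
      Real.log (1 + (P.lam + P.lamMin)⁻¹ • gramSum (fun s => P.Φ (x s ω)) P.T).det)) +
      2 * P.T * (δ * (P.T + 1)) := by
  set X : ℕ → P.Idx → ℝ := fun s => P.Φ (x s ω) with hX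
  set l := P.lamMin with hldef
  have hl0 : 0 < l := by linarith
  set c := P.lam + l with hc
  have hc0 : 0 < c := by positivity
  have hX1 : ∀ s, X s ⬝ᵥ X s = 1 := fun s => P.Φ_dotProduct_self hm _
  have hT0 : (0 : ℝ) ≤ P.T := Nat.cast_nonneg _
  have hlogζ : 0 ≤ Real.log (2 / P.ζ) := Real.log_nonneg (by
    rw [le_div_iff₀ hζ]
    linarith)
  have hκ0 : 0 ≤ P.κ := by
    rw [κ]
    positivity
  have hκl : P.κ ^ 2 * l = P.σu ^ 2 * P.T *
      (Real.sqrt (2 * P.m) + Real.sqrt (2 * Real.log (2 * P.T / P.ζ))) ^ 2 := by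
    rw [κ, ← hldef, mul_pow, mul_pow, Real.sq_sqrt (by positivity)]
    field_simp
  have hmax : 3 * l = P.lamMax := by
    rw [hldef, lamMin, lamMax]
    ring
  have happ := P.approxError_nonneg
  set V : ℕ → Matrix P.Idx P.Idx ℝ := fun t => P.V (P.serverState f x ε N n ω t) with hV
  have hVe : ∀ t, V t = gramSum X t +
      ((2 * l) • (1 : Matrix P.Idx P.Idx ℝ) + P.accMatrix N t ω) + P.lam • 1 := fun t =>
    P.V_serverState ω t
  have hVp : ∀ t < P.T, (V t).PosDef := fun t ht =>
    posDef_of_eq_gramSum_add (P.accMatrix_isSymm N t ω) hl0 hlam (hmat t ht) (hVe t)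
  have hVs : ∀ t < P.T, (V t).IsSymm := fun t ht => (hVp t ht).posSemidef.isSymm_real
  set w : ℕ → ℝ := fun t => P.ρ * P.sqrtBeta (t + 1) (P.serverState f x ε N n ω t) with hw
  set g : ℕ → ℝ := fun t => Real.log (c⁻¹ • V t).det + 2 * Real.log (2 / P.ζ) with hg
  have hwe : ∀ t, w t = P.B * Real.sqrt (P.lamMax + P.lam) +
      (t + 1) * P.B * P.approxError / Real.sqrt l + P.κ + P.ρ * Real.sqrt (g t) := by
    intro t
    have : 0 < Real.sqrt l := Real.sqrt_pos.2 hl0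
    simp only [hw, sqrtBeta, hg, hV, ← hldef, ← hc]
    push_cast
    field_simp
  have hG : ∀ t < P.T, Real.sqrt ((∑ s ∈ Finset.range t, ε s ω • X s) ⬝ᵥ
      (c • (1 : Matrix P.Idx P.Idx ℝ) + gramSum X t)⁻¹ *ᵥ
        (∑ s ∈ Finset.range t, ε s ω • X s)) ≤ P.ρ * Real.sqrt (g t) := by
    intro t ht
    have h1 := log_det_add_gramSum_le hc0 (hVs t ht)
      (quadForm_le_of_eq_gramSum_add (hmat t ht) (hVe t))
    have h2 : P.ρ * Real.sqrt (g t) = Real.sqrt (P.ρ ^ 2 * g t) := by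
      rw [Real.sqrt_mul (sq_nonneg _), Real.sqrt_sq hρ.le]
    rw [h2]
    refine Real.sqrt_le_sqrt ((hself t ht).trans ?_)
    refine mul_le_mul_of_nonneg_left ?_ (sq_nonneg _)
    simp only [hg]
    linarith
  have hconf : ∀ t < P.T, ∀ y, |P.θ (P.serverState f x ε N n ω t) ⬝ᵥ P.Φ y - θ ⬝ᵥ P.Φ y| ≤
      w t * Real.sqrt (P.Φ y ⬝ᵥ (V t)⁻¹ *ᵥ P.Φ y) + δ * P.T := by
    intro t ht y
    have h := abs_dotProduct_ridge_sub_le (P.accMatrix_isSymm N t ω) hl0 hlam (hmat t ht) (hVe t)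
      hX1 hB hθ (b := fun s => f (x s ω) - θ ⬝ᵥ X s) (ε := fun s => ε s ω) hδ (fun s => hf _)
      (S := P.accVector n t ω) hκ0 (by rw [hκl]; exact hvec t ht) (hG t ht)
      (u := (P.serverState f x ε N n ω t).2) (by
        rw [P.serverState_snd]
        congr 1
        refine Finset.sum_congr rfl fun s _ => ?_
        congr 1
        ring) (P.Φ_dotProduct_self hm y)
    rw [dotProduct_comm _ (P.Φ y), dotProduct_comm θ (P.Φ y), Params.θ]
    -- The declared approximation error in β_t enters only through its nonnegativity. The actual
    -- misspecification goes into the additive term δT, by l ≥ 1.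
    refine h.trans (add_le_add (mul_le_mul_of_nonneg_right ?_ (Real.sqrt_nonneg _)) ?_)
    · rw [hwe, hmax]
      have : 0 ≤ ((t : ℝ) + 1) * P.B * P.approxError / Real.sqrt l := by positivity
      linarith
    · have htT : (t : ℝ) ≤ P.T := by exact_mod_cast ht.le
      rw [div_le_iff₀ hl0]
      have h1 : (t : ℝ) * δ ≤ P.T * δ := mul_le_mul_of_nonneg_right htT hδ
      have h2 : 0 ≤ δ * P.T := by positivity
      nlinarith
  -- Optimism: the action maximises the upper confidence bound, so the gap is at most twice the band
  -- at the action. Each of the two comparisons also costs δT from the band and δ from passing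
  -- between f and its linear approximation.
  have hinst : ∀ t < P.T, sSup (f '' D t ω) - f (x t ω) ≤
      2 * (w t * Real.sqrt (X t ⬝ᵥ (V t)⁻¹ *ᵥ X t)) + 2 * (δ * (P.T + 1)) := by
    intro t ht
    obtain ⟨hmem, hmaxon⟩ := hact t ht
    rw [sub_le_iff_le_add]
    refine csSup_le ⟨_, Set.mem_image_of_mem f hmem⟩ ?_
    rintro _ ⟨y, hy, rfl⟩
    have h1 : P.ucb (t + 1) (P.serverState f x ε N n ω t) y ≤
        P.ucb (t + 1) (P.serverState f x ε N n ω t) (x t ω) := hmaxon hy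
    have hu : ∀ z, P.ucb (t + 1) (P.serverState f x ε N n ω t) z =
        P.θ (P.serverState f x ε N n ω t) ⬝ᵥ P.Φ z +
          w t * Real.sqrt (P.Φ z ⬝ᵥ (V t)⁻¹ *ᵥ P.Φ z) := by
      intro z
      simp only [ucb, σpost, hw, hV]
      ring
    rw [hu, hu] at h1
    have h2 := (abs_le.1 (hconf t ht y)).1
    have h3 := (abs_le.1 (hconf t ht (x t ω))).2
    have h4 := (abs_le.1 (hf y)).2
    have h5 := (abs_le.1 (hf (x t ω))).1
    simp only [hX]
    linarith
  have hww : ∀ t < P.T, w t ≤ P.width := by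
    intro t ht
    rw [hwe, width]
    have htT : (t : ℝ) + 1 ≤ P.T := by exact_mod_cast ht
    have h1 := log_det_le_of_eq_gramSum_add (P.accMatrix_isSymm N t ω) hl0 hlam (hmat t ht) (hVe t)
      hX1
    rw [P.card_Idx] at h1
    push_cast at h1
    have h2 : g t ≤ P.T / l + 2 * (2 * P.m) + 2 * Real.log (2 / P.ζ) := by
      have : (t : ℝ) / l ≤ P.T / l := by
        gcongr
      simp only [hg]
      linarith
    have h3 := mul_le_mul_of_nonneg_left (Real.sqrt_le_sqrt h2) hρ.le
    have h4 : ((t : ℝ) + 1) * P.B * P.approxError / Real.sqrt l ≤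
        P.T * P.B * P.approxError / Real.sqrt l := by gcongr
    linarith
  set qf : ℕ → ℝ := fun t => X t ⬝ᵥ (V t)⁻¹ *ᵥ X t with hqf
  have hw0 : 0 ≤ P.width := by
    rw [width]
    have h1 : 0 ≤ P.T * P.B * P.approxError / Real.sqrt P.lamMin := by positivity
    positivity
  -- V_t dominates the noiseless matrix with regulariser c, so the elliptical potential lemma
  -- applies; c ≥ 1 makes its factor at most 2.
  have hqsum : ∑ t ∈ Finset.range P.T, qf t ≤
      2 * Real.log (1 + c⁻¹ • gramSum X P.T).det := by
    have h1 := sum_quadForm_inv_le hc0 (fun t => (hX1 t).le) P.T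
    have h2 : ∑ t ∈ Finset.range P.T, qf t ≤ ∑ t ∈ Finset.range P.T, X t ⬝ᵥ
        (c • (1 : Matrix P.Idx P.Idx ℝ) + gramSum X t)⁻¹ *ᵥ X t := by
      refine Finset.sum_le_sum fun t ht => ?_
      have ht' := Finset.mem_range.1 ht
      exact quadForm_inv_le ((posDef_smul_one hc0).add_posSemidef (gramSum_posSemidef X t))
        (hVp t ht') (quadForm_le_of_eq_gramSum_add (hmat t ht') (hVe t)) _
    have h3 : 0 ≤ Real.log (1 + c⁻¹ • gramSum X P.T).det :=
      Real.log_nonneg (one_le_det_one_add ((gramSum_posSemidef X P.T).smul (inv_pos.2 hc0).le))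
    have h4 : 1 + 1 / c ≤ 2 := by
      have : 1 / c ≤ 1 := by
        rw [div_le_one hc0]
        linarith
      linarith
    exact h2.trans (h1.trans (mul_le_mul_of_nonneg_right h4 h3))
  have hsq : ∑ t ∈ Finset.range P.T, Real.sqrt (qf t) ≤ Real.sqrt P.T *
      Real.sqrt (2 * Real.log (1 + c⁻¹ • gramSum X P.T).det) := by
    rw [← Real.sqrt_mul hT0]
    refine Real.le_sqrt_of_sq_le (sq_sum_le_card_mul_sum_sq.trans ?_)
    rw [Finset.card_range]
    refine mul_le_mul_of_nonneg_left (le_trans (le_of_eq ?_) hqsum) hT0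
    refine Finset.sum_congr rfl fun t ht => Real.sq_sqrt ?_
    exact (hVp t (Finset.mem_range.1 ht)).inv.posSemidef.quadForm_nonneg _
  calc P.regret f D x ω ≤ ∑ t ∈ Finset.range P.T,
        (2 * P.width * Real.sqrt (qf t) + 2 * (δ * (P.T + 1))) := by
        refine Finset.sum_le_sum fun t ht => (hinst t (Finset.mem_range.1 ht)).trans ?_
        have := mul_le_mul_of_nonneg_right (hww t (Finset.mem_range.1 ht)) (Real.sqrt_nonneg (qf t))
        linarith
    _ = 2 * P.width * ∑ t ∈ Finset.range P.T, Real.sqrt (qf t) + 2 * P.T * (δ * (P.T + 1)) := by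
        rw [Finset.sum_add_distrib, ← Finset.mul_sum, Finset.sum_const, Finset.card_range,
          nsmul_eq_mul]
        ring
    _ ≤ _ := by
        refine add_le_add (mul_le_mul_of_nonneg_left hsq (by positivity)) le_rfl

end Params

end Regret

end PrivateGP
end

noncomputable section
open MeasureTheory ProbabilityTheory
namespace PrivateGP

/-! ### Regret with high probability -/

open Matrix

section HighProbability

variable {d : ℕ} (P : Params d)

lemma Params.measurable_Φ : Measurable P.Φ := by
  refine measurable_pi_lambda _ fun i => ?_
  have h : ∀ y : Cube d, P.Φ y i = Real.sqrt (∏ j, hermiteWeight P.mbar (i.1 j)) *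
      bif i.2 then Real.cos (∑ j, (i.1 j : ℝ) / P.ν j * (y : Fin d → ℝ) j)
      else Real.sin (∑ j, (i.1 j : ℝ) / P.ν j * (y : Fin d → ℝ) j) := fun y => rfl
  simp only [h]
  have hs : Measurable fun y : Cube d => ∑ j, (i.1 j : ℝ) / P.ν j * (y : Fin d → ℝ) j :=
    Finset.measurable_sum _ fun j _ =>
      ((measurable_pi_apply j).comp measurable_subtype_coe).const_mul _
  refine Measurable.const_mul ?_ _
  cases i.2
  · exact Real.measurable_sin.comp hs
  · exact Real.measurable_cos.comp hs

/-- Sylvester's identity passes to the T×T matrix of inner products of features, the kernel replaces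
it at the cost of T² times the entrywise error, and exchanging the regulariser c for ρ² costs a
factor of at most 1 + ρ². -/
lemma log_det_one_add_smul_gramSum_le (hd : 0 < d) {k : (Fin d → ℝ) → (Fin d → ℝ) → ℝ}
    {p : Fin d → Measure ℝ} (hk : IsDecomposable k p)
    (hp : ∀ j, p j = gaussianReal 0 (1 / (P.ν j) ^ 2).toNNReal) (hm : 0 < P.mbar)
    (hρ : 0 < P.ρ) {c : ℝ} (hc : 1 ≤ c) (x : ℕ → Cube d) (T : ℕ) :
    Real.log (1 + c⁻¹ • gramSum (fun s => P.Φ (x s)) T).det ≤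
      T ^ 2 * (featureConst P.ν * Real.exp (-P.mbar)) +
        2 * (1 + P.ρ ^ 2) * maxInfoGain k P.ρ T := by
  have hc0 : 0 < c := by linarith
  have hcinv : c⁻¹ ≤ 1 := inv_le_one_of_one_le₀ hc
  set η := featureConst P.ν * Real.exp (-P.mbar) with hη
  have hη0 : 0 ≤ η := mul_nonneg (featureConst_nonneg _) (Real.exp_pos _).le
  set K : Matrix (Fin T) (Fin T) ℝ := Matrix.of fun a b => k (x a) (x b) with hK
  set K' : Matrix (Fin T) (Fin T) ℝ := Matrix.of fun a b => P.Φ (x a) ⬝ᵥ P.Φ (x b) with hK'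
  have hKp : K.PosSemidef := hk.posSemidef_gram fun a : Fin T => (x a : Fin d → ℝ)
  have hK'p : K'.PosSemidef := by
    have e : K' = (Matrix.of fun i (a : Fin T) => P.Φ (x a) i)ᵀ *
        (Matrix.of fun i (a : Fin T) => P.Φ (x a) i) := by
      ext a b
      rfl
    rw [e]
    simpa using posSemidef_conjTranspose_mul_self (Matrix.of fun i (a : Fin T) => P.Φ (x a) i)
  have h1 := log_det_one_add_smul_le_of_approx hKp hK'p hη0 (inv_pos.2 hc0).le fun a b =>
    abs_kernel_sub_qff_le hk hp hm (x a).2 (x b).2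
  have h2 := log_det_le_maxInfoGain hd hk hp hρ (T := T) (x := fun a => (x a : Fin d → ℝ))
    fun a => (x a).2
  set A : Matrix (Fin T) (Fin T) ℝ := (P.ρ ^ 2)⁻¹ • K with hA
  have hAp : A.PosSemidef := hKp.smul (by positivity)
  have e1 : c⁻¹ • K = (P.ρ ^ 2 * c⁻¹) • A := by
    rw [hA, smul_smul]
    congr 1
    field_simp
  have h3 := log_det_one_add_smul_le hAp (a := P.ρ ^ 2 * c⁻¹) (by positivity)
  rw [← e1] at h3
  have h4 : max 1 (P.ρ ^ 2 * c⁻¹) ≤ 1 + P.ρ ^ 2 := by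
    refine max_le (by nlinarith [sq_nonneg P.ρ]) ?_
    nlinarith [sq_nonneg P.ρ]
  have h5 : 0 ≤ Real.log (1 + A).det := Real.log_nonneg (one_le_det_one_add hAp)
  have h6 : Real.log (1 + A).det ≤ 2 * maxInfoGain k P.ρ T := by
    change Real.log (1 + A).det / 2 ≤ _ at h2
    linarith
  have h7 : c⁻¹ * (T : ℝ) ^ 2 * η ≤ T ^ 2 * η := by
    have : 0 ≤ (T : ℝ) ^ 2 * η := by positivity
    rw [mul_assoc]
    nlinarith
  rw [det_one_add_smul_gramSum]
  refine h1.trans (add_le_add h7 (h3.trans ?_))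
  calc _ ≤ (1 + P.ρ ^ 2) * Real.log (1 + A).det := mul_le_mul_of_nonneg_right h4 h5
    _ ≤ (1 + P.ρ ^ 2) * (2 * maxInfoGain k P.ρ T) :=
        mul_le_mul_of_nonneg_left h6 (by positivity)
    _ = _ := by ring

lemma Params.width_nonneg (hρ : 0 < P.ρ) (hB : 0 ≤ P.B) (hσu : 0 < P.σu) : 0 ≤ P.width := by
  rw [width, κ]
  have h1 := P.approxError_nonneg
  have h2 : 0 ≤ P.T * P.B * P.approxError / Real.sqrt P.lamMin := by positivity
  positivity

/-- The regret of a run exceeds the explicit bound with probability at most `ζ`. -/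
lemma Params.IsRun.measure_regret_le (hd : 0 < d) {k : (Fin d → ℝ) → (Fin d → ℝ) → ℝ}
    {p : Fin d → Measure ℝ} (hk : IsDecomposable k p)
    (hp : ∀ j, p j = gaussianReal 0 (1 / (P.ν j) ^ 2).toNNReal)
    {H : Type*} [NormedAddCommGroup H] [InnerProductSpace ℝ H] [CompleteSpace H]
    [RKHS ℝ H (Cube d) ℝ] (hH : ∀ x y : Cube d, RKHS.kernel H x y 1 = k x y)
    {Ω : Type*} [mΩ : MeasurableSpace Ω] {μ : Measure Ω}
    [IsProbabilityMeasure μ] {f : H} (hf : ‖f‖ ≤ P.B) {ℱ : Filtration ℕ mΩ}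
    {D : ℕ → Ω → Set (Cube d)}
    {x : ℕ → Ω → Cube d} {ε : ℕ → Ω → ℝ} {N : ℕ → Ω → Sym2 P.Idx → ℝ} {n : ℕ → Ω → P.Idx → ℝ}
    (h : P.IsRun μ f ℱ D x ε N n) (hT : 0 < P.T) (hm : 0 < P.mbar) (hσX : 0 < P.σX)
    (hσu : 0 < P.σu) (hρ : 0 < P.ρ) (hlam : 0 < P.lam) (hζ : 0 < P.ζ) (hζ1 : P.ζ < 1)
    (hl : 1 ≤ P.lamMin) :
    μ {ω | ¬ P.regret f D x ω ≤ 2 * P.width * (Real.sqrt P.T * Real.sqrt (2 *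
      (P.T ^ 2 * (featureConst P.ν * Real.exp (-P.mbar)) +
        2 * (1 + P.ρ ^ 2) * maxInfoGain k P.ρ P.T))) +
      2 * P.T * (P.B * Real.sqrt (featureConst P.ν * Real.exp (-P.mbar)) * (P.T + 1))} ≤
      ENNReal.ofReal P.ζ := by
  have hB : 0 ≤ P.B := (norm_nonneg f).trans hf
  set η := featureConst P.ν * Real.exp (-P.mbar) with hη
  have hη0 : 0 ≤ η := mul_nonneg (featureConst_nonneg _) (Real.exp_pos _).le
  obtain ⟨θ, hθ, hfθ⟩ := exists_feature_approx (Φ := P.Φ) hη0 (fun y z => by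
    rw [hH]
    exact abs_kernel_sub_qff_le hk hp hm y.2 z.2) f hf
  have hc : 0 < P.lam + P.lamMin := by linarith
  have hself := measure_selfNormalised_le (μ := μ) (ℱ := ℱ) (X := fun t ω => P.Φ (x t ω)) (ε := ε)
    (T := P.T) hρ hc (half_pos hζ) (fun t ht => P.measurable_Φ.comp (h.measurable_action t ht))
    h.measurable_noise h.integrable_exp h.subgaussian
  have hnoise := Params.IsRun.measure_noise_le P h hT hm hσX hσu hζ hζ1
  have hact : ∀ᵐ ω ∂μ, ∀ t, t < P.T →
      P.IsAction (t + 1) (P.serverState f x ε N n ω t) (D t ω) (x t ω) := by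
    refine ae_all_iff.2 fun t => ?_
    by_cases ht : t < P.T
    · filter_upwards [h.isAction t ht] with ω hω _ using hω
    · exact ae_of_all _ fun _ h' => absurd h' ht
  have hsplit : ENNReal.ofReal P.ζ = ENNReal.ofReal (P.ζ / 2) + ENNReal.ofReal (P.ζ / 2) := by
    rw [← ENNReal.ofReal_add (by positivity) (by positivity), add_halves]
  rw [hsplit]
  -- Almost surely every action is a maximiser, and then the bound can fail only with the privacy
  -- noise estimate or the self-normalised estimate, each of probability at most ζ/2.
  refine le_trans (measure_mono_ae ?_) ((measure_union_le _ _).trans (add_le_add hnoise hself))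
  filter_upwards [hact] with ω hω hbad
  by_contra hgood
  refine hbad ?_
  have hgood' : ω ∉ _ ∧ ω ∉ _ := not_or.1 hgood
  obtain ⟨hg1, hg2⟩ := hgood'
  simp only [Set.mem_ofPred_eq, not_exists, not_and, not_or, not_lt] at hg1 hg2
  have hlogdet := log_det_one_add_smul_gramSum_le P hd hk hp hm hρ (c := P.lam + P.lamMin)
    (by linarith) (fun s => x s ω) P.T
  refine (P.regret_le_of_good hm hσu hρ hB hlam hζ hζ1 hl hθ (by positivity) hfθ hω
    (fun t ht => (hg1 t ht).1) (fun t ht => (hg1 t ht).2) fun t ht => ?_).trans ?_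
  · have := hg2 t ht.le
    rw [one_div_div] at this
    exact this
  · have hw := P.width_nonneg hρ hB hσu
    gcongr

end HighProbability

end PrivateGP
end

noncomputable section
open MeasureTheory ProbabilityTheory
namespace PrivateGP

/-! ### Size of the confidence width -/

section Asymptotics

lemma half_le_log {T : ℕ} (hT : 2 ≤ T) : 1 / 2 ≤ Real.log T := by
  have h1 := Real.log_two_gt_d9
  have h2 : Real.log 2 ≤ Real.log T :=
    Real.log_le_log two_pos (by exact_mod_cast hT)
  linarith

/-- Size of the number of features. -/
lemma exists_feature_count_le (d : ℕ) : ∃ c : ℝ, 1 ≤ c ∧ ∀ T : ℕ, 2 ≤ T →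
    Real.log T * Real.sqrt (2 * (⌈6 * Real.log T⌉₊ : ℝ) ^ d) ≤
      c * Real.log T ^ (((d : ℝ) + 2) / 2) ∧
    2 * (⌈6 * Real.log T⌉₊ : ℝ) ^ d ≤ c * Real.sqrt T := by
  refine ⟨max 1 (max (Real.sqrt (2 * 8 ^ d)) (2 * 16 ^ d * d.factorial)), le_max_left _ _,
    fun T hT => ?_⟩
  have hτ := half_le_log hT
  set τ := Real.log T with hτd
  have hτ0 : 0 < τ := by linarith
  have hT0 : (0 : ℝ) < T := by
    have : 0 < T := by omega
    exact_mod_cast this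
  -- The ceiling adds less than 1 ≤ 2τ.
  have hceil : (⌈6 * τ⌉₊ : ℝ) ≤ 8 * τ := by
    have := Nat.ceil_lt_add_one (show 0 ≤ 6 * τ by positivity)
    linarith
  have hpow : (⌈6 * τ⌉₊ : ℝ) ^ d ≤ (8 * τ) ^ d := pow_le_pow_left₀ (Nat.cast_nonneg _) hceil d
  constructor
  · have h1 : Real.sqrt (2 * (⌈6 * τ⌉₊ : ℝ) ^ d) ≤ Real.sqrt (2 * 8 ^ d) * τ ^ ((d : ℝ) / 2) := by
      have e : τ ^ ((d : ℝ) / 2) = Real.sqrt (τ ^ d) := by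
        rw [Real.sqrt_eq_rpow, ← Real.rpow_natCast, ← Real.rpow_mul hτ0.le]
        congr 1
        ring
      rw [e, ← Real.sqrt_mul (by positivity)]
      refine Real.sqrt_le_sqrt ?_
      rw [mul_pow] at hpow
      linarith
    have h2 : τ * τ ^ ((d : ℝ) / 2) = τ ^ (((d : ℝ) + 2) / 2) := by
      rw [show ((d : ℝ) + 2) / 2 = 1 + (d : ℝ) / 2 by ring, Real.rpow_add hτ0, Real.rpow_one]
    calc _ ≤ τ * (Real.sqrt (2 * 8 ^ d) * τ ^ ((d : ℝ) / 2)) := by gcongr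
      _ = Real.sqrt (2 * 8 ^ d) * τ ^ (((d : ℝ) + 2) / 2) := by
          rw [← h2]
          ring
      _ ≤ _ := by
          gcongr
          exact (le_max_left _ _).trans (le_max_right _ _)
  · have h1 := Real.pow_div_factorial_le_exp (τ / 2) (by positivity) d
    have h2 : Real.exp (τ / 2) = Real.sqrt T := by
      rw [Real.exp_half, hτd, Real.exp_log hT0]
    rw [h2, div_le_iff₀ (by positivity)] at h1
    have h3 : (8 * τ) ^ d = 16 ^ d * (τ / 2) ^ d := by
      rw [← mul_pow]
      congr 1
      ring
    calc 2 * (⌈6 * τ⌉₊ : ℝ) ^ d ≤ 2 * (16 ^ d * (Real.sqrt T * d.factorial)) := by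
          rw [h3] at hpow
          have : (16 : ℝ) ^ d * (τ / 2) ^ d ≤ 16 ^ d * (Real.sqrt T * d.factorial) := by gcongr
          linarith
      _ = 2 * 16 ^ d * d.factorial * Real.sqrt T := by ring
      _ ≤ _ := by
          gcongr
          exact (le_max_right _ _).trans (le_max_right _ _)

/-- Source of the constant 6: the uniform error of f is the square root of the kernel error, hence
of order T⁻³, and the total misspecification is of order T² times that. -/
lemma exp_neg_ceil_le {T : ℕ} (hT : 2 ≤ T) :
    Real.exp (-(⌈6 * Real.log T⌉₊ : ℝ)) ≤ ((T : ℝ) ^ 6)⁻¹ := by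
  have hT0 : (0 : ℝ) < T := by
    have : 0 < T := by omega
    exact_mod_cast this
  have h1 : Real.exp (-(6 * Real.log T)) = ((T : ℝ) ^ 6)⁻¹ := by
    rw [Real.exp_neg, show (6 : ℝ) * Real.log T = ((6 : ℕ) : ℝ) * Real.log T by norm_num,
      Real.exp_nat_mul, Real.exp_log hT0]
  rw [← h1]
  exact Real.exp_le_exp.2 (neg_le_neg (Nat.le_ceil _))

/-- The constant in the bound for the approximation error declared by the algorithm. -/
def errorConst {d : ℕ} (ν : Fin d → ℝ) : ℝ :=
  d * 2 ^ (d - 1) * Real.sqrt (Real.pi / 2) *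
    Real.exp (Real.exp 1 * (Real.exp 1 / (4 * (⨅ j, ν j) ^ 2)))

lemma errorConst_nonneg {d : ℕ} (ν : Fin d → ℝ) : 0 ≤ errorConst ν := by
  rw [errorConst]
  positivity

lemma Params.approxError_le {d : ℕ} (P : Params d) :
    P.approxError ≤ errorConst P.ν * Real.exp (-P.mbar) := by
  set y := Real.exp 1 / (4 * (⨅ j, P.ν j) ^ 2) with hy
  have hy0 : 0 ≤ y := by positivity
  have h1 := pow_div_factorial_le_exp_mul hy0 P.mbar
  have h2 : 1 / (P.mbar : ℝ) ^ P.mbar * y ^ P.mbar ≤ y ^ P.mbar / P.mbar.factorial := by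
    rw [div_mul_eq_mul_div, one_mul]
    gcongr
    exact_mod_cast Nat.factorial_le_pow P.mbar
  rw [approxError, errorConst, ← hy, mul_assoc, mul_assoc _ (Real.exp _)]
  exact mul_le_mul_of_nonneg_left (h2.trans h1) (by positivity)

/-- The tuning of the noise levels, with the relations between the parameters that determine the
size of the confidence width. -/
structure IsTuned {d : ℕ} (P : Params d) (α₀ α β b₀ c : ℝ) : Prop where
  two_le : 2 ≤ P.T
  α_pos : 0 < α
  α_le : α ≤ α₀
  β_pos : 0 < β
  ζ_pos : 0 < P.ζ
  b₀_pos : 0 < b₀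
  le_log_β : b₀ ≤ Real.log (1 / β)
  le_log_ζ : b₀ ≤ Real.log (1 / P.ζ)
  B_nonneg : 0 ≤ P.B
  ρ_pos : 0 < P.ρ
  lam_pos : 0 < P.lam
  one_le : 1 ≤ c
  σX_eq : P.σX = 32 * (2 + α₀) * Real.log (5 / β) / α
  σu_pos : 0 < P.σu
  σu_sq : P.σu ^ 2 = 8 * (32 * (2 + α₀)) * (P.B ^ 2 + 2 * P.ρ ^ 2 * Real.log (8 * P.m / β)) *
    Real.log (5 / β) / α ^ 2
  sqrt_le : Real.log P.T * Real.sqrt (2 * P.m) ≤ c * Real.log P.T ^ (((d : ℝ) + 2) / 2)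
  m_le : 2 * (P.m : ℝ) ≤ c * Real.sqrt P.T

/-- The square of the rate of the confidence width. -/
def Params.rate {d : ℕ} (P : Params d) (α β : ℝ) : ℝ :=
  Real.sqrt P.T * Real.log P.T ^ (((d : ℝ) + 2) / 2) / α * Real.log (1 / β) * Real.log (1 / P.ζ)

namespace IsTuned

variable {d : ℕ} {P : Params d} {α₀ α β b₀ c : ℝ}

lemma log_pos (h : IsTuned P α₀ α β b₀ c) : 1 / 2 ≤ Real.log P.T := half_le_log h.two_le

lemma one_le_sqrt (h : IsTuned P α₀ α β b₀ c) : 1 ≤ Real.sqrt P.T :=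
  Real.one_le_sqrt.2 (by have := h.two_le; exact_mod_cast (by omega : 1 ≤ P.T))

lemma mbar_pos (h : IsTuned P α₀ α β b₀ c) : 0 < P.mbar := by
  rw [Params.mbar, Nat.ceil_pos]
  have := h.log_pos
  linarith

lemma one_le_m (h : IsTuned P α₀ α β b₀ c) : (1 : ℝ) ≤ P.m := by
  have : 0 < P.m := pow_pos h.mbar_pos d
  exact_mod_cast this

lemma one_le_sqrt_m (h : IsTuned P α₀ α β b₀ c) : 1 ≤ Real.sqrt (2 * P.m) :=
  Real.one_le_sqrt.2 (by linarith [h.one_le_m])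

lemma sqrt_m_le (h : IsTuned P α₀ α β b₀ c) :
    Real.sqrt (2 * P.m) ≤ 2 * c * Real.log P.T ^ (((d : ℝ) + 2) / 2) := by
  have h1 := h.sqrt_le
  have h2 := h.log_pos
  have h3 := h.one_le_sqrt_m
  nlinarith

lemma log_le (h : IsTuned P α₀ α β b₀ c) :
    Real.log P.T ≤ c * Real.log P.T ^ (((d : ℝ) + 2) / 2) := by
  have h1 := h.sqrt_le
  have h2 := h.log_pos
  have h3 := h.one_le_sqrt_m
  nlinarith

lemma rpow_pos (h : IsTuned P α₀ α β b₀ c) : 0 < Real.log P.T ^ (((d : ℝ) + 2) / 2) :=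
  Real.rpow_pos_of_pos (by linarith [h.log_pos]) _

lemma α₀_pos (h : IsTuned P α₀ α β b₀ c) : 0 < α₀ := h.α_pos.trans_le h.α_le

lemma rate_pos (h : IsTuned P α₀ α β b₀ c) : 0 < P.rate α β := by
  have h1 := h.one_le_sqrt
  have h2 := h.rpow_pos
  have h3 := h.b₀_pos.trans_le h.le_log_β
  have h4 := h.b₀_pos.trans_le h.le_log_ζ
  have h5 := h.α_pos
  rw [Params.rate]
  positivity

/-- Monotonicity used to compare the terms of the width with the rate. -/
lemma le_rate (h : IsTuned P α₀ α β b₀ c) {y : ℝ}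
    (hy : y ≤ Real.sqrt P.T * Real.log P.T ^ (((d : ℝ) + 2) / 2) * Real.log (1 / P.ζ)) :
    y ≤ α₀ / b₀ * P.rate α β := by
  refine hy.trans ?_
  have h1 := h.one_le_sqrt
  have h2 := h.rpow_pos
  have h4 := h.b₀_pos.trans_le h.le_log_ζ
  have h5 := h.α_pos
  have h6 := h.b₀_pos
  have hα : 1 ≤ α₀ / α := by
    rw [le_div_iff₀ h5]
    linarith [h.α_le]
  have hb : 1 ≤ Real.log (1 / β) / b₀ := by
    rw [le_div_iff₀ h6]
    linarith [h.le_log_β]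
  have hab : 1 ≤ α₀ / α * (Real.log (1 / β) / b₀) := one_le_mul_of_one_le_of_one_le hα hb
  set u := Real.sqrt P.T * Real.log P.T ^ (((d : ℝ) + 2) / 2) * Real.log (1 / P.ζ) with hu
  have hu0 : 0 ≤ u := by positivity
  have e : α₀ / b₀ * P.rate α β = u * (α₀ / α * (Real.log (1 / β) / b₀)) := by
    rw [hu, Params.rate]
    ring
  rw [e]
  nlinarith

/-- The remaining factors of the rate are bounded below, the power of log T through √(2m) ≥ 1 and
log(1/ζ) by b₀. Constants and terms of order √T are absorbed in this way. -/
lemma sqrt_le_rate (h : IsTuned P α₀ α β b₀ c) :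
    Real.sqrt P.T ≤ 2 * c / b₀ * (α₀ / b₀ * P.rate α β) := by
  have h0 := h.b₀_pos
  have hc := h.one_le
  have hp := h.rpow_pos
  have hs := h.one_le_sqrt
  have h1 : 1 ≤ 2 * c * Real.log P.T ^ (((d : ℝ) + 2) / 2) := h.one_le_sqrt_m.trans h.sqrt_m_le
  rw [← div_le_iff₀' (by positivity)]
  refine h.le_rate ?_
  rw [div_div_eq_mul_div, div_le_iff₀ (by positivity)]
  have h2 := h.le_log_ζ
  have h3 : b₀ * 1 ≤ Real.log (1 / P.ζ) * (2 * c * Real.log P.T ^ (((d : ℝ) + 2) / 2)) :=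
    mul_le_mul h2 h1 zero_le_one (by linarith)
  nlinarith

lemma one_le_rate (h : IsTuned P α₀ α β b₀ c) :
    1 ≤ 2 * c / b₀ * (α₀ / b₀ * P.rate α β) := h.one_le_sqrt.trans h.sqrt_le_rate

lemma log_five_div_le (h : IsTuned P α₀ α β b₀ c) :
    Real.log (5 / β) ≤ (1 + 2 / b₀) * Real.log (1 / β) := by
  have h0 := h.b₀_pos
  have h1 := h.le_log_β
  have h5 : Real.log 5 ≤ 2 := by
    rw [Real.log_le_iff_le_exp (by norm_num)]
    have h2 := Real.exp_one_gt_d9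
    rw [show (2 : ℝ) = 1 + 1 by norm_num, Real.exp_add]
    nlinarith
  have e : Real.log (5 / β) = Real.log 5 + Real.log (1 / β) := by
    rw [← Real.log_mul (by norm_num) (one_div_pos.2 h.β_pos).ne', mul_one_div]
  have h3 : 2 ≤ 2 / b₀ * Real.log (1 / β) := by
    rw [div_mul_eq_mul_div, le_div_iff₀ h0]
    linarith
  rw [e]
  linarith

lemma one_le_log_five_div (h : IsTuned P α₀ α β b₀ c) : 1 ≤ Real.log (5 / β) := by
  have h0 := h.b₀_pos
  have h1 := h.le_log_β
  have h5 : 1 ≤ Real.log 5 := by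
    rw [Real.le_log_iff_exp_le (by norm_num)]
    linarith [Real.exp_one_lt_d9]
  have e : Real.log (5 / β) = Real.log 5 + Real.log (1 / β) := by
    rw [← Real.log_mul (by norm_num) (one_div_pos.2 h.β_pos).ne', mul_one_div]
  rw [e]
  linarith

lemma log_two_mul_div_eq (h : IsTuned P α₀ α β b₀ c) :
    Real.log (2 * P.T / P.ζ) = Real.log 2 + Real.log P.T + Real.log (1 / P.ζ) := by
  have hT : (0 : ℝ) < P.T := by
    have := h.two_le
    exact_mod_cast (by omega : 0 < P.T)
  rw [← Real.log_mul two_ne_zero hT.ne', ← Real.log_mul (by positivity)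
    (one_div_pos.2 h.ζ_pos).ne', mul_one_div]

lemma log_two_mul_div_le (h : IsTuned P α₀ α β b₀ c) :
    Real.log (2 * P.T / P.ζ) ≤ (3 / b₀ + 2) * (Real.log P.T * Real.log (1 / P.ζ)) := by
  have h0 := h.b₀_pos
  have h1 := h.le_log_ζ
  have h2 := h.log_pos
  have h3 := Real.log_two_lt_d9
  rw [h.log_two_mul_div_eq]
  have h4 : 3 * Real.log P.T ≤ 3 / b₀ * (Real.log P.T * Real.log (1 / P.ζ)) := by
    rw [div_mul_eq_mul_div, le_div_iff₀ h0]
    have := mul_le_mul_of_nonneg_left h1 (show 0 ≤ 3 * Real.log P.T by linarith)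
    linarith
  nlinarith

lemma log_two_mul_div_nonneg (h : IsTuned P α₀ α β b₀ c) : 0 ≤ Real.log (2 * P.T / P.ζ) := by
  rw [h.log_two_mul_div_eq]
  have h2 := h.log_pos
  have h3 := Real.log_two_gt_d9
  linarith [h.b₀_pos, h.le_log_ζ]

lemma log_two_mul_div_le' (h : IsTuned P α₀ α β b₀ c) :
    Real.log (2 * P.T / P.ζ) ≤
      (3 / b₀ + 2) * c * (Real.log P.T ^ (((d : ℝ) + 2) / 2) * Real.log (1 / P.ζ)) := by
  have h0 := h.b₀_pos
  refine h.log_two_mul_div_le.trans ?_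
  rw [mul_assoc]
  refine mul_le_mul_of_nonneg_left ?_ (by positivity)
  have := mul_le_mul_of_nonneg_right h.log_le (h.b₀_pos.le.trans h.le_log_ζ)
  linarith

lemma one_le_σX (h : IsTuned P α₀ α β b₀ c) : 1 ≤ P.σX := by
  rw [h.σX_eq, le_div_iff₀ h.α_pos, one_mul]
  have h1 := h.one_le_log_five_div
  have h2 := h.α₀_pos
  have h3 := h.α_le
  nlinarith

lemma sqrt_le_lamMin (h : IsTuned P α₀ α β b₀ c) : Real.sqrt P.T ≤ P.lamMin := by
  rw [Params.lamMin, Params.Lam]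
  have h1 := h.one_le_σX
  have h2 := h.one_le_sqrt
  have h3 := h.one_le_sqrt_m
  have h4 := h.log_two_mul_div_nonneg
  have h5 : 1 ≤ P.σX * (4 * Real.sqrt (2 * P.m) + 2 * Real.log (2 * P.T / P.ζ)) :=
    one_le_mul_of_one_le_of_one_le h1 (by linarith)
  calc Real.sqrt P.T = Real.sqrt P.T * 1 := (mul_one _).symm
    _ ≤ Real.sqrt P.T *
        (P.σX * (4 * Real.sqrt (2 * P.m) + 2 * Real.log (2 * P.T / P.ζ))) := by gcongr
    _ = _ := by ring

lemma lamMax_le (h : IsTuned P α₀ α β b₀ c) :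
    P.lamMax ≤ 3 * (32 * (2 + α₀)) * (1 + 2 / b₀) * (8 * c / b₀ + 2 * (3 / b₀ + 2) * c) *
      P.rate α β := by
  have h0 := h.b₀_pos
  have hα := h.α_pos
  have hα₀ := h.α₀_pos
  have hp := h.rpow_pos
  have hc := h.one_le
  set p := Real.log P.T ^ (((d : ℝ) + 2) / 2) with hpd
  set z := Real.log (1 / P.ζ) with hz
  have hz0 : b₀ ≤ z := h.le_log_ζ
  have h1 : 4 * Real.sqrt (2 * P.m) + 2 * Real.log (2 * P.T / P.ζ) ≤
      (8 * c / b₀ + 2 * (3 / b₀ + 2) * c) * (p * z) := by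
    have h2 := h.log_two_mul_div_le'
    have h3 : 4 * Real.sqrt (2 * P.m) ≤ 8 * c / b₀ * (p * z) := by
      rw [div_mul_eq_mul_div, le_div_iff₀ h0]
      have h4 := h.sqrt_m_le
      have h5 : Real.sqrt (2 * P.m) * b₀ ≤ 2 * c * p * z :=
        mul_le_mul h4 hz0 h0.le (by positivity)
      linarith
    rw [add_mul]
    linarith
  have h6 := h.log_five_div_le
  have hb : 0 < Real.log (1 / β) := h0.trans_le h.le_log_β
  have hz1 : 0 < z := h0.trans_le hz0
  have hl5 := h.one_le_log_five_div
  rw [Params.lamMax, Params.Lam, h.σX_eq]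
  calc _ = 3 * (32 * (2 + α₀)) / α * Real.sqrt P.T * (Real.log (5 / β) *
        (4 * Real.sqrt (2 * P.m) + 2 * Real.log (2 * P.T / P.ζ))) := by ring
    _ ≤ 3 * (32 * (2 + α₀)) / α * Real.sqrt P.T * (((1 + 2 / b₀) * Real.log (1 / β)) *
        ((8 * c / b₀ + 2 * (3 / b₀ + 2) * c) * (p * z))) := by
        refine mul_le_mul_of_nonneg_left ?_ (by positivity)
        refine mul_le_mul h6 h1 ?_ (by positivity)
        have := h.log_two_mul_div_nonneg
        positivity
    _ = _ := by
        rw [Params.rate, ← hpd, ← hz]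
        ring

/-- As m is at most a multiple of √T, log m is of order log T; the lower bounds for log T and
log(1/β) turn the sum of logarithms into a product. -/
lemma log_eight_le (h : IsTuned P α₀ α β b₀ c) :
    Real.log (8 * P.m / β) ≤ ((8 * c + 1) / b₀ + 2) * (Real.log P.T * Real.log (1 / β)) := by
  have h0 := h.b₀_pos
  have h1 := h.le_log_β
  have h2 := h.log_pos
  have hm := h.one_le_m
  have hc := h.one_le
  have hs := h.one_le_sqrt
  have hT : (0 : ℝ) < P.T := by
    have := h.two_le
    exact_mod_cast (by omega : 0 < P.T)
  have e : Real.log (8 * P.m / β) = Real.log (8 * P.m) + Real.log (1 / β) := by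
    rw [← Real.log_mul (by positivity) (one_div_pos.2 h.β_pos).ne', mul_one_div]
  have h3 : Real.log (8 * P.m) ≤ (8 * c + 1) * Real.log P.T := by
    have h4 : (8 : ℝ) * P.m ≤ 4 * c * Real.sqrt P.T := by linarith [h.m_le]
    have h5 := Real.log_le_log (by positivity) h4
    rw [Real.log_mul (x := 4 * c) (by positivity) (by positivity), Real.log_sqrt hT.le] at h5
    have h6 := Real.log_le_self (show 0 ≤ 4 * c by positivity)
    nlinarith
  have h7 : (8 * c + 1) * Real.log P.T ≤
      (8 * c + 1) / b₀ * (Real.log P.T * Real.log (1 / β)) := by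
    rw [div_mul_eq_mul_div, le_div_iff₀ h0]
    have := mul_le_mul_of_nonneg_left h1
      (show 0 ≤ (8 * c + 1) * Real.log P.T by positivity)
    linarith
  rw [e]
  nlinarith

lemma log_eight_nonneg (h : IsTuned P α₀ α β b₀ c) : 0 ≤ Real.log (8 * P.m / β) := by
  have h0 := h.b₀_pos
  have h1 := h.le_log_β
  have hm := h.one_le_m
  have e : Real.log (8 * P.m / β) = Real.log (8 * P.m) + Real.log (1 / β) := by
    rw [← Real.log_mul (by positivity) (one_div_pos.2 h.β_pos).ne', mul_one_div]
  have h2 : 0 ≤ Real.log (8 * P.m) := Real.log_nonneg (by linarith)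
  rw [e]
  linarith

lemma moment_le (h : IsTuned P α₀ α β b₀ c) :
    P.B ^ 2 + 2 * P.ρ ^ 2 * Real.log (8 * P.m / β) ≤
      (2 * P.B ^ 2 / b₀ + 2 * P.ρ ^ 2 * ((8 * c + 1) / b₀ + 2)) *
        (Real.log P.T * Real.log (1 / β)) := by
  have h0 := h.b₀_pos
  have h1 := h.le_log_β
  have h2 := h.log_pos
  have h3 := mul_le_mul_of_nonneg_left h.log_eight_le (show 0 ≤ 2 * P.ρ ^ 2 by positivity)
  have h4 : P.B ^ 2 ≤ 2 * P.B ^ 2 / b₀ * (Real.log P.T * Real.log (1 / β)) := by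
    rw [div_mul_eq_mul_div, le_div_iff₀ h0]
    have h5 : 1 / 2 * b₀ ≤ Real.log P.T * Real.log (1 / β) :=
      mul_le_mul h2 h1 h0.le (by linarith)
    nlinarith [sq_nonneg P.B]
  rw [add_mul]
  linarith

/-- The tuning makes σ_u²/σ_X = 8M/α, with no log(1/β) outside M. The normalisation by λ_min reduces
the rest to at most 4√T·√(2m). One factor log T from M and √(2m) together give the power (d+2)/2. -/
lemma κ_sq_le (h : IsTuned P α₀ α β b₀ c) :
    P.κ ^ 2 ≤ 32 * (2 * P.B ^ 2 / b₀ + 2 * P.ρ ^ 2 * ((8 * c + 1) / b₀ + 2)) * c / b₀ *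
      P.rate α β := by
  have h0 := h.b₀_pos
  have hα := h.α_pos
  have hα₀ := h.α₀_pos
  have hp := h.rpow_pos
  have hc := h.one_le
  have hτ := h.log_pos
  have hb : 0 < Real.log (1 / β) := h0.trans_le h.le_log_β
  have hz := h.le_log_ζ
  have hl5 := h.one_le_log_five_div
  have hw := h.one_le_sqrt_m
  have hL := h.log_two_mul_div_nonneg
  have hσX := h.one_le_σX
  have hs := h.one_le_sqrt
  have hm := h.one_le_m
  have hM := h.moment_le
  set M := P.B ^ 2 + 2 * P.ρ ^ 2 * Real.log (8 * P.m / β) with hMd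
  set c₄ := 2 * P.B ^ 2 / b₀ + 2 * P.ρ ^ 2 * ((8 * c + 1) / b₀ + 2) with hc₄
  have hc₄0 : 0 ≤ c₄ := by positivity
  set p := Real.log P.T ^ (((d : ℝ) + 2) / 2) with hpd
  set z := Real.log (1 / P.ζ) with hzd
  set w := Real.sqrt (2 * P.m) with hwd
  set L := Real.log (2 * P.T / P.ζ) with hLd
  set s := Real.sqrt P.T with hsd
  have hss : s ^ 2 = P.T := Real.sq_sqrt (Nat.cast_nonneg _)
  have hww : w ^ 2 = 2 * P.m := Real.sq_sqrt (by positivity)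
  have hM0 : 0 ≤ M := by
    have := h.log_eight_nonneg
    positivity
  have hratio : P.σu ^ 2 / P.σX = 8 * M / α := by
    rw [h.σu_sq, h.σX_eq, ← hMd]
    field_simp
  have hlm : P.lamMin = P.σX * (s * (4 * w + 2 * L)) := rfl
  have hden : 0 < 4 * w + 2 * L := by linarith
  have h1 : P.κ ^ 2 = P.σu ^ 2 / P.σX * s * ((w + Real.sqrt (2 * L)) ^ 2 / (4 * w + 2 * L)) := by
    rw [Params.κ, ← hLd, ← hwd, mul_pow, mul_pow, Real.sq_sqrt (by rw [hlm]; positivity), hlm,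
      ← hss]
    field_simp
  have h2 : (w + Real.sqrt (2 * L)) ^ 2 / (4 * w + 2 * L) ≤ 4 * w := by
    rw [div_le_iff₀ hden]
    have h3 : Real.sqrt (2 * L) ^ 2 = 2 * L := Real.sq_sqrt (by positivity)
    nlinarith [sq_nonneg (w - Real.sqrt (2 * L)), mul_nonneg hL (sub_nonneg.2 hw)]
  rw [h1, hratio]
  calc 8 * M / α * s * ((w + Real.sqrt (2 * L)) ^ 2 / (4 * w + 2 * L))
      ≤ 8 * M / α * s * (4 * w) := by
        refine mul_le_mul_of_nonneg_left h2 (by positivity)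
    _ = 32 / α * s * (M * w) := by ring
    _ ≤ 32 / α * s * (c₄ * (Real.log P.T * Real.log (1 / β)) * w) := by gcongr
    _ = 32 / α * s * c₄ * Real.log (1 / β) * (Real.log P.T * w) := by ring
    _ ≤ 32 / α * s * c₄ * Real.log (1 / β) * (c * p) :=
        mul_le_mul_of_nonneg_left h.sqrt_le (by positivity)
    _ = 32 / α * s * c₄ * Real.log (1 / β) * (c * p) / b₀ * b₀ := by field_simp
    _ ≤ 32 / α * s * c₄ * Real.log (1 / β) * (c * p) / b₀ * z :=
        mul_le_mul_of_nonneg_left hz (by positivity)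
    _ = _ := by
        rw [Params.rate, ← hpd, ← hzd, ← hsd]
        ring

lemma declared_error_sq_le (h : IsTuned P α₀ α β b₀ c) :
    (P.T * P.B * P.approxError / Real.sqrt P.lamMin) ^ 2 ≤ (P.B * errorConst P.ν) ^ 2 := by
  have hT : (1 : ℝ) ≤ P.T := by
    have := h.two_le
    exact_mod_cast (by omega : 1 ≤ P.T)
  have hB := h.B_nonneg
  have hE := errorConst_nonneg P.ν
  have happ := P.approxError_nonneg
  have hl : 1 ≤ Real.sqrt P.lamMin := Real.one_le_sqrt.2 (h.one_le_sqrt.trans h.sqrt_le_lamMin)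
  have h1 : P.T * P.approxError ≤ errorConst P.ν := by
    have h2 := P.approxError_le
    have h3 : Real.exp (-P.mbar) ≤ ((P.T : ℝ) ^ 6)⁻¹ := exp_neg_ceil_le h.two_le
    have h4 : (P.T : ℝ) * ((P.T : ℝ) ^ 6)⁻¹ ≤ 1 := by
      rw [mul_inv_le_iff₀ (by positivity), one_mul]
      exact le_self_pow₀ hT (by norm_num)
    calc P.T * P.approxError ≤ P.T * (errorConst P.ν * ((P.T : ℝ) ^ 6)⁻¹) := by
          refine mul_le_mul_of_nonneg_left (h2.trans ?_) (by positivity)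
          exact mul_le_mul_of_nonneg_left h3 hE
      _ = errorConst P.ν * (P.T * ((P.T : ℝ) ^ 6)⁻¹) := by ring
      _ ≤ errorConst P.ν * 1 := mul_le_mul_of_nonneg_left h4 hE
      _ = _ := mul_one _
  refine pow_le_pow_left₀ (by positivity) ?_ 2
  refine (div_le_self (by positivity) hl).trans ?_
  have := mul_le_mul_of_nonneg_left h1 hB
  linarith

/-- The confidence width is of the order of the rate. -/
lemma exists_width_sq_le {d : ℕ} (ν : Fin d → ℝ) (B ρ lam α₀ b₀ c : ℝ) :
    ∃ C : ℝ, ∀ (P : Params d) (α β : ℝ), IsTuned P α₀ α β b₀ c → P.ν = ν → P.B = B → P.ρ = ρ →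
      P.lam = lam → P.width ^ 2 ≤ C * P.rate α β := by
  set C₁ := 3 * (32 * (2 + α₀)) * (1 + 2 / b₀) * (8 * c / b₀ + 2 * (3 / b₀ + 2) * c) with hC₁
  set C₀ := 2 * c / b₀ * (α₀ / b₀) with hC₀
  set C₃ := 32 * (2 * B ^ 2 / b₀ + 2 * ρ ^ 2 * ((8 * c + 1) / b₀ + 2)) * c / b₀ with hC₃
  set C₄ := C₀ + 2 * c * C₀ + 2 * ((3 / b₀ + 2) * c) * (α₀ / b₀) with hC₄
  refine ⟨4 * (B ^ 2 * (C₁ + lam * C₀) + (B * errorConst ν) ^ 2 * C₀ + C₃ + ρ ^ 2 * C₄), ?_⟩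
  rintro P α β h rfl rfl rfl rfl
  have h0 := h.b₀_pos
  have hc := h.one_le
  have hα₀ := h.α₀_pos
  have hR := h.rate_pos
  set R := P.rate α β with hRd
  have hlam := h.lam_pos
  have hone : 1 ≤ C₀ * R := by
    have := h.one_le_rate
    rw [← mul_assoc] at this
    exact this
  have hs : Real.sqrt P.T ≤ C₀ * R := by
    have := h.sqrt_le_rate
    rw [← mul_assoc] at this
    exact this
  have hs1 := h.one_le_sqrt
  have hlm := h.sqrt_le_lamMin
  have hlm0 : 0 < P.lamMin := by linarith
  have hmax0 : 0 ≤ P.lamMax := by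
    have : P.lamMax = 3 * P.lamMin := by
      rw [Params.lamMax, Params.lamMin]
      ring
    rw [this]
    positivity
  have t1 : (P.B * Real.sqrt (P.lamMax + P.lam)) ^ 2 ≤ P.B ^ 2 * (C₁ + P.lam * C₀) * R := by
    rw [mul_pow, Real.sq_sqrt (by positivity), mul_assoc]
    refine mul_le_mul_of_nonneg_left ?_ (sq_nonneg _)
    have h1 := h.lamMax_le
    have h2 := mul_le_mul_of_nonneg_left hone hlam.le
    rw [add_mul]
    linarith
  have t2 : (P.T * P.B * P.approxError / Real.sqrt P.lamMin) ^ 2 ≤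
      (P.B * errorConst P.ν) ^ 2 * C₀ * R := by
    refine h.declared_error_sq_le.trans ?_
    have := mul_le_mul_of_nonneg_left hone (sq_nonneg (P.B * errorConst P.ν))
    linarith
  have t3 : P.κ ^ 2 ≤ C₃ * R := h.κ_sq_le
  have hζlog : 0 ≤ Real.log (2 / P.ζ) := by
    rw [← mul_one_div, Real.log_mul two_ne_zero (one_div_pos.2 h.ζ_pos).ne']
    have := Real.log_two_gt_d9
    linarith [h.le_log_ζ]
  have t4 : (P.ρ * Real.sqrt (P.T / P.lamMin + 2 * (2 * P.m) + 2 * Real.log (2 / P.ζ))) ^ 2 ≤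
      P.ρ ^ 2 * C₄ * R := by
    rw [mul_pow, Real.sq_sqrt (by positivity), mul_assoc]
    refine mul_le_mul_of_nonneg_left ?_ (sq_nonneg _)
    have h1 : (P.T : ℝ) / P.lamMin ≤ C₀ * R := by
      refine le_trans ?_ hs
      rw [div_le_iff₀ hlm0]
      calc (P.T : ℝ) = Real.sqrt P.T * Real.sqrt P.T := (Real.mul_self_sqrt (Nat.cast_nonneg _)).symm
        _ ≤ _ := by gcongr
    have h2 : 2 * (2 * (P.m : ℝ)) ≤ 2 * c * (C₀ * R) := by
      have h3 := h.m_le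
      have h4 := mul_le_mul_of_nonneg_left hs (show 0 ≤ 2 * c by positivity)
      linarith
    have h5 : Real.log (2 / P.ζ) ≤ (3 / b₀ + 2) * c * (α₀ / b₀ * R) := by
      have h6 : Real.log (2 / P.ζ) ≤ Real.log (2 * P.T / P.ζ) := by
        rw [h.log_two_mul_div_eq, ← mul_one_div,
          Real.log_mul two_ne_zero (one_div_pos.2 h.ζ_pos).ne']
        linarith [h.log_pos]
      refine (h6.trans h.log_two_mul_div_le').trans ?_
      refine mul_le_mul_of_nonneg_left ?_ (by positivity)
      refine h.le_rate ?_
      have h7 := mul_nonneg h.rpow_pos.le (h0.le.trans h.le_log_ζ)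
      nlinarith
    rw [hC₄, add_mul, add_mul]
    linarith
  rw [Params.width]
  set w₁ := P.B * Real.sqrt (P.lamMax + P.lam)
  set w₂ := P.T * P.B * P.approxError / Real.sqrt P.lamMin
  set w₃ := P.κ
  set w₄ := P.ρ * Real.sqrt (P.T / P.lamMin + 2 * (2 * P.m) + 2 * Real.log (2 / P.ζ))
  have hsum : (w₁ + w₂ + w₃ + w₄) ^ 2 ≤ 4 * (w₁ ^ 2 + w₂ ^ 2 + w₃ ^ 2 + w₄ ^ 2) := by
    nlinarith [sq_nonneg (w₁ - w₂), sq_nonneg (w₁ - w₃), sq_nonneg (w₁ - w₄), sq_nonneg (w₂ - w₃),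
      sq_nonneg (w₂ - w₄), sq_nonneg (w₃ - w₄)]
  refine hsum.trans ?_
  linarith

end IsTuned

end Asymptotics

end PrivateGP
end

noncomputable section
open MeasureTheory ProbabilityTheory
namespace PrivateGP

/-! ### The regret rate -/

section Rate

lemma sqrt_mul_sqrt_rate_mul_eq {d : ℕ} {P : Params d} {α₀ α β b₀ c : ℝ}
    (h : IsTuned P α₀ α β b₀ c) (γ : ℝ) :
    Real.sqrt P.T * Real.sqrt (P.rate α β * γ) =
      (P.T : ℝ) ^ (3 / 4 : ℝ) * Real.log P.T ^ (((d : ℝ) + 2) / 4) *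
        Real.sqrt (γ / α * Real.log (1 / β) * Real.log (1 / P.ζ)) := by
  have hT : (0 : ℝ) ≤ P.T := Nat.cast_nonneg _
  have hT0 : (0 : ℝ) < P.T := by
    have := h.two_le
    exact_mod_cast (by omega : 0 < P.T)
  have hτ : 0 < Real.log P.T := by linarith [h.log_pos]
  have e : P.rate α β * γ = Real.sqrt P.T * (Real.log P.T ^ (((d : ℝ) + 2) / 2) *
      (γ / α * Real.log (1 / β) * Real.log (1 / P.ζ))) := by
    rw [Params.rate]
    ring
  have e1 : Real.sqrt (Real.log P.T ^ (((d : ℝ) + 2) / 2)) =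
      Real.log P.T ^ (((d : ℝ) + 2) / 4) := by
    rw [Real.sqrt_eq_rpow, ← Real.rpow_mul hτ.le]
    congr 1
    ring
  have e2 : Real.sqrt P.T * Real.sqrt (Real.sqrt P.T) = (P.T : ℝ) ^ (3 / 4 : ℝ) := by
    rw [Real.sqrt_eq_rpow, Real.sqrt_eq_rpow, ← Real.rpow_mul hT, ← Real.rpow_add hT0]
    norm_num
  rw [e, Real.sqrt_mul (Real.sqrt_nonneg _), Real.sqrt_mul (Real.rpow_nonneg hτ.le _), e1, ← e2]
  ring

/-- The explicit regret bound is of the order of the rate. -/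
lemma exists_regret_bound_le {d : ℕ} (hd : 0 < d) {ν : Fin d → ℝ}
    {k : (Fin d → ℝ) → (Fin d → ℝ) → ℝ} {p : Fin d → Measure ℝ} (hk : IsDecomposable k p)
    (hp : ∀ j, p j = gaussianReal 0 (1 / (ν j) ^ 2).toNNReal) {B ρ : ℝ} (hB : 0 ≤ B) (hρ : 0 < ρ)
    (lam α₀ b₀ c : ℝ) :
    ∃ C : ℝ, 0 < C ∧ ∀ (P : Params d) (α β : ℝ), IsTuned P α₀ α β b₀ c → P.ν = ν → P.B = B →
      P.ρ = ρ → P.lam = lam →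
      2 * P.width * (Real.sqrt P.T * Real.sqrt (2 *
        (P.T ^ 2 * (featureConst P.ν * Real.exp (-P.mbar)) +
          2 * (1 + P.ρ ^ 2) * maxInfoGain k P.ρ P.T))) +
        2 * P.T * (P.B * Real.sqrt (featureConst P.ν * Real.exp (-P.mbar)) * (P.T + 1)) ≤
      C * ((P.T : ℝ) ^ (3 / 4 : ℝ) * Real.log P.T ^ (((d : ℝ) + 2) / 4) *
        Real.sqrt (maxInfoGain k ρ P.T / α * Real.log (1 / β) * Real.log (1 / P.ζ))) := by
  obtain ⟨C₁, hC₁⟩ := IsTuned.exists_width_sq_le ν B ρ lam α₀ b₀ c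
  -- A lower bound for γ_T that depends only on ρ, since T ≥ 2. The approximation errors are
  -- absorbed into multiples of γ_T/γ₀.
  set γ₀ := Real.log (1 + (ρ ^ 2)⁻¹ * 2) / 2 with hγ₀
  have hγ₀pos : 0 < γ₀ := by
    refine div_pos (Real.log_pos ?_) two_pos
    have : 0 < (ρ ^ 2)⁻¹ * 2 := by positivity
    linarith
  set F := featureConst ν with hF
  have hF0 : 0 ≤ F := featureConst_nonneg ν
  set C₂ := 2 * (F / γ₀ + 2 * (1 + ρ ^ 2)) with hC₂
  have hC₂0 : 0 ≤ C₂ := by positivity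
  set C₀ := 2 * c / b₀ * (α₀ / b₀) with hC₀
  refine ⟨2 * Real.sqrt (C₁ * C₂) + 4 * B * Real.sqrt F * Real.sqrt (C₀ / γ₀) + 1,
    by positivity, ?_⟩
  rintro P α β h rfl rfl rfl rfl
  have hR := h.rate_pos
  have hW := hC₁ P α β h rfl rfl rfl rfl
  rw [← sqrt_mul_sqrt_rate_mul_eq h]
  set R := P.rate α β with hRd
  set γ := maxInfoGain k P.ρ P.T with hγ
  have hT2 : (2 : ℝ) ≤ P.T := by exact_mod_cast h.two_le
  have hT0 : (0 : ℝ) < P.T := by linarith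
  have hγγ : γ₀ ≤ γ := by
    refine le_trans ?_ (log_le_maxInfoGain hd hk hp hρ P.T)
    rw [hγ₀]
    gcongr
  have hγpos : 0 < γ := hγ₀pos.trans_le hγγ
  have hexp : Real.exp (-P.mbar) ≤ ((P.T : ℝ) ^ 6)⁻¹ := exp_neg_ceil_le h.two_le
  have hone : 1 ≤ C₀ * R := by
    have := h.one_le_rate
    rw [← mul_assoc] at this
    exact this
  have hs1 := h.one_le_sqrt
  have hTpow : ∀ j : ℕ, j ≤ 6 → (P.T : ℝ) ^ j * ((P.T : ℝ) ^ 6)⁻¹ ≤ 1 := by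
    intro j hj
    rw [mul_inv_le_iff₀ (by positivity), one_mul]
    exact pow_le_pow_right₀ (by linarith) hj
  have h1 : 2 * (P.T ^ 2 * (F * Real.exp (-P.mbar)) + 2 * (1 + P.ρ ^ 2) * γ) ≤ C₂ * γ := by
    have h2 : (P.T : ℝ) ^ 2 * (F * Real.exp (-P.mbar)) ≤ F := by
      calc (P.T : ℝ) ^ 2 * (F * Real.exp (-P.mbar)) ≤ P.T ^ 2 * (F * ((P.T : ℝ) ^ 6)⁻¹) := by gcongr
        _ = F * (P.T ^ 2 * ((P.T : ℝ) ^ 6)⁻¹) := by ring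
        _ ≤ F * 1 := mul_le_mul_of_nonneg_left (hTpow 2 (by norm_num)) hF0
        _ = F := mul_one F
    have h3 : F ≤ F / γ₀ * γ := by
      rw [div_mul_eq_mul_div, le_div_iff₀ hγ₀pos]
      exact mul_le_mul_of_nonneg_left hγγ hF0
    rw [hC₂]
    linarith
  have hw0 := P.width_nonneg h.ρ_pos hB h.σu_pos
  have h4 : P.width * Real.sqrt (2 * (P.T ^ 2 * (F * Real.exp (-P.mbar)) +
      2 * (1 + P.ρ ^ 2) * γ)) ≤ Real.sqrt (C₁ * C₂) * Real.sqrt (R * γ) := by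
    have hw : P.width ≤ Real.sqrt (C₁ * R) := Real.le_sqrt_of_sq_le hW
    have hC₁R : 0 ≤ C₁ * R := (sq_nonneg _).trans hW
    -- The sign of C₁ follows from 0 ≤ width² ≤ C₁R and R > 0.
    have hC₁0 : 0 ≤ C₁ := nonneg_of_mul_nonneg_left hC₁R hR
    calc _ ≤ Real.sqrt (C₁ * R) * Real.sqrt (C₂ * γ) :=
          mul_le_mul hw (Real.sqrt_le_sqrt h1) (Real.sqrt_nonneg _) (Real.sqrt_nonneg _)
      _ = _ := by
          rw [← Real.sqrt_mul hC₁R, ← Real.sqrt_mul (mul_nonneg hC₁0 hC₂0)]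
          congr 1
          ring
  have h5 : 2 * P.T * (P.B * Real.sqrt (F * Real.exp (-P.mbar)) * (P.T + 1)) ≤
      4 * P.B * Real.sqrt F := by
    have h6 : Real.sqrt (F * Real.exp (-P.mbar)) ≤ Real.sqrt F * ((P.T : ℝ) ^ 3)⁻¹ := by
      rw [Real.sqrt_mul hF0]
      refine mul_le_mul_of_nonneg_left ?_ (Real.sqrt_nonneg _)
      refine Real.sqrt_le_iff.2 ⟨by positivity, hexp.trans (le_of_eq ?_)⟩
      rw [inv_pow, ← pow_mul]
    have h7 : (P.T : ℝ) * (P.T + 1) * ((P.T : ℝ) ^ 3)⁻¹ ≤ 2 := by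
      rw [mul_inv_le_iff₀ (by positivity)]
      nlinarith [sq_nonneg ((P.T : ℝ) - 2), mul_pos hT0 hT0]
    calc 2 * P.T * (P.B * Real.sqrt (F * Real.exp (-P.mbar)) * (P.T + 1))
        ≤ 2 * P.T * (P.B * (Real.sqrt F * ((P.T : ℝ) ^ 3)⁻¹) * (P.T + 1)) := by gcongr
      _ = 2 * P.B * Real.sqrt F * (P.T * (P.T + 1) * ((P.T : ℝ) ^ 3)⁻¹) := by ring
      _ ≤ 2 * P.B * Real.sqrt F * 2 := mul_le_mul_of_nonneg_left h7 (by positivity)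
      _ = _ := by ring
  have h8 : 1 ≤ Real.sqrt (C₀ / γ₀) * (Real.sqrt P.T * Real.sqrt (R * γ)) := by
    have h9 : 1 ≤ Real.sqrt (C₀ / γ₀) * Real.sqrt (R * γ) := by
      rw [← Real.sqrt_mul' _ (by positivity)]
      refine Real.one_le_sqrt.2 ?_
      have e : C₀ / γ₀ * (R * γ) = C₀ * R * (γ / γ₀) := by ring
      rw [e]
      exact one_le_mul_of_one_le_of_one_le hone ((one_le_div hγ₀pos).2 hγγ)
    calc (1 : ℝ) ≤ Real.sqrt P.T * (Real.sqrt (C₀ / γ₀) * Real.sqrt (R * γ)) :=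
          one_le_mul_of_one_le_of_one_le hs1 h9
      _ = _ := by ring
  set Z := Real.sqrt P.T * Real.sqrt (R * γ) with hZ
  have hZ0 : 0 ≤ Z := by positivity
  calc _ = 2 * Real.sqrt P.T * (P.width * Real.sqrt (2 * (P.T ^ 2 * (F * Real.exp (-P.mbar)) +
      2 * (1 + P.ρ ^ 2) * γ))) +
        2 * P.T * (P.B * Real.sqrt (F * Real.exp (-P.mbar)) * (P.T + 1)) := by ring
    _ ≤ 2 * Real.sqrt P.T * (Real.sqrt (C₁ * C₂) * Real.sqrt (R * γ)) +
        4 * P.B * Real.sqrt F * (Real.sqrt (C₀ / γ₀) * Z) := by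
        refine add_le_add (mul_le_mul_of_nonneg_left h4 (by positivity)) (h5.trans ?_)
        exact le_mul_of_one_le_right (by positivity) h8
    _ = (2 * Real.sqrt (C₁ * C₂) + 4 * P.B * Real.sqrt F * Real.sqrt (C₀ / γ₀)) * Z := by
        rw [hZ]
        ring
    _ ≤ _ := by
        rw [add_mul _ 1 Z]
        linarith

end Rate

end PrivateGP
end

/-! ### The main theorem: choice of the noise levels -/

open MeasureTheory ProbabilityTheory PrivateGP in
theorem mainTheorem4 {d : ℕ} (hd : 0 < d)
    (ν : Fin d → ℝ) (hν : ∀ j, 0 < ν j)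
    (k : (Fin d → ℝ) → (Fin d → ℝ) → ℝ) (p : Fin d → Measure ℝ)
    (hk : IsDecomposable k p)
    (hp : ∀ j, p j = gaussianReal 0 (1 / (ν j) ^ 2).toNNReal)
    {H : Type*} [NormedAddCommGroup H] [InnerProductSpace ℝ H] [CompleteSpace H]
    [RKHS ℝ H (Cube d) ℝ] (hH : ∀ x y : Cube d, RKHS.kernel H x y 1 = k x y)
    (B ρ lam : ℝ) (hB : 0 ≤ B) (hρ : 0 < ρ) (hlam : 0 < lam)
    (α₀ q : ℝ) (hα₀ : 0 < α₀) (hq : q < 1) :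
    ∃ C : ℝ, 0 < C ∧
      ∀ (T : ℕ) (α β ζ : ℝ), 2 ≤ T → 0 < α → α ≤ α₀ → 0 < β → β ≤ q → 0 < ζ → ζ ≤ q →
      ∃ σX σu : ℝ, 0 < σX ∧ 0 < σu ∧
        let P : Params d := ⟨T, ν, B, ρ, lam, ζ, σX, σu⟩
        8 / α ^ 2 * Real.log (5 / (2 * β)) ≤ σX ^ 2 ∧
        8 / α ^ 2 * (B ^ 2 + 2 * ρ ^ 2 * Real.log (8 * P.m / β)) * Real.log (5 / β) ≤ σu ^ 2 ∧
        P.LocalJDP α β ∧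
        ∀ (f : H), ‖f‖ ≤ B →
        ∀ {Ω : Type*} [mΩ : MeasurableSpace Ω] (μ : Measure Ω) [IsProbabilityMeasure μ]
          (ℱ : Filtration ℕ mΩ) (D : ℕ → Ω → Set (Cube d)) (x : ℕ → Ω → Cube d)
          (ε : ℕ → Ω → ℝ) (N : ℕ → Ω → Sym2 P.Idx → ℝ) (n : ℕ → Ω → P.Idx → ℝ),
          P.IsRun μ f ℱ D x ε N n →
          μ {ω | ¬ P.regret f D x ω ≤
            C * ((T : ℝ) ^ (3 / 4 : ℝ) * (Real.log T) ^ (((d : ℝ) + 2) / 4) *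
              Real.sqrt (maxInfoGain k ρ T / α * Real.log (1 / β) * Real.log (1 / ζ)))}
            ≤ ENNReal.ofReal ζ
:= by
  obtain ⟨c, hc, hcount⟩ := exists_feature_count_le d
  -- The value log(1/q) serves as a lower bound for log(1/β) and log(1/ζ). It is positive as soon as
  -- some β in (0, q] exists.
  obtain ⟨C, hC, hbound⟩ := exists_regret_bound_le hd hk hp hB hρ lam α₀ (Real.log (1 / q)) c
  refine ⟨C, hC, fun T α β ζ hT hα hαα hβ hβq hζ hζq => ?_⟩
  have hq0 : 0 < q := hβ.trans_le hβq
  have hβ1 : β < 1 := hβq.trans_lt hq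
  have hζ1 : ζ < 1 := hζq.trans_lt hq
  set m : ℝ := (⌈6 * Real.log T⌉₊ : ℝ) ^ d with hm
  have hlogT := half_le_log hT
  have hm1 : 1 ≤ m := by
    refine one_le_pow₀ ?_
    have : 0 < ⌈6 * Real.log T⌉₊ := Nat.ceil_pos.2 (by linarith)
    exact_mod_cast this
  set κ := 32 * (2 + α₀) with hκ
  have hκ64 : 64 ≤ κ := by linarith
  set ℓ := Real.log (5 / β) with hℓ
  have hℓ1 : 1 ≤ ℓ := by
    rw [hℓ, Real.le_log_iff_exp_le (by positivity), le_div_iff₀ hβ]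
    nlinarith [Real.exp_one_lt_d9, Real.exp_pos 1]
  set M := B ^ 2 + 2 * ρ ^ 2 * Real.log (8 * m / β) with hM
  have hlog8 : 0 < Real.log (8 / β) := Real.log_pos (by
    rw [lt_div_iff₀ hβ]
    linarith)
  have hlog8m : Real.log (8 / β) ≤ Real.log (8 * m / β) := by
    refine Real.log_le_log (by positivity) ?_
    gcongr
    linarith
  have hM0 : 0 < M := by
    have : 0 < 2 * ρ ^ 2 * Real.log (8 * m / β) := by
      have := hlog8.trans_le hlog8m
      positivity
    nlinarith [sq_nonneg B]
  -- By (a + b)² ≤ 2(a² + b²) and m ≥ 1, the squared truncation level of the rewards is at most 2M,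
  -- so σ_u² can be taken proportional to M.
  have hBM : (B + ρ * Real.sqrt (2 * Real.log (8 / β))) ^ 2 ≤ 2 * M := by
    have h2 : (ρ * Real.sqrt (2 * Real.log (8 / β))) ^ 2 = 2 * ρ ^ 2 * Real.log (8 / β) := by
      rw [mul_pow, Real.sq_sqrt (by positivity)]
      ring
    have h3 := mul_le_mul_of_nonneg_left hlog8m (show 0 ≤ 2 * ρ ^ 2 by positivity)
    have h4 := add_sq_le (a := B) (b := ρ * Real.sqrt (2 * Real.log (8 / β)))
    rw [h2] at h4
    linarith
  have hκM : 4 * κ * (B + ρ * Real.sqrt (2 * Real.log (8 / β))) ^ 2 ≤ 8 * κ * M := by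
    have := mul_le_mul_of_nonneg_left hBM (show 0 ≤ 4 * κ by linarith)
    linarith
  have hκℓ : 2 * κ * ℓ ≤ κ ^ 2 * ℓ ^ 2 :=
    mul_le_mul (by nlinarith) (by nlinarith) (by linarith) (by positivity)
  have h8ℓ : 8 * ℓ ≤ 2 * κ * ℓ := by gcongr; linarith
  have hv0 : 0 < 8 * κ * M * ℓ / α ^ 2 := by positivity
  have hX0 : 0 < κ * ℓ / α := by positivity
  -- Privacy requires only σ_X² ≥ 2κℓ/α². Taking σ_X linear in ℓ cancels the factor ℓ of σ_u² in
  -- σ_u²/σ_X, which keeps the squared width linear in log(1/β).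
  refine ⟨κ * ℓ / α, Real.sqrt (8 * κ * M * ℓ / α ^ 2), hX0, Real.sqrt_pos.2 hv0, ?_⟩
  intro P
  have hPm : (P.m : ℝ) = m := by
    simp [Params.m, Params.mbar, P, hm]
  have hσu : P.σu ^ 2 = 8 * κ * M * ℓ / α ^ 2 := Real.sq_sqrt hv0.le
  have hσX : P.σX ^ 2 = κ ^ 2 * ℓ ^ 2 / α ^ 2 := by
    change (κ * ℓ / α) ^ 2 = _
    rw [div_pow, mul_pow]
  have htuned : IsTuned P α₀ α β (Real.log (1 / q)) c :=
    { two_le := hT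
      α_pos := hα
      α_le := hαα
      β_pos := hβ
      ζ_pos := hζ
      b₀_pos := Real.log_pos ((one_lt_div hq0).2 hq)
      le_log_β := Real.log_le_log (by positivity) (one_div_le_one_div_of_le hβ hβq)
      le_log_ζ := Real.log_le_log (by positivity) (one_div_le_one_div_of_le hζ hζq)
      B_nonneg := hB
      ρ_pos := hρ
      lam_pos := hlam
      one_le := hc
      σX_eq := rfl
      σu_pos := Real.sqrt_pos.2 hv0
      σu_sq := by rw [hPm]; exact hσu
      sqrt_le := by rw [hPm]; exact (hcount T hT).1
      m_le := by rw [hPm]; exact (hcount T hT).2 }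
  refine ⟨?_, ?_, ?_, ?_⟩
  · change _ ≤ P.σX ^ 2
    have h1 : Real.log (5 / (2 * β)) ≤ ℓ := by
      refine Real.log_le_log (by positivity) ?_
      gcongr
      linarith
    rw [hσX, div_mul_eq_mul_div]
    refine div_le_div_of_nonneg_right ?_ (by positivity)
    linarith
  · change _ ≤ P.σu ^ 2
    rw [hPm, hσu, div_mul_eq_mul_div, div_mul_eq_mul_div]
    gcongr
    linarith
  · refine P.localJDP_of_noise htuned.mbar_pos hX0 htuned.σu_pos hρ hα hαα hβ hβ1 ?_ ?_
    · rw [hσX]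
      refine div_le_div_of_nonneg_right ?_ (by positivity)
      exact hκℓ
    · rw [hσu]
      change 4 * κ * (B + ρ * Real.sqrt (2 * Real.log (8 / β))) ^ 2 * ℓ / α ^ 2 ≤ _
      gcongr
  · intro f hf Ω mΩ μ _ ℱ D x ε N n hrun
    have hl : 1 ≤ P.lamMin := htuned.one_le_sqrt.trans htuned.sqrt_le_lamMin
    have hT0 : 0 < P.T := by
      change 0 < T
      omega
    have hprob := Params.IsRun.measure_regret_le P hd hk hp hH hf hrun hT0 htuned.mbar_pos hX0
      htuned.σu_pos hρ hlam hζ hζ1 hl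
    refine (measure_mono fun ω hω => ?_).trans hprob
    rw [Set.mem_ofPred_eq, not_le] at hω ⊢
    exact (hbound P α β htuned rfl rfl rfl rfl).trans_lt hω
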